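/- **Setting.** Let $D\subset[0,r]^d$ be a nonempty compact convex set, let $k:D\times D\to\mathbb R$ be a positive semidefinite kernel with $k(x,x)\le 1$ for all $x\in D$, and let $\sigma>0$, $\varepsilon\in[0,1]$. Let $g_1,g_2,\dots$ be independent Gaussian processes on $D$ with mean $0$ and covariance $k$ (written $\mathcal{GP}(0,k)$), put $f_1=g_1$ and $f_{t+1}=\sqrt{1-\varepsilon}\,f_t+\sqrt{\varepsilon}\,g_{t+1}$ for $t\ge1$. Querying $x_t\in D$ at time $t$ yields $y_t=f_t(x_t)+z_t$, where $z_1,z_2,\dots$ are i.i.d. $\mathcal N(0,\sigma^2)$ and independent of $(g_t)_{t\ge1}$. The cumulative regret is $R_T=\sum_{t=1}^T\big(\max_{x\in D}f_t(x)-f_t(x_t)\big)$. For points $x_1,\dots,x_n\in D$ let $\mathbf K=[k(x_i,x_j)]_{i,j=1}^n$ and $\mathbf k(x)=[k(x_i,x)]_{i=1}^n$; the maximum information gain is $\gamma_n=\max_{x_1,\dots,x_n\in D}\tfrac12\log\det(\mathbf I+\sigma^{-2}\mathbf K)$. **Algorithm (R-GP-UCB, block length $N\ge1$).** At each time $t$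 let $(x_i,y_i)$ be the samples obtained since the last reset, a reset taking place just before each of the times $1,N+1,2N+1,\dots$. With $\mu_{t-1}(x)=\mathbf k(x)^T(\mathbf K+\sigma^2\mathbf I)^{-1}\mathbf y$ and $\sigma_{t-1}^2(x)=k(x,x)-\mathbf k(x)^T(\mathbf K+\sigma^2\mathbf I)^{-1}\mathbf k(x)$ computed from these samples ($\mu_{t-1}=0$, $\sigma_{t-1}^2(x)=k(x,x)$ if there are none), choose $x_t\in\arg\max_{x\in D}\ \mu_{t-1}(x)+\sqrt{\beta_t}\,\sigma_{t-1}(x)$, where ties are broken by a fixed measurable rule, so that $x_t$ is a function of the observations since the last reset. **Theorem.** Suppose that the random functions $g_t$ have almost surely continuously differentiable sample paths on $D$, and that for some $a_0,a_1$ and $b_0,b_1>0$, every $f\sim\mathcal{GP}(0,k)$ with such paths satisfies, for all $L\ge0$ and all $j=1,\dots,d$, $$\Pr\Big(\sup_{x\in D}|f(x)|>L\Big)\le a_0e^{-(L/b_0)^2},\qquad \Pr\Big(\sup_{x\in D}\Big|\frac{\partial f}{\partial x^{(j)}}(x)\Big|>L\Big)\le a_1e^{-(L/b_1)^2}.$$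 Fix $\delta\in(0,1)$, and for $t\ge1$ set $$\beta_t=2\log\frac{2\pi^2t^2}{3\delta}+2d\log\Big(r\,d\,b_1t^2\sqrt{\log\frac{2d\,a_1\pi^2t^2}{3\delta}}\Big),\qquad C_1=\frac{8}{\log(1+\sigma^{-2})}.$$ Then for every $T\ge1$ and $N\ge1$, with probability at least $1-\delta$, $$R_T\le\sqrt{C_1T\beta_T\Big(\frac TN+1\Big)\gamma_N}+2+T\psi_T(N,\varepsilon),$$ where $$\psi_T(N,\varepsilon)=\sqrt{\beta_T\big(3\sigma^{-2}+\sigma^{-4}\big)N^3\varepsilon}+\big(\sigma^{-2}+\sigma^{-4}\big)N^3\varepsilon\,(2+b_0)\sqrt{\log\frac{2(1+a_0)\pi^2T^2}{3\delta}}.$$ (In the degenerate cases in which $\beta_t$ is negative, $\sqrt{\cdot}$ of a negative number is read as $0$; likewise $\log u$ is read as $\log|u|$ and $\log0$ as $0$.) -/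

import Mathlib

open MeasureTheory ProbabilityTheory
open scoped Matrix

noncomputable section

namespace RGPUCB

/-! Time is indexed from `0`: index `s` stands for the time step `t = s + 1`. -/

section Kernel

variable {E : Type*}

/-- The Gram matrix `K = [k(xᵢ, xⱼ)]`. -/
def gram (k : E → E → ℝ) {n : ℕ} (x : Fin n → E) : Matrix (Fin n) (Fin n) ℝ :=
  Matrix.of fun i j => k (x i) (x j)

/-- The vector `k(p) = [k(xᵢ, p)]`. -/
def kvec (k : E → E → ℝ) {n : ℕ} (x : Fin n → E) (p : E) : Fin n → ℝ :=
  fun i => k (x i) p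

/-- Posterior mean `k(p)ᵀ (K + σ² I)⁻¹ y` (it is the prior mean `0` when there are no samples). -/
def postMean (k : E → E → ℝ) (σ : ℝ) {n : ℕ} (x : Fin n → E) (y : Fin n → ℝ) (p : E) : ℝ :=
  kvec k x p ⬝ᵥ ((gram k x + σ ^ 2 • (1 : Matrix (Fin n) (Fin n) ℝ))⁻¹ *ᵥ y)

/-- Posterior variance `k(p, p) - k(p)ᵀ (K + σ² I)⁻¹ k(p)` (it is the prior variance `k(p, p)`
when there are no samples). -/
def postVar (k : E → E → ℝ) (σ : ℝ) {n : ℕ} (x : Fin n → E) (p : E) : ℝ :=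
  k p p - kvec k x p ⬝ᵥ ((gram k x + σ ^ 2 • (1 : Matrix (Fin n) (Fin n) ℝ))⁻¹ *ᵥ kvec k x p)

/-- The upper confidence bound `μ(p) + √β σ(p)`. -/
def ucb (k : E → E → ℝ) (σ β : ℝ) {n : ℕ} (x : Fin n → E) (y : Fin n → ℝ) (p : E) : ℝ :=
  postMean k σ x y p + √β * √(postVar k σ x p)

/-- The mutual information `½ log det (I + σ⁻² K)`. -/
def infoGain (k : E → E → ℝ) (σ : ℝ) {n : ℕ} (x : Fin n → E) : ℝ :=
  1 / 2 * Real.log (1 + (σ ^ 2)⁻¹ • gram k x).det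

/-- The maximum information gain `γ_n` over `n` points of `D`. -/
def maxInfoGain (D : Set E) (k : E → E → ℝ) (σ : ℝ) (n : ℕ) : ℝ :=
  ⨆ x : Fin n → D, infoGain k σ (fun i => (x i : E))

end Kernel

section Model

variable {Ω : Type*} [MeasurableSpace Ω]

/-- `f` is a Gaussian process on `D` with mean zero and covariance kernel `k`. -/
structure IsCenteredGP {E : Type*} (μ : Measure Ω) (D : Set E) (k : E → E → ℝ)
    (f : Ω → E → ℝ) : Prop where
  measurable : ∀ p ∈ D, Measurable fun ω => f ω p
  gaussian : IsGaussianProcess (fun (p : D) ω => f ω p) μ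
  mean : ∀ p ∈ D, ∫ ω, f ω p ∂μ = 0
  cov : ∀ p ∈ D, ∀ q ∈ D, cov[fun ω => f ω p, fun ω => f ω q; μ] = k p q

/-- The sample paths of `f` on `D` are almost surely continuously differentiable. -/
def HasC1Paths {d : ℕ} (μ : Measure Ω) (D : Set (EuclideanSpace ℝ (Fin d)))
    (f : Ω → EuclideanSpace ℝ (Fin d) → ℝ) : Prop :=
  ∀ᵐ ω ∂μ, ContDiffOn ℝ 1 (f ω) D

/-- The `j`-th partial derivative on `D`. -/
def partialD {d : ℕ} (D : Set (EuclideanSpace ℝ (Fin d))) (j : Fin d)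
    (h : EuclideanSpace ℝ (Fin d) → ℝ) (p : EuclideanSpace ℝ (Fin d)) : ℝ :=
  fderivWithin ℝ h D p (EuclideanSpace.single j 1)

/-- For `f ∼ GP(0, k)` with continuously differentiable paths,
`Pr (sup_D |f| > L) ≤ a exp (-(L/b)²)` for all `L ≥ 0`. -/
def SupTail {d : ℕ} (μ : Measure Ω) (D : Set (EuclideanSpace ℝ (Fin d)))
    (k : EuclideanSpace ℝ (Fin d) → EuclideanSpace ℝ (Fin d) → ℝ) (a b : ℝ) : Prop :=
  ∀ f : Ω → EuclideanSpace ℝ (Fin d) → ℝ, IsCenteredGP μ D k f → HasC1Paths μ D f →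
    ∀ L : ℝ, 0 ≤ L →
      μ.real {ω | ∃ p ∈ D, L < |f ω p|} ≤ a * Real.exp (-(L / b) ^ 2)

/-- For `f ∼ GP(0, k)` with continuously differentiable paths,
`Pr (sup_D |∂f/∂x⁽ʲ⁾| > L) ≤ a exp (-(L/b)²)` for all `j` and all `L ≥ 0`. -/
def DerivTail {d : ℕ} (μ : Measure Ω) (D : Set (EuclideanSpace ℝ (Fin d)))
    (k : EuclideanSpace ℝ (Fin d) → EuclideanSpace ℝ (Fin d) → ℝ) (a b : ℝ) : Prop :=
  ∀ f : Ω → EuclideanSpace ℝ (Fin d) → ℝ, IsCenteredGP μ D k f → HasC1Paths μ D f →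
    ∀ j : Fin d, ∀ L : ℝ, 0 ≤ L →
      μ.real {ω | ∃ p ∈ D, L < |partialD D j (f ω) p|} ≤ a * Real.exp (-(L / b) ^ 2)

/-- The time-varying reward functions: `f₁ = g₁`, `f_{t+1} = √(1-ε) f_t + √ε g_{t+1}`. -/
def reward {Ω E : Type*} (ε : ℝ) (g : ℕ → Ω → E → ℝ) : ℕ → Ω → E → ℝ
  | 0 => g 0
  | s + 1 => fun ω p => √(1 - ε) * reward ε g s ω p + √ε * g (s + 1) ω p

/-- The innovations `g₁, g₂, …` are independent with law `GP(0, k)`, the noise variables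
`z₁, z₂, …` are independent with law `N(0, σ²)`, and the noise is independent of the
innovations. -/
structure IsModel {E : Type*} (μ : Measure Ω) (D : Set E) (k : E → E → ℝ) (σ : ℝ)
    (g : ℕ → Ω → E → ℝ) (z : ℕ → Ω → ℝ) : Prop where
  gp : ∀ s, IsCenteredGP μ D k (g s)
  indep_gp : iIndepFun (fun s ω (p : D) => g s ω p) μ
  noise_measurable : ∀ s, Measurable (z s)
  noise_law : ∀ s, μ.map (z s) = gaussianReal 0 (Real.toNNReal (σ ^ 2))
  indep_noise : iIndepFun z μ
  indep : IndepFun (fun ω s (p : D) => g s ω p) (fun ω s => z s ω) μ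

/-- The entries of the sequence `v` recorded before index `s`, since the most recent reset;
resets happen at the indices `0, N, 2N, …`. -/
def sinceReset {α : Type*} (N : ℕ) (v : ℕ → α) (s : ℕ) : Fin (s % N) → α :=
  fun i => v (s - s % N + i)

/-- `x` and `y` are the queries and observations of a run of GP-UCB that is reset every `N` steps,
on the reward functions `f` with observation noise `z`. The query is a maximizer over `D` of the
upper confidence bound computed from the samples since the last reset; ties are broken by a
(measurable) rule, so that the query is a function of the observations since the last reset. -/
structure IsRun {E : Type*} [MeasurableSpace E] (D : Set E) (k : E → E → ℝ) (σ : ℝ) (β : ℕ → ℝ)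
    (N : ℕ) (f : ℕ → Ω → E → ℝ) (z : ℕ → Ω → ℝ) (x : ℕ → Ω → E) (y : ℕ → Ω → ℝ) : Prop where
  mem : ∀ s ω, x s ω ∈ D
  argmax : ∀ s ω, ∀ p ∈ D,
    ucb k σ (β s) (sinceReset N (fun i => x i ω) s) (sinceReset N (fun i => y i ω) s) p ≤
      ucb k σ (β s) (sinceReset N (fun i => x i ω) s) (sinceReset N (fun i => y i ω) s) (x s ω)
  rule : ∀ s, ∃ φ : (Fin (s % N) → ℝ) → E, Measurable φ ∧
    ∀ ω, x s ω = φ (sinceReset N (fun i => y i ω) s)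
  obs : ∀ s ω, y s ω = f s ω (x s ω) + z s ω

/-- The cumulative regret `R_T = ∑_t (max_D f_t - f_t(x_t))` on the outcome `ω`. -/
def regret {Ω E : Type*} (D : Set E) (f : ℕ → Ω → E → ℝ) (x : ℕ → Ω → E) (T : ℕ) (ω : Ω) : ℝ :=
  ∑ s ∈ Finset.range T, (sSup (f s ω '' D) - f s ω (x s ω))

end Model

/-- `β_t`. -/
def beta (d : ℕ) (r a b δ : ℝ) (t : ℕ) : ℝ :=
  2 * Real.log (2 * Real.pi ^ 2 * (t : ℝ) ^ 2 / (3 * δ)) +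
    2 * (d : ℝ) * Real.log (r * d * b * (t : ℝ) ^ 2 *
      √(Real.log (2 * d * a * Real.pi ^ 2 * (t : ℝ) ^ 2 / (3 * δ))))

/-- `ψ_T(N, ε)`, with `βT` the value of `β_T`. -/
def psi (σ a₀ b₀ δ βT : ℝ) (T N : ℕ) (ε : ℝ) : ℝ :=
  √(βT * (3 * (σ ^ 2)⁻¹ + (σ ^ 4)⁻¹) * (N : ℝ) ^ 3 * ε) +
    ((σ ^ 2)⁻¹ + (σ ^ 4)⁻¹) * (N : ℝ) ^ 3 * ε * (2 + b₀) *
      √(Real.log (2 * (1 + a₀) * Real.pi ^ 2 * (T : ℝ) ^ 2 / (3 * δ)))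

end RGPUCB

end

/-! The algorithm computes its posterior as if the reward did not move. The GP-UCB argument is
therefore run with the true posterior of the drifting reward, and the computed posterior is compared
with it. The rewards form one Gaussian process in time and space with covariance √(1-ε)^|s-t| k(p,q)
(`isGaussianProcess_reward`, `cov_reward`), so the true posterior within a block is given by the
same formulas with this kernel in place of k.

Confidence: queries depend on earlier noise, so the sampled values are not a fixed Gaussian vector.
Instead of constructing conditional laws, the joint law of paths and observations is written with
the likelihood as density (`lintegral_observe`). For a fixed observation vector the queries are
fixed points, and the exponential moments of a reward value weighted by the likelihood are those of
the posterior (`lintegral_exp_mul_likelihood`, by Gaussian tilting). Chernoff's bound then gives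
tails exp(-β/2) at any measurable function of the data (`measure_posterior_tail`). Only an upper
bound on a finite grid and a lower bound at the query itself are needed. The value of β_t pays for
the union over the grid, and the derivative tail passes from the grid to D at cost 1/t².

Mismatch: inside a block the two kernels differ by a relative error of at most min(1, Nε/2).
`IsCov.posterior_mismatch` bounds the error of the mean plus the confidence multiplier times the
excess of the true standard deviation by ψ_T/2. This is paid once at the grid point and once at the
query (`ucb_step`).

Summation: a step costs at most 1/t² + 2√β_T σ_{t-1}(x_t) + ψ_T. By Cauchy-Schwarz it remains to sum
the posterior variances. The determinant of I + σ⁻²K is a product over successive posterior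
variances, so each block contributes at most a multiple of γ_N, and at most T/N + 1 blocks are
needed (`IsPosKernel.sum_postVar_le`). -/

noncomputable section

namespace RGPUCB

/-! ### The drifting rewards as a Gaussian process in space and time -/

section RewardLaw

variable {Ω E : Type*} [MeasurableSpace Ω] {μ : Measure Ω} {D : Set E} {k : E → E → ℝ}
  {g : ℕ → Ω → E → ℝ} {ε : ℝ}

/-- A finite index set is enlarged to a product of times and points. There the slices are
independent Gaussian vectors, hence jointly Gaussian, and the wanted marginal is a linear image. -/
theorem isGaussian_of_indep (h : ∀ s, IsCenteredGP μ D k (g s))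
    (hind : iIndepFun (fun s ω (p : D) => g s ω p) μ) :
    IsGaussianProcess (fun (q : ℕ × D) ω => g q.1 ω q.2) μ := by
  classical
  refine ⟨fun I => ?_⟩
  let K := I.image Prod.fst
  let J := I.image Prod.snd
  let X : K → Ω → (J → ℝ) := fun s ω p => g s ω p
  have hX : ∀ s, HasGaussianLaw (X s) μ := fun s => (h s).gaussian.hasGaussianLaw J
  have hXi : iIndepFun X μ :=
    (hind.precomp (g := fun s : K => (s : ℕ)) Subtype.val_injective).comp
      (fun _ v => J.restrict v) (fun _ => by fun_prop)
  let L : (K → J → ℝ) →L[ℝ] (I → ℝ) :=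
    { toFun := fun x q => x ⟨q.1.1, Finset.mem_image_of_mem _ q.2⟩
        ⟨q.1.2, Finset.mem_image_of_mem _ q.2⟩
      map_add' := by intros; ext; simp
      map_smul' := by intros; ext; simp }
  exact (iIndepFun.hasGaussianLaw hX hXi).map_fun L

/-- Only the fact that innovations up to time s enter, and enter linearly, is ever used; the
coefficients themselves are not needed. -/
theorem reward_eq_sum {Ω E : Type*} (ε : ℝ) (g : ℕ → Ω → E → ℝ) (s : ℕ) :
    ∃ c : ℕ → ℝ, ∀ ω p, reward ε g s ω p = ∑ j ∈ Finset.range (s + 1), c j * g j ω p := by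
  induction s with
  | zero => exact ⟨fun _ => 1, fun ω p => by simp [reward]⟩
  | succ s ih =>
    obtain ⟨c, hc⟩ := ih
    refine ⟨fun j => if j = s + 1 then √ε else √(1 - ε) * c j, fun ω p => ?_⟩
    rw [Finset.sum_range_succ]
    simp only [reward, hc, if_true, Finset.mul_sum]
    congr 1
    refine Finset.sum_congr rfl fun j hj => ?_
    rw [if_neg (by simp at hj; omega)]
    ring

theorem isGaussianProcess_reward (h : ∀ s, IsCenteredGP μ D k (g s))
    (hind : iIndepFun (fun s ω (p : D) => g s ω p) μ) :
    IsGaussianProcess (fun (q : ℕ × D) ω => reward ε g q.1 ω q.2) μ := by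
  classical
  refine IsGaussianProcess.of_isGaussianProcess (isGaussian_of_indep h hind) fun q => ?_
  obtain ⟨c, hc⟩ := reward_eq_sum ε g q.1
  refine ⟨(Finset.range (q.1 + 1)).image fun j => (j, q.2), ∑ j : Finset.range (q.1 + 1),
    c j • ContinuousLinearMap.proj ⟨((j : ℕ), q.2), Finset.mem_image_of_mem _ j.2⟩, fun ω => ?_⟩
  rw [hc, ← Finset.sum_attach]
  simp

theorem measurable_reward (h : ∀ s, IsCenteredGP μ D k (g s)) (s : ℕ) {p : E} (hp : p ∈ D) :
    Measurable fun ω => reward ε g s ω p := by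
  obtain ⟨c, hc⟩ := reward_eq_sum ε g s
  simp only [hc]
  exact Finset.measurable_fun_sum _ fun j _ => ((h j).measurable p hp).const_mul _

theorem IsCenteredGP.memLp {f : Ω → E → ℝ} (h : IsCenteredGP μ D k f) {p : E} (hp : p ∈ D) :
    MemLp (fun ω => f ω p) 2 μ :=
  (h.gaussian.hasGaussianLaw_eval ⟨p, hp⟩).memLp_two

theorem memLp_reward (h : ∀ s, IsCenteredGP μ D k (g s))
    (hind : iIndepFun (fun s ω (p : D) => g s ω p) μ) (s : ℕ) {p : E} (hp : p ∈ D) :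
    MemLp (fun ω => reward ε g s ω p) 2 μ :=
  ((isGaussianProcess_reward h hind).hasGaussianLaw_eval (s, ⟨p, hp⟩)).memLp_two

theorem integral_reward [IsProbabilityMeasure μ] (h : ∀ s, IsCenteredGP μ D k (g s)) (s : ℕ)
    {p : E} (hp : p ∈ D) : ∫ ω, reward ε g s ω p ∂μ = 0 := by
  obtain ⟨c, hc⟩ := reward_eq_sum ε g s
  simp only [hc]
  rw [integral_finsetSum _ fun j _ => (((h j).memLp hp).integrable (by norm_num)).const_mul _]
  refine Finset.sum_eq_zero fun j _ => ?_
  rw [integral_const_mul, (h j).mean p hp, mul_zero]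

theorem cov_innovation_reward [IsProbabilityMeasure μ] (h : ∀ s, IsCenteredGP μ D k (g s))
    (hind : iIndepFun (fun s ω (p : D) => g s ω p) μ) {s j : ℕ} (hsj : s < j)
    {p q : E} (hp : p ∈ D) (hq : q ∈ D) :
    cov[fun ω => g j ω p, fun ω => reward ε g s ω q; μ] = 0 := by
  obtain ⟨c, hc⟩ := reward_eq_sum ε g s
  simp only [hc]
  rw [covariance_fun_sum_right' (fun i _ => ((h i).memLp hq).const_mul _) ((h j).memLp hp)]
  refine Finset.sum_eq_zero fun i hi => ?_
  rw [covariance_const_mul_right]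
  have hij : j ≠ i := by simp at hi; omega
  have hm : ∀ p : D, Measurable fun v : D → ℝ => v p := fun p => measurable_pi_apply p
  have := (hind.indepFun hij).comp (φ := fun v : D → ℝ => v ⟨p, hp⟩)
    (ψ := fun v : D → ℝ => v ⟨q, hq⟩) (hm _) (hm _)
  have h0 := this.covariance_eq_zero ((h j).memLp hp) ((h i).memLp hq)
  simp only [Function.comp_def] at h0
  rw [h0, mul_zero]

/-- The squared weights sum to (1-ε) + ε = 1 and the new innovation is uncorrelated with the past,
so the covariance is stationary. This makes the tail hypotheses for GP(0,k) available at every time.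
-/
theorem cov_reward_self [IsProbabilityMeasure μ] (hε : ε ∈ Set.Icc (0 : ℝ) 1)
    (h : ∀ s, IsCenteredGP μ D k (g s))
    (hind : iIndepFun (fun s ω (p : D) => g s ω p) μ) (s : ℕ)
    {p q : E} (hp : p ∈ D) (hq : q ∈ D) :
    cov[fun ω => reward ε g s ω p, fun ω => reward ε g s ω q; μ] = k p q := by
  induction s with
  | zero => exact (h 0).cov p hp q hq
  | succ s ih =>
    have hf : ∀ {p : E}, p ∈ D → MemLp (fun ω => √(1 - ε) * reward ε g s ω p) 2 μ :=
      fun hp => (memLp_reward h hind s hp).const_mul _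
    have hg : ∀ {p : E}, p ∈ D → MemLp (fun ω => √ε * g (s + 1) ω p) 2 μ :=
      fun hp => ((h (s + 1)).memLp hp).const_mul _
    have e1 := cov_innovation_reward (ε := ε) h hind (Nat.lt_succ_self s) hp hq
    have e2 := cov_innovation_reward (ε := ε) h hind (Nat.lt_succ_self s) hq hp
    rw [covariance_comm] at e2
    change cov[(fun ω => √(1 - ε) * reward ε g s ω p) + (fun ω => √ε * g (s + 1) ω p),
      (fun ω => √(1 - ε) * reward ε g s ω q) + (fun ω => √ε * g (s + 1) ω q); μ] = _
    rw [covariance_add_left (hf hp) (hg hp) ((hf hq).add (hg hq)),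
      covariance_add_right (hf hp) (hf hq) (hg hq), covariance_add_right (hg hp) (hf hq) (hg hq)]
    simp only [covariance_const_mul_left, covariance_const_mul_right]
    rw [ih, e1, e2, (h (s + 1)).cov p hp q hq]
    have h1 := Real.mul_self_sqrt (sub_nonneg.2 hε.2)
    have h2 := Real.mul_self_sqrt hε.1
    linear_combination k p q * h1 + k p q * h2

theorem cov_reward_add [IsProbabilityMeasure μ] (hε : ε ∈ Set.Icc (0 : ℝ) 1)
    (h : ∀ s, IsCenteredGP μ D k (g s))
    (hind : iIndepFun (fun s ω (p : D) => g s ω p) μ) (s m : ℕ)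
    {p q : E} (hp : p ∈ D) (hq : q ∈ D) :
    cov[fun ω => reward ε g (s + m) ω p, fun ω => reward ε g s ω q; μ] = √(1 - ε) ^ m * k p q := by
  induction m with
  | zero => simpa using cov_reward_self hε h hind s hp hq
  | succ m ih =>
    change cov[(fun ω => √(1 - ε) * reward ε g (s + m) ω p) + (fun ω => √ε * g (s + m + 1) ω p),
      (fun ω => reward ε g s ω q); μ] = _
    rw [covariance_add_left ((memLp_reward h hind _ hp).const_mul _)
      (((h _).memLp hp).const_mul _) (memLp_reward h hind _ hq), covariance_const_mul_left,
      covariance_const_mul_left, ih, cov_innovation_reward h hind (by omega) hp hq]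
    ring

/-- The distance of two times. -/
def timeDist (s t : ℕ) : ℕ := (s - t) + (t - s)

theorem IsCenteredGP.symm {f : Ω → E → ℝ} (h : IsCenteredGP μ D k f) {p q : E} (hp : p ∈ D)
    (hq : q ∈ D) : k p q = k q p := by
  rw [← h.cov p hp q hq, ← h.cov q hq p hp, covariance_comm]

theorem cov_reward [IsProbabilityMeasure μ] (hε : ε ∈ Set.Icc (0 : ℝ) 1)
    (h : ∀ s, IsCenteredGP μ D k (g s))
    (hind : iIndepFun (fun s ω (p : D) => g s ω p) μ) (s t : ℕ)
    {p q : E} (hp : p ∈ D) (hq : q ∈ D) :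
    cov[fun ω => reward ε g s ω p, fun ω => reward ε g t ω q; μ] =
      √(1 - ε) ^ timeDist s t * k p q := by
  rcases le_total t s with hts | hts
  · obtain ⟨m, rfl⟩ := Nat.exists_eq_add_of_le hts
    rw [cov_reward_add hε h hind t m hp hq]
    simp [timeDist]
  · obtain ⟨m, rfl⟩ := Nat.exists_eq_add_of_le hts
    rw [covariance_comm, cov_reward_add hε h hind s m hq hp, (h 0).symm hq hp]
    simp [timeDist]

theorem isCenteredGP_reward [IsProbabilityMeasure μ] (hε : ε ∈ Set.Icc (0 : ℝ) 1)
    (h : ∀ s, IsCenteredGP μ D k (g s))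
    (hind : iIndepFun (fun s ω (p : D) => g s ω p) μ) (s : ℕ) :
    IsCenteredGP μ D k (reward ε g s) where
  measurable _ hp := measurable_reward h s hp
  gaussian := (isGaussianProcess_reward h hind).comp_right fun p : D => (s, p)
  mean _ hp := integral_reward h s hp
  cov _ hp _ hq := cov_reward_self hε h hind s hp hq

theorem hasC1Paths_reward {d : ℕ} {D : Set (EuclideanSpace ℝ (Fin d))}
    {g : ℕ → Ω → EuclideanSpace ℝ (Fin d) → ℝ} (h : ∀ s, HasC1Paths μ D (g s)) (s : ℕ) :
    HasC1Paths μ D (reward ε g s) := by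
  induction s with
  | zero => exact h 0
  | succ s ih =>
    have := h (s + 1)
    unfold HasC1Paths at ih this ⊢
    filter_upwards [ih, this] with ω h1 h2
    exact (contDiffOn_const.mul h1).add (contDiffOn_const.mul h2)

/-- Covariance matrices of square integrable variables are positive semidefinite. -/
theorem sum_cov_nonneg [IsProbabilityMeasure μ] {ι : Type*} [Fintype ι] {X : ι → Ω → ℝ}
    (hX : ∀ i, MemLp (X i) 2 μ) (c : ι → ℝ) :
    0 ≤ ∑ i, ∑ j, c i * c j * cov[X i, X j; μ] := by
  have : cov[fun ω => ∑ i, c i * X i ω, fun ω => ∑ i, c i * X i ω; μ]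
      = ∑ i, ∑ j, c i * c j * cov[X i, X j; μ] := by
    rw [covariance_fun_sum_fun_sum (fun i => (hX i).const_mul _) (fun i => (hX i).const_mul _)]
    simp only [covariance_const_mul_left, covariance_const_mul_right]
    exact Finset.sum_congr rfl fun i _ => Finset.sum_congr rfl fun j _ => by ring
  rw [← this, covariance_self (Finset.aemeasurable_fun_sum _ fun i _ =>
    ((hX i).aestronglyMeasurable.aemeasurable.const_mul _))]
  exact variance_nonneg _ _

end RewardLaw

/-! ### Gaussian tilting and posterior tails without conditional distributions -/

section Conditioning

open ENNReal NNReal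

theorem gaussianPDF_add_left (m h y : ℝ) {v : ℝ≥0} (hv : v ≠ 0) :
    gaussianPDF (m + h) v y =
      gaussianPDF m v y * ENNReal.ofReal (Real.exp ((h * (y - m) - h ^ 2 / 2) / v)) := by
  have hv' : (v : ℝ) ≠ 0 := by exact_mod_cast hv
  rw [gaussianPDF, gaussianPDF, ← ENNReal.ofReal_mul (gaussianPDFReal_nonneg _ _ _),
    gaussianPDFReal, gaussianPDFReal, mul_assoc (√_)⁻¹, ← Real.exp_add]
  congr 3
  field_simp
  ring

/-- Completing the square: exp(l) times the N(0,v) density is exp(v/2) times the N(v,v) density. -/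
theorem lintegral_exp_mul_gaussianReal (v : ℝ≥0) {H : ℝ → ℝ≥0∞} (hH : Measurable H) :
    ∫⁻ l, ENNReal.ofReal (Real.exp l) * H l ∂gaussianReal 0 v =
      ENNReal.ofReal (Real.exp (v / 2)) * ∫⁻ l, H (l + v) ∂gaussianReal 0 v := by
  by_cases hv : v = 0
  · subst hv
    simp
  have e1 : ∫⁻ l, H (l + v) ∂gaussianReal 0 v = ∫⁻ l, H l ∂gaussianReal (0 + v) v := by
    rw [← gaussianReal_map_add_const, lintegral_map hH (by fun_prop)]
  have hv' : (v : ℝ) ≠ 0 := by exact_mod_cast hv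
  rw [e1, gaussianReal_of_var_ne_zero _ hv, gaussianReal_of_var_ne_zero _ hv,
    lintegral_withDensity_eq_lintegral_mul _ (measurable_gaussianPDF _ _) (by fun_prop),
    lintegral_withDensity_eq_lintegral_mul _ (measurable_gaussianPDF _ _) hH,
    ← lintegral_const_mul _ (by fun_prop)]
  refine lintegral_congr fun l => ?_
  simp only [Pi.mul_apply]
  rw [gaussianPDF_add_left _ _ _ hv, ← mul_assoc, ← mul_assoc,
    mul_comm (ENNReal.ofReal (Real.exp (v / 2))), mul_assoc (gaussianPDF 0 v l) (ENNReal.ofReal _)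
      (ENNReal.ofReal _), ← ENNReal.ofReal_mul (Real.exp_nonneg _), ← Real.exp_add]
  congr 4
  field_simp
  ring

variable {Ω : Type*} [MeasurableSpace Ω] {μ : Measure Ω} [IsProbabilityMeasure μ]

/-- Tilting a centered Gaussian vector by the exponential of a linear functional shifts its law by
the covariances with that functional. -/
theorem lintegral_exp_mul_gaussian {n : ℕ} {U : Fin n → Ω → ℝ} {l : Ω → ℝ}
    (hlU : HasGaussianLaw (fun ω => (l ω, fun i => U i ω)) μ) (hl : Measurable l)
    (hU : ∀ i, Measurable (U i)) (hl0 : ∫ ω, l ω ∂μ = 0)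
    {G : (Fin n → ℝ) → ℝ≥0∞} (hG : Measurable G) :
    ∫⁻ ω, ENNReal.ofReal (Real.exp (l ω)) * G (fun i => U i ω) ∂μ =
      ENNReal.ofReal (Real.exp (Var[l; μ] / 2)) *
        ∫⁻ ω, G (fun i => U i ω + cov[l, U i; μ]) ∂μ := by
  set v : ℝ := Var[l; μ] with hv
  set c : Fin n → ℝ := fun i => cov[l, U i; μ] with hc
  have hlm : MemLp l 2 μ := hlU.fst.memLp_two
  have hUm : ∀ i, MemLp (U i) 2 μ := fun i => (hlU.snd.eval i).memLp_two
  have hv0 : 0 ≤ v := variance_nonneg _ _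
  -- If v = 0, then l vanishes almost surely and so do its covariances. With the convention c i / 0
  -- = 0, the identity `hcc` therefore holds in all cases.
  have hcv : v = 0 → ∀ i, c i = 0 := by
    intro h i
    have h0 : l =ᵐ[μ] fun _ => 0 := by
      have := ae_eq_integral_of_variance_eq_zero hlm h
      rwa [hl0] at this
    simp only [hc, covariance, hl0]
    refine integral_eq_zero_of_ae ?_
    filter_upwards [h0] with ω hω
    simp [hω]
  have hcc : ∀ i, c i / v * v = c i := by
    intro i
    by_cases h : v = 0
    · simp [hcv h]
    · field_simp
  -- Residuals of the regression of U on l. They are uncorrelated with l, hence independent of it by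
  -- joint Gaussianity, so the tilt acts on l alone.
  let R : Fin n → Ω → ℝ := fun i ω => U i ω - c i / v * l ω
  have hR : ∀ i, Measurable (R i) := fun i => (hU i).sub (hl.const_mul _)
  have hind : IndepFun (fun ω (_ : Unit) => l ω) (fun ω i => R i ω) μ := by
    refine HasGaussianLaw.indepFun_of_covariance_eval (X := fun _ : Unit => l) ?_ ?_
    · let L : (ℝ × (Fin n → ℝ)) →L[ℝ] (Unit → ℝ) × (Fin n → ℝ) :=
        (ContinuousLinearMap.pi fun _ => ContinuousLinearMap.fst ℝ ℝ (Fin n → ℝ)).prod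
          (ContinuousLinearMap.pi fun i =>
            (ContinuousLinearMap.proj i).comp (ContinuousLinearMap.snd ℝ ℝ (Fin n → ℝ)) -
              (c i / v) • ContinuousLinearMap.fst ℝ ℝ (Fin n → ℝ))
      exact hlU.map_fun L
    · intro _ i
      change cov[l, fun ω => U i ω - c i / v * l ω; μ] = 0
      rw [covariance_fun_sub_right hlm (hUm i) (hlm.const_mul _), covariance_const_mul_right,
        covariance_self hl.aemeasurable, ← hv, hcc]
      simp [hc]
  have hind' : IndepFun l (fun ω i => R i ω) μ :=
    hind.comp (φ := fun u : Unit → ℝ => u ()) (ψ := id) (measurable_pi_apply _) measurable_id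
  have hRm : Measurable fun ω i => R i ω := measurable_pi_lambda _ hR
  have hmap := (indepFun_iff_map_prod_eq_prod_map_map hl.aemeasurable hRm.aemeasurable).1 hind'
  have hlaw : μ.map l = gaussianReal 0 v.toNNReal := by
    rw [hlU.fst.map_eq_gaussianReal, hl0]
  have hshift : Measurable fun p : ℝ × (Fin n → ℝ) => fun i => p.2 i + c i / v * p.1 := by
    fun_prop
  have hΨ : Measurable fun p : ℝ × (Fin n → ℝ) =>
      ENNReal.ofReal (Real.exp p.1) * G (fun i => p.2 i + c i / v * p.1) :=
    (by fun_prop : Measurable fun p : ℝ × (Fin n → ℝ) => ENNReal.ofReal (Real.exp p.1)).mul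
      (hG.comp hshift)
  have hΘ : Measurable fun p : ℝ × (Fin n → ℝ) =>
      G (fun i => p.2 i + c i / v * (p.1 + v)) := by
    refine hG.comp ?_
    fun_prop
  have e1 : ∫⁻ ω, ENNReal.ofReal (Real.exp (l ω)) * G (fun i => U i ω) ∂μ =
      ∫⁻ p, ENNReal.ofReal (Real.exp p.1) * G (fun i => p.2 i + c i / v * p.1)
        ∂(μ.map fun ω => (l ω, fun i => R i ω)) := by
    rw [lintegral_map hΨ (hl.prodMk hRm)]
    simp [R]
  have e2 : ∫⁻ ω, G (fun i => U i ω + c i) ∂μ =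
      ∫⁻ p, G (fun i => p.2 i + c i / v * (p.1 + v))
        ∂(μ.map fun ω => (l ω, fun i => R i ω)) := by
    rw [lintegral_map hΘ (hl.prodMk hRm)]
    refine lintegral_congr fun ω => ?_
    congr 1
    ext i
    simp only [R]
    rw [mul_add, hcc]
    ring
  rw [e1, e2, hmap, hlaw, lintegral_prod_symm' _ hΨ, lintegral_prod_symm' _ hΘ,
    ← lintegral_const_mul _ hΘ.lintegral_prod_left']
  refine lintegral_congr fun u => ?_
  have := lintegral_exp_mul_gaussianReal v.toNNReal
    (H := fun t => G (fun i => u i + c i / v * t)) (hG.comp (by fun_prop))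
  simpa [Real.coe_toNNReal _ hv0] using this

/-- The exponential moments of a Gaussian variable `V` under the likelihood of the noisy
observations `y` of Gaussian variables `U i` are those of the posterior law. -/
theorem lintegral_exp_mul_likelihood {n : ℕ} {U : Fin n → Ω → ℝ} {V : Ω → ℝ}
    (hVU : HasGaussianLaw (fun ω => (V ω, fun i => U i ω)) μ) (hV : Measurable V)
    (hU : ∀ i, Measurable (U i)) (hV0 : ∫ ω, V ω ∂μ = 0) (hU0 : ∀ i, ∫ ω, U i ω ∂μ = 0)
    {v : ℝ≥0} (hv : v ≠ 0) {w : Fin n → ℝ}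
    (hw : ∀ i, ∑ j, cov[U i, U j; μ] * w j + v * w i = cov[U i, V; μ])
    (y : Fin n → ℝ) (lam : ℝ) :
    ∫⁻ ω, ENNReal.ofReal (Real.exp (lam * (V ω - ∑ i, w i * y i))) *
        ∏ i, gaussianPDF (U i ω) v (y i) ∂μ =
      ENNReal.ofReal (Real.exp (lam ^ 2 * (Var[V; μ] - ∑ i, w i * cov[U i, V; μ]) / 2)) *
        ∫⁻ ω, ∏ i, gaussianPDF (U i ω) v (y i) ∂μ := by
  have hv' : (v : ℝ) ≠ 0 := by exact_mod_cast hv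
  have hVm : MemLp V 2 μ := hVU.fst.memLp_two
  have hUm : ∀ i, MemLp (U i) 2 μ := fun i => (hVU.snd.eval i).memLp_two
  -- The exponent splits into l plus a function of U. By the normal equations `hw`, tilting by l
  -- shifts U i by lam * v * w i. The resulting change of the Gaussian likelihood cancels the
  -- remaining linear factor in U, up to a constant.
  let l : Ω → ℝ := fun ω => lam * (V ω - ∑ i, w i * U i ω)
  have hsum : MemLp (fun ω => ∑ i, w i * U i ω) 2 μ :=
    memLp_finsetSum _ fun i _ => (hUm i).const_mul _
  have hl : Measurable l := by
    have : Measurable fun ω => ∑ i, w i * U i ω :=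
      Finset.measurable_fun_sum _ fun i _ => (hU i).const_mul _
    exact (hV.sub this).const_mul _
  have hlU : HasGaussianLaw (fun ω => (l ω, fun i => U i ω)) μ := by
    let L : (ℝ × (Fin n → ℝ)) →L[ℝ] ℝ × (Fin n → ℝ) :=
      (lam • (ContinuousLinearMap.fst ℝ ℝ (Fin n → ℝ) -
        ∑ i, w i • (ContinuousLinearMap.proj i).comp
          (ContinuousLinearMap.snd ℝ ℝ (Fin n → ℝ)))).prod (ContinuousLinearMap.snd ℝ _ _)
    refine (hVU.map_fun L).congr (Filter.Eventually.of_forall fun ω => ?_)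
    simp [L, l]
  have hl0 : ∫ ω, l ω ∂μ = 0 := by
    simp only [l]
    rw [integral_const_mul, integral_sub (hVm.integrable (by norm_num))
      (hsum.integrable (by norm_num)), hV0,
      integral_finsetSum _ fun i _ => ((hUm i).integrable (by norm_num)).const_mul _]
    simp [integral_const_mul, hU0]
  have hcov : ∀ i, cov[l, U i; μ] = lam * v * w i := by
    intro i
    simp only [l]
    rw [covariance_const_mul_left, covariance_fun_sub_left hVm hsum (hUm i),
      covariance_fun_sum_left (fun j => (hUm j).const_mul _) (hUm i), covariance_comm, ← hw i]
    simp only [covariance_const_mul_left, covariance_comm (U i)]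
    rw [Finset.sum_congr rfl fun j _ => mul_comm (w j) _]
    ring
  have hvar : Var[l; μ] = lam ^ 2 * (Var[V; μ] - ∑ i, w i * cov[U i, V; μ])
      - lam ^ 2 * v * ∑ i, w i ^ 2 := by
    rw [← covariance_self hl.aemeasurable]
    conv_lhs => arg 2; simp only [l]
    rw [covariance_const_mul_right, covariance_fun_sub_right hlU.fst.memLp_two hVm hsum,
      covariance_fun_sum_right (fun j => (hUm j).const_mul _) hlU.fst.memLp_two]
    simp only [covariance_const_mul_right, hcov]
    simp only [l]
    rw [covariance_const_mul_left, covariance_fun_sub_left hVm hsum hVm,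
      covariance_fun_sum_left (fun j => (hUm j).const_mul _) hVm, covariance_self hV.aemeasurable]
    simp only [covariance_const_mul_left]
    have : ∑ i, w i * (lam * v * w i) = lam * v * ∑ i, w i ^ 2 := by
      rw [Finset.mul_sum]; exact Finset.sum_congr rfl fun i _ => by ring
    rw [this]
    ring
  let G : (Fin n → ℝ) → ℝ≥0∞ := fun u =>
    ENNReal.ofReal (Real.exp (lam * (∑ i, w i * u i - ∑ i, w i * y i))) *
      ∏ i, gaussianPDF (u i) v (y i)
  have hpdf : Measurable fun u : Fin n → ℝ => ∏ i, gaussianPDF (u i) v (y i) :=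
    Finset.measurable_fun_prod _ fun i _ => by fun_prop
  have hG : Measurable G := (by fun_prop : Measurable fun u : Fin n → ℝ =>
    ENNReal.ofReal (Real.exp (lam * (∑ i, w i * u i - ∑ i, w i * y i)))).mul hpdf
  have e1 : ∀ ω, ENNReal.ofReal (Real.exp (lam * (V ω - ∑ i, w i * y i))) *
      ∏ i, gaussianPDF (U i ω) v (y i) =
      ENNReal.ofReal (Real.exp (l ω)) * G (fun i => U i ω) := by
    intro ω
    simp only [G]
    rw [← mul_assoc, ← ENNReal.ofReal_mul (Real.exp_nonneg _), ← Real.exp_add]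
    congr 3
    simp only [l]
    ring
  have e2 : ∀ ω, G (fun i => U i ω + cov[l, U i; μ]) =
      ENNReal.ofReal (Real.exp (lam ^ 2 * v * (∑ i, w i ^ 2) / 2)) *
        ∏ i, gaussianPDF (U i ω) v (y i) := by
    intro ω
    simp only [G, hcov, gaussianPDF_add_left _ _ _ hv, Finset.prod_mul_distrib]
    rw [← ENNReal.ofReal_prod_of_nonneg fun i _ => Real.exp_nonneg _, ← Real.exp_sum, mul_comm,
      mul_assoc, ← ENNReal.ofReal_mul (Real.exp_nonneg _), ← Real.exp_add, mul_comm]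
    congr 3
    have : ∀ i, (lam * v * w i * (y i - U i ω) - (lam * v * w i) ^ 2 / 2) / v =
        lam * (w i * y i) - lam * (w i * U i ω) - lam ^ 2 * v / 2 * w i ^ 2 := by
      intro i; field_simp
    simp only [this, mul_add, Finset.sum_add_distrib, Finset.sum_sub_distrib, ← Finset.mul_sum]
    have h3 : ∑ i, w i * (lam * v * w i) = lam * v * ∑ i, w i ^ 2 := by
      rw [Finset.mul_sum]; exact Finset.sum_congr rfl fun i _ => by ring
    rw [h3]
    ring
  simp only [e1]
  rw [lintegral_exp_mul_gaussian hlU hl hU hl0 hG]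
  simp only [e2]
  have hp : Measurable fun ω => ∏ i, gaussianPDF (U i ω) v (y i) :=
    hpdf.comp (measurable_pi_lambda _ hU)
  rw [lintegral_const_mul _ hp, ← mul_assoc,
    ← ENNReal.ofReal_mul (Real.exp_nonneg _), ← Real.exp_add, hvar]
  congr 3
  ring

theorem lintegral_likelihood_lt_top {n : ℕ} (U : Fin n → Ω → ℝ) (v : ℝ≥0) (y : Fin n → ℝ) :
    ∫⁻ ω, ∏ i, gaussianPDF (U i ω) v (y i) ∂μ < ∞ := by
  have hle : ∀ m t, gaussianPDF m v t ≤ ENNReal.ofReal (√(2 * Real.pi * v))⁻¹ := by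
    intro m t
    refine ENNReal.ofReal_le_ofReal ?_
    rw [gaussianPDFReal]
    refine mul_le_of_le_one_right (by positivity) (Real.exp_le_one_iff.2 ?_)
    rw [neg_div]
    exact neg_nonpos.2 (by positivity)
  calc ∫⁻ ω, ∏ i, gaussianPDF (U i ω) v (y i) ∂μ
      ≤ ∫⁻ _, (ENNReal.ofReal (√(2 * Real.pi * v))⁻¹) ^ n ∂μ := by
        refine lintegral_mono fun ω => ?_
        calc ∏ i, gaussianPDF (U i ω) v (y i)
            ≤ ∏ _i : Fin n, ENNReal.ofReal (√(2 * Real.pi * v))⁻¹ :=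
              Finset.prod_le_prod' fun i _ => hle _ _
          _ = _ := by simp
    _ < ∞ := by
        rw [lintegral_const, measure_univ, mul_one]
        exact ENNReal.pow_lt_top ENNReal.ofReal_lt_top

/-- Posterior tail bound: under the likelihood of the observations `y`, the variable `V` deviates
from its posterior mean by more than `√b` posterior standard deviations with relative weight at
most `exp (-b / 2)`. -/
theorem lintegral_indicator_likelihood_le {n : ℕ} {U : Fin n → Ω → ℝ} {V : Ω → ℝ}
    (hVU : HasGaussianLaw (fun ω => (V ω, fun i => U i ω)) μ) (hV : Measurable V)
    (hU : ∀ i, Measurable (U i)) (hV0 : ∫ ω, V ω ∂μ = 0) (hU0 : ∀ i, ∫ ω, U i ω ∂μ = 0)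
    {v : ℝ≥0} (hv : v ≠ 0) {w : Fin n → ℝ}
    (hw : ∀ i, ∑ j, cov[U i, U j; μ] * w j + v * w i = cov[U i, V; μ])
    (y : Fin n → ℝ) {c b : ℝ} (hc : c ^ 2 = 1) (hb : 0 ≤ b) :
    ∫⁻ ω, {ω | √b * √(Var[V; μ] - ∑ i, w i * cov[U i, V; μ]) <
        c * (V ω - ∑ i, w i * y i)}.indicator (fun ω => ∏ i, gaussianPDF (U i ω) v (y i)) ω ∂μ ≤
      ENNReal.ofReal (Real.exp (-b / 2)) * ∫⁻ ω, ∏ i, gaussianPDF (U i ω) v (y i) ∂μ := by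
  set S := Var[V; μ] - ∑ i, w i * cov[U i, V; μ] with hS
  set L : Ω → ℝ≥0∞ := fun ω => ∏ i, gaussianPDF (U i ω) v (y i) with hL
  set X : Ω → ℝ := fun ω => c * (V ω - ∑ i, w i * y i) with hX
  have hXm : Measurable X := (hV.sub_const _).const_mul _
  have hLm : Measurable L := Finset.measurable_fun_prod _ fun i _ => by
    have := hU i
    fun_prop
  have hmom : ∀ lam : ℝ, ∫⁻ ω, ENNReal.ofReal (Real.exp (lam * X ω)) * L ω ∂μ =
      ENNReal.ofReal (Real.exp (lam ^ 2 * S / 2)) * ∫⁻ ω, L ω ∂μ := by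
    intro lam
    have := lintegral_exp_mul_likelihood hVU hV hU hV0 hU0 hv hw y (lam * c)
    rw [mul_pow, hc, mul_one] at this
    rw [← this]
    refine lintegral_congr fun ω => ?_
    simp only [hX, hL, mul_assoc]
  have hcher : ∀ lam η : ℝ, 0 ≤ lam →
      ∫⁻ ω, {ω | η < X ω}.indicator L ω ∂μ ≤
        ENNReal.ofReal (Real.exp (-(lam * η) + lam ^ 2 * S / 2)) * ∫⁻ ω, L ω ∂μ := by
    intro lam η hlam
    rw [Real.exp_add, ENNReal.ofReal_mul (Real.exp_nonneg _), mul_assoc, ← hmom,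
      ← lintegral_const_mul _ (by fun_prop)]
    refine lintegral_mono fun ω => ?_
    by_cases h : η < X ω
    · rw [Set.indicator_of_mem (by exact h), ← mul_assoc, ← ENNReal.ofReal_mul (Real.exp_nonneg _),
        ← Real.exp_add]
      refine le_mul_of_one_le_left (zero_le) ?_
      rw [ENNReal.one_le_ofReal]
      exact Real.one_le_exp (by nlinarith)
    · rw [Set.indicator_of_notMem (by exact h)]
      exact zero_le
  rcases le_or_gt S 0 with h | h
  -- Here the threshold is 0. Letting lam tend to infinity in the Chernoff bound kills the weight of
  -- {X > 1/(k+1)} for every k; finiteness of the likelihood integral rules out 0 * ∞ in the limit.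
  · rw [Real.sqrt_eq_zero_of_nonpos h, mul_zero]
    have hzero : ∀ k : ℕ, ∀ᵐ ω ∂μ, {ω | 1 / ((k : ℝ) + 1) < X ω}.indicator L ω = 0 := by
      intro k
      have hk : (0 : ℝ) < 1 / ((k : ℝ) + 1) := by positivity
      refine (lintegral_eq_zero_iff (hLm.indicator (measurableSet_lt (by fun_prop) hXm))).1 ?_
      refine le_antisymm ?_ zero_le
      have hlim : Filter.Tendsto (fun lam : ℝ =>
          ENNReal.ofReal (Real.exp (-(lam * (1 / ((k : ℝ) + 1))))) * ∫⁻ ω, L ω ∂μ)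
          Filter.atTop (nhds (0 * ∫⁻ ω, L ω ∂μ)) := by
        refine ENNReal.Tendsto.mul_const ?_ (Or.inr (lintegral_likelihood_lt_top U v y).ne)
        rw [← ENNReal.ofReal_zero]
        refine (ENNReal.continuous_ofReal.tendsto 0).comp ?_
        refine Real.tendsto_exp_neg_atTop_nhds_zero.comp ?_
        exact Filter.tendsto_id.atTop_mul_const hk
      rw [zero_mul] at hlim
      refine ge_of_tendsto hlim ?_
      filter_upwards [Filter.eventually_ge_atTop 0] with lam hlam
      refine (hcher lam _ hlam).trans ?_
      gcongr
      nlinarith [sq_nonneg lam]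
    refine le_of_eq_of_le ((lintegral_eq_zero_iff
      (hLm.indicator (measurableSet_lt measurable_const hXm))).2 ?_) zero_le
    filter_upwards [ae_all_iff.2 hzero] with ω hω
    by_cases hpos : 0 < X ω
    · obtain ⟨k, hk⟩ := exists_nat_one_div_lt hpos
      have := hω k
      rw [Set.indicator_of_mem (by exact hk)] at this
      rw [Set.indicator_of_mem (by exact hpos), this]
      rfl
    · rw [Set.indicator_of_notMem (by exact hpos)]
      rfl
  -- The optimal exponent: it gives -b + b/2.
  · refine (hcher (√b / √S) _ (by positivity)).trans (le_of_eq ?_)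
    congr 3
    have h1 := Real.sq_sqrt hb
    have h2 := Real.sq_sqrt h.le
    have h3 : √S ≠ 0 := (Real.sqrt_pos.2 h).ne'
    have h4 : √b / √S * (√b * √S) = b := by
      rw [div_mul_eq_mul_div, div_eq_iff h3]
      linear_combination √S * h1
    rw [h4, div_pow, h1, h2]
    field_simp
    ring

end Conditioning

/-! ### The joint law of reward paths and adaptively collected observations -/

section Adaptive

open ENNReal NNReal

/-- Associativity of product measures. It makes a new noise variable independent of the paths and
the earlier noise taken together. -/
theorem indepFun_prodMk_of_prodMk {Ω A B C : Type*} [MeasurableSpace Ω] [MeasurableSpace A]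
    [MeasurableSpace B] [MeasurableSpace C] {μ : Measure Ω} [IsProbabilityMeasure μ]
    {a : Ω → A} {b : Ω → B} {c : Ω → C} (ha : Measurable a) (hb : Measurable b) (hc : Measurable c)
    (h : IndepFun a (fun ω => (b ω, c ω)) μ) (hbc : IndepFun b c μ) :
    IndepFun (fun ω => (a ω, b ω)) c μ := by
  have := Measure.isProbabilityMeasure_map (μ := μ) ha.aemeasurable
  have := Measure.isProbabilityMeasure_map (μ := μ) hb.aemeasurable
  have := Measure.isProbabilityMeasure_map (μ := μ) hc.aemeasurable
  have hab : IndepFun a b μ := h.comp measurable_id measurable_fst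
  rw [indepFun_iff_map_prod_eq_prod_map_map (ha.prodMk hb).aemeasurable hc.aemeasurable,
    (indepFun_iff_map_prod_eq_prod_map_map ha.aemeasurable hb.aemeasurable).1 hab,
    ← (measurePreserving_prodAssoc _ _ _).symm.map_eq,
    ← (indepFun_iff_map_prod_eq_prod_map_map hb.aemeasurable hc.aemeasurable).1 hbc,
    ← (indepFun_iff_map_prod_eq_prod_map_map ha.aemeasurable (hb.prodMk hc).aemeasurable).1 h,
    Measure.map_map (by fun_prop) (by fun_prop)]
  rfl

/-- Lebesgue measure on the space of `n` observations. -/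
def obsMeasure : (n : ℕ) → Measure (Fin n → ℝ)
  | 0 => Measure.dirac default
  | n + 1 => ((obsMeasure n).prod volume).map fun p => Fin.snoc (α := fun _ => ℝ) p.1 p.2

theorem measurable_snoc (n : ℕ) :
    Measurable fun p : (Fin n → ℝ) × ℝ => Fin.snoc (α := fun _ => ℝ) p.1 p.2 := by
  refine measurable_pi_lambda _ fun i => ?_
  refine Fin.lastCases ?_ (fun i => ?_) i
  · simpa using measurable_snd
  · simp only [Fin.snoc_castSucc]
    exact (measurable_pi_apply i).comp measurable_fst

instance instSFiniteObsMeasure (n : ℕ) : SFinite (obsMeasure n) := by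
  induction n with
  | zero => exact inferInstanceAs (SFinite (Measure.dirac default))
  | succ n ih => exact inferInstanceAs (SFinite (((obsMeasure n).prod volume).map _))

theorem lintegral_obsMeasure_succ {n : ℕ} {f : (Fin (n + 1) → ℝ) → ℝ≥0∞} (hf : Measurable f) :
    ∫⁻ y, f y ∂obsMeasure (n + 1) = ∫⁻ y, ∫⁻ t, f (Fin.snoc y t) ∂volume ∂obsMeasure n := by
  rw [obsMeasure, lintegral_map hf (measurable_snoc n)]
  exact lintegral_prod _ (hf.comp (measurable_snoc n)).aemeasurable

/-- The first `i` entries of `y`. -/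
def initial {n : ℕ} (y : Fin n → ℝ) (i : Fin n) : Fin (i : ℕ) → ℝ :=
  fun j => y ⟨j, j.2.trans i.2⟩

variable {A E : Type*}

/-- The likelihood of the observations `y`, given the reward functions `F · α`, when the queries
follow the rules `φ`. -/
def likelihood (F : ℕ → A → E → ℝ) (φ : (i : ℕ) → (Fin i → ℝ) → E) (v : ℝ≥0) (n : ℕ) (α : A)
    (y : Fin n → ℝ) : ℝ≥0∞ :=
  ∏ i : Fin n, gaussianPDF (F i α (φ i (initial y i))) v (y i)

/-- The observations produced by the rules `φ` on the reward functions `F · α` with noise `ζ`. -/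
def observe (F : ℕ → A → E → ℝ) (φ : (i : ℕ) → (Fin i → ℝ) → E) (α : A) :
    (n : ℕ) → (Fin n → ℝ) → (Fin n → ℝ)
  | 0 => fun _ => default
  | n + 1 => fun ζ => Fin.snoc (α := fun _ => ℝ) (observe F φ α n (Fin.init ζ))
      (F n α (φ n (observe F φ α n (Fin.init ζ))) + ζ (Fin.last n))

theorem likelihood_snoc (F : ℕ → A → E → ℝ) (φ : (i : ℕ) → (Fin i → ℝ) → E) (v : ℝ≥0) (n : ℕ)
    (α : A) (y : Fin n → ℝ) (t : ℝ) :
    likelihood F φ v (n + 1) α (Fin.snoc (α := fun _ => ℝ) y t) =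
      likelihood F φ v n α y * gaussianPDF (F n α (φ n y)) v t := by
  rw [likelihood, Fin.prod_univ_castSucc]
  have h1 : ∀ i : Fin n, initial (Fin.snoc (α := fun _ => ℝ) y t) i.castSucc = initial y i := by
    intro i
    ext j
    simp only [initial]
    have : (⟨j, j.2.trans i.castSucc.2⟩ : Fin (n + 1)) =
      Fin.castSucc ⟨j, j.2.trans i.2⟩ := rfl
    rw [this, Fin.snoc_castSucc]
  have h2 : initial (Fin.snoc (α := fun _ => ℝ) y t) (Fin.last n) = y := by
    ext j
    simp only [initial]
    have : (⟨j, j.2.trans (Fin.last n).2⟩ : Fin (n + 1)) = Fin.castSucc ⟨j, j.2⟩ := rfl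
    rw [this, Fin.snoc_castSucc]
  simp only [h1, Fin.snoc_castSucc, Fin.snoc_last]
  congr 1
  exact congrArg (fun u => gaussianPDF (F n α (φ n u)) v t) h2

variable [MeasurableSpace A] [MeasurableSpace E]

theorem measurable_initial {n : ℕ} (i : Fin n) : Measurable fun y : Fin n → ℝ => initial y i :=
  measurable_pi_lambda _ fun _ => measurable_pi_apply _

theorem measurable_likelihood {F : ℕ → A → E → ℝ} (hF : ∀ i, Measurable fun p : A × E => F i p.1 p.2)
    {φ : (i : ℕ) → (Fin i → ℝ) → E} (hφ : ∀ i, Measurable (φ i)) (v : ℝ≥0) (n : ℕ) :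
    Measurable fun p : A × (Fin n → ℝ) => likelihood F φ v n p.1 p.2 := by
  refine Finset.measurable_fun_prod _ fun i _ => ?_
  have h1 : Measurable fun p : A × (Fin n → ℝ) => F i p.1 (φ i (initial p.2 i)) :=
    (hF i).comp (measurable_fst.prodMk ((hφ i).comp ((measurable_initial i).comp measurable_snd)))
  have h2 : Measurable fun p : A × (Fin n → ℝ) => p.2 i :=
    (measurable_pi_apply i).comp measurable_snd
  exact measurable_uncurry_gaussianPDF.comp (h1.prodMk (measurable_const.prodMk h2))

theorem measurable_likelihood_right {F : ℕ → A → E → ℝ}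
    (hF : ∀ i, Measurable fun p : A × E => F i p.1 p.2)
    {φ : (i : ℕ) → (Fin i → ℝ) → E} (hφ : ∀ i, Measurable (φ i)) (v : ℝ≥0) (n : ℕ) (α : A) :
    Measurable fun y : Fin n → ℝ => likelihood F φ v n α y := by
  have := measurable_likelihood hF hφ v n
  generalize likelihood F φ v n = l at this ⊢
  exact this.comp measurable_prodMk_left

theorem measurable_observe {F : ℕ → A → E → ℝ} (hF : ∀ i, Measurable fun p : A × E => F i p.1 p.2)
    {φ : (i : ℕ) → (Fin i → ℝ) → E} (hφ : ∀ i, Measurable (φ i)) (n : ℕ) :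
    Measurable fun p : A × (Fin n → ℝ) => observe F φ p.1 n p.2 := by
  induction n with
  | zero => exact measurable_const
  | succ n ih =>
    have hinit : Measurable fun p : A × (Fin (n + 1) → ℝ) => (p.1, Fin.init p.2) :=
      measurable_fst.prodMk (measurable_pi_lambda _ fun i =>
        (measurable_pi_apply i.castSucc).comp measurable_snd)
    have h1 : Measurable fun p : A × (Fin (n + 1) → ℝ) => observe F φ p.1 n (Fin.init p.2) :=
      ih.comp hinit
    have h2 : Measurable fun p : A × (Fin (n + 1) → ℝ) =>
        F n p.1 (φ n (observe F φ p.1 n (Fin.init p.2))) + p.2 (Fin.last n) :=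
      ((hF n).comp (measurable_fst.prodMk ((hφ n).comp h1))).add
        ((measurable_pi_apply _).comp measurable_snd)
    exact (measurable_snoc n).comp (h1.prodMk h2)

variable {Ω : Type*} [MeasurableSpace Ω] {μ : Measure Ω} [IsProbabilityMeasure μ]

/-- The joint law of the randomness of the reward functions and of adaptively collected noisy
observations has the likelihood as its density. -/
theorem lintegral_observe {F : ℕ → A → E → ℝ} (hF : ∀ i, Measurable fun p : A × E => F i p.1 p.2)
    {φ : (i : ℕ) → (Fin i → ℝ) → E} (hφ : ∀ i, Measurable (φ i)) {v : ℝ≥0} (hv : v ≠ 0)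
    {a : Ω → A} (ha : Measurable a) {z : ℕ → Ω → ℝ} (hz : ∀ i, Measurable (z i))
    (hlaw : ∀ i, μ.map (z i) = gaussianReal 0 v)
    (hind : ∀ n, IndepFun (fun ω => (a ω, fun i : Fin n => z i ω)) (z n) μ) (n : ℕ)
    {Φ : A × (Fin n → ℝ) → ℝ≥0∞} (hΦ : Measurable Φ) :
    ∫⁻ ω, Φ (a ω, observe F φ (a ω) n fun i => z i ω) ∂μ =
      ∫⁻ ω, ∫⁻ y, Φ (a ω, y) * likelihood F φ v n (a ω) y ∂obsMeasure n ∂μ := by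
  induction n with
  | zero =>
    refine lintegral_congr fun ω => ?_
    rw [obsMeasure, lintegral_dirac]
    simp [likelihood, observe]
  | succ n ih =>
    have hzn : Measurable fun ω => fun i : Fin n => z i ω := measurable_pi_lambda _ fun i => hz i
    let W : Ω → A × (Fin n → ℝ) := fun ω => (a ω, observe F φ (a ω) n fun i => z i ω)
    have hpair : Measurable fun p : A × (Fin n → ℝ) => (p.1, observe F φ p.1 n p.2) :=
      measurable_fst.prodMk (measurable_observe hF hφ n)
    have hW : Measurable W := hpair.comp (ha.prodMk hzn)
    -- The paths and the first n observations involve only earlier noise. Given them, the next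
    -- observation is Gaussian around the value at the next query, which contributes one more
    -- density factor.
    have hWz : IndepFun W (z n) μ := (hind n).comp hpair measurable_id
    have hmap := (indepFun_iff_map_prod_eq_prod_map_map hW.aemeasurable (hz n).aemeasurable).1 hWz
    have hFn : Measurable fun p : A × (Fin n → ℝ) => F n p.1 (φ n p.2) :=
      (hF n).comp (measurable_fst.prodMk ((hφ n).comp measurable_snd))
    let Ψ : (A × (Fin n → ℝ)) × ℝ → ℝ≥0∞ := fun q =>
      Φ (q.1.1, Fin.snoc (α := fun _ => ℝ) q.1.2 q.2)
    have hΨ : Measurable Ψ := hΦ.comp ((measurable_fst.comp measurable_fst).prodMk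
      ((measurable_snoc n).comp ((measurable_snd.comp measurable_fst).prodMk measurable_snd)))
    have hΨs : Measurable fun q : (A × (Fin n → ℝ)) × ℝ =>
        Ψ (q.1, F n q.1.1 (φ n q.1.2) + q.2) :=
      hΨ.comp (measurable_fst.prodMk ((hFn.comp measurable_fst).add measurable_snd))
    have hpdf : Measurable fun q : (A × (Fin n → ℝ)) × ℝ =>
        gaussianPDF (F n q.1.1 (φ n q.1.2)) v q.2 :=
      measurable_uncurry_gaussianPDF.comp ((hFn.comp measurable_fst).prodMk
        (measurable_const.prodMk measurable_snd))
    have e1 : ∫⁻ ω, Φ (a ω, observe F φ (a ω) (n + 1) fun i => z i ω) ∂μ =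
        ∫⁻ ω, ∫⁻ t, Ψ (W ω, F n (W ω).1 (φ n (W ω).2) + t) ∂gaussianReal 0 v ∂μ := by
      have : ∀ ω, Φ (a ω, observe F φ (a ω) (n + 1) fun i => z i ω) =
          Ψ (W ω, F n (W ω).1 (φ n (W ω).2) + z n ω) := fun ω => rfl
      simp only [this]
      rw [← lintegral_map (f := fun q : (A × (Fin n → ℝ)) × ℝ =>
        Ψ (q.1, F n q.1.1 (φ n q.1.2) + q.2)) hΨs (hW.prodMk (hz n)), hmap,
        lintegral_prod _ hΨs.aemeasurable, hlaw, lintegral_map hΨs.lintegral_prod_right' hW]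
    have e2 : ∀ w : A × (Fin n → ℝ), ∫⁻ t, Ψ (w, F n w.1 (φ n w.2) + t) ∂gaussianReal 0 v =
        ∫⁻ t, Ψ (w, t) * gaussianPDF (F n w.1 (φ n w.2)) v t := by
      intro w
      have hw : Measurable fun t => Ψ (w, t) := hΨ.comp (measurable_const.prodMk measurable_id)
      rw [← lintegral_map (f := fun t => Ψ (w, t)) hw (by fun_prop), gaussianReal_map_const_add,
        zero_add, gaussianReal_of_var_ne_zero _ hv,
        lintegral_withDensity_eq_lintegral_mul _ (measurable_gaussianPDF _ _) hw]
      simp only [Pi.mul_apply, mul_comm]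
    rw [e1]
    simp only [e2]
    rw [ih (Φ := fun w => ∫⁻ t, Ψ (w, t) * gaussianPDF (F n w.1 (φ n w.2)) v t)
      (hΨ.mul hpdf).lintegral_prod_right']
    refine lintegral_congr fun ω => ?_
    have h1 : Measurable fun y : Fin (n + 1) → ℝ => Φ (a ω, y) :=
      hΦ.comp (measurable_prodMk_left (x := a ω))
    have h2 := measurable_likelihood_right hF hφ v (n + 1) (a ω)
    rw [lintegral_obsMeasure_succ
      (f := fun y => Φ (a ω, y) * likelihood F φ v (n + 1) (a ω) y) (h1.mul h2)]
    · refine lintegral_congr fun y => ?_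
      have hm : Measurable fun t : ℝ => Ψ ((a ω, y), t) *
          gaussianPDF (F n (a ω, y).1 (φ n (a ω, y).2)) v t :=
        (hΨ.mul hpdf).comp (measurable_prodMk_left (x := (a ω, y)))
      rw [← lintegral_mul_const _ hm]
      refine lintegral_congr fun t => ?_
      rw [likelihood_snoc, mul_assoc]
      simp only [Ψ]
      rw [mul_comm (likelihood F φ v n (a ω) y)]

/-- Exchanging the integrals fixes the observation vector and with it every query, so a bound for
deterministic query points suffices. Integrating back loses nothing because the likelihood has total
mass one. -/
theorem measure_observe_le {F : ℕ → A → E → ℝ} (hF : ∀ i, Measurable fun p : A × E => F i p.1 p.2)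
    {φ : (i : ℕ) → (Fin i → ℝ) → E} (hφ : ∀ i, Measurable (φ i)) {v : ℝ≥0} (hv : v ≠ 0)
    {a : Ω → A} (ha : Measurable a) {z : ℕ → Ω → ℝ} (hz : ∀ i, Measurable (z i))
    (hlaw : ∀ i, μ.map (z i) = gaussianReal 0 v)
    (hind : ∀ n, IndepFun (fun ω => (a ω, fun i : Fin n => z i ω)) (z n) μ) (n : ℕ)
    {S : Set (A × (Fin n → ℝ))} (hS : MeasurableSet S) {C : ℝ≥0∞}
    (hC : ∀ y, ∫⁻ ω, {ω | (a ω, y) ∈ S}.indicator (fun ω => likelihood F φ v n (a ω) y) ω ∂μ ≤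
      C * ∫⁻ ω, likelihood F φ v n (a ω) y ∂μ) :
    μ {ω | (a ω, observe F φ (a ω) n fun i => z i ω) ∈ S} ≤ C := by
  have hzn : Measurable fun ω => fun i : Fin n => z i ω := measurable_pi_lambda _ fun i => hz i
  have hW : Measurable fun ω => (a ω, observe F φ (a ω) n fun i => z i ω) :=
    ha.prodMk ((measurable_observe hF hφ n).comp (ha.prodMk hzn))
  have hlik : Measurable fun p : Ω × (Fin n → ℝ) => likelihood F φ v n (a p.1) p.2 := by
    have := measurable_likelihood hF hφ v n
    generalize likelihood F φ v n = l at this ⊢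
    exact this.comp ((ha.comp measurable_fst).prodMk measurable_snd)
  have hSm : MeasurableSet {p : Ω × (Fin n → ℝ) | (a p.1, p.2) ∈ S} :=
    ((ha.comp measurable_fst).prodMk measurable_snd) hS
  have e1 : μ {ω | (a ω, observe F φ (a ω) n fun i => z i ω) ∈ S} =
      ∫⁻ ω, ∫⁻ y, {p : Ω × (Fin n → ℝ) | (a p.1, p.2) ∈ S}.indicator
        (fun p => likelihood F φ v n (a p.1) p.2) (ω, y) ∂obsMeasure n ∂μ := by
    have := lintegral_observe hF hφ hv ha hz hlaw hind n
      (Φ := S.indicator 1) (measurable_one.indicator hS)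
    refine Eq.trans (lintegral_indicator_one (hW hS)).symm (Eq.trans ?_ (this.trans ?_))
    · rfl
    · refine lintegral_congr fun ω => lintegral_congr fun y => ?_
      by_cases h : (a ω, y) ∈ S
      · rw [Set.indicator_of_mem h, Set.indicator_of_mem (by exact h)]
        simp
      · rw [Set.indicator_of_notMem h, Set.indicator_of_notMem (by exact h), zero_mul]
  have e2 : ∫⁻ ω, ∫⁻ y, likelihood F φ v n (a ω) y ∂obsMeasure n ∂μ = 1 := by
    have := lintegral_observe hF hφ hv ha hz hlaw hind n (Φ := fun _ => 1) measurable_const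
    simp only [one_mul, lintegral_const, measure_univ] at this
    exact this.symm
  rw [e1, lintegral_lintegral_swap (f := fun ω y =>
    {p : Ω × (Fin n → ℝ) | (a p.1, p.2) ∈ S}.indicator
      (fun p => likelihood F φ v n (a p.1) p.2) (ω, y)) (hlik.indicator hSm).aemeasurable]
  calc _ ≤ ∫⁻ y, C * ∫⁻ ω, likelihood F φ v n (a ω) y ∂μ ∂obsMeasure n :=
        lintegral_mono fun y => hC y
    _ = C * ∫⁻ y, ∫⁻ ω, likelihood F φ v n (a ω) y ∂μ ∂obsMeasure n :=
        lintegral_const_mul _ hlik.lintegral_prod_left'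
    _ = C * ∫⁻ ω, ∫⁻ y, likelihood F φ v n (a ω) y ∂obsMeasure n ∂μ := by
        rw [lintegral_lintegral_swap (f := fun ω y => likelihood F φ v n (a ω) y) hlik.aemeasurable]
    _ = C := by rw [e2, mul_one]

end Adaptive

/-! ### Perturbation of posterior means and variances -/

section LinearAlgebra

variable {n : ℕ}

theorem sum_abs_le_sqrt (c : Fin n → ℝ) : ∑ i, |c i| ≤ √n * √(c ⬝ᵥ c) := by
  rw [← Real.sqrt_mul (Nat.cast_nonneg n)]
  refine Real.le_sqrt_of_sq_le ?_
  have := sq_sum_le_card_mul_sum_sq (s := Finset.univ) (f := fun i => |c i|)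
  simpa [dotProduct, pow_two] using this

theorem dotProduct_self_nonneg' (c : Fin n → ℝ) : 0 ≤ c ⬝ᵥ c :=
  Finset.sum_nonneg fun i _ => mul_self_nonneg (c i)

theorem abs_dotProduct_le_sqrt (c d : Fin n → ℝ) : |c ⬝ᵥ d| ≤ √(c ⬝ᵥ c) * √(d ⬝ᵥ d) := by
  rw [← Real.sqrt_mul (dotProduct_self_nonneg' c)]
  refine Real.abs_le_sqrt ?_
  have := Finset.sum_mul_sq_le_sq_mul_sq Finset.univ c d
  simpa [dotProduct, pow_two] using this

theorem sqrt_dotProduct_le {c : Fin n → ℝ} {a : ℝ} (ha : 0 ≤ a) (h : ∀ i, |c i| ≤ a) :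
    √(c ⬝ᵥ c) ≤ √n * a := by
  refine Real.sqrt_le_iff.2 ⟨by positivity, ?_⟩
  rw [mul_pow, Real.sq_sqrt (Nat.cast_nonneg n)]
  calc c ⬝ᵥ c ≤ ∑ _i : Fin n, a ^ 2 := Finset.sum_le_sum fun i _ => by
        rw [← pow_two, ← sq_abs]
        exact pow_le_pow_left₀ (abs_nonneg _) (h i) 2
    _ = n * a ^ 2 := by simp

theorem abs_dotProduct_le_mul_sum {c d : Fin n → ℝ} {a : ℝ} (h : ∀ i, |d i| ≤ a) :
    |c ⬝ᵥ d| ≤ a * ∑ i, |c i| := by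
  rw [Finset.mul_sum]
  refine (Finset.abs_sum_le_sum_abs _ _).trans (Finset.sum_le_sum fun i _ => ?_)
  rw [abs_mul, mul_comm]
  exact mul_le_mul_of_nonneg_right (h i) (abs_nonneg _)

theorem abs_dotProduct_mulVec_le {M : Matrix (Fin n) (Fin n) ℝ} {e : ℝ} (he : 0 ≤ e)
    (hM : ∀ i j, |M i j| ≤ e) (c d : Fin n → ℝ) :
    |c ⬝ᵥ (M *ᵥ d)| ≤ n * e * (√(c ⬝ᵥ c) * √(d ⬝ᵥ d)) := by
  have h1 : ∀ i, |(M *ᵥ d) i| ≤ e * ∑ j, |d j| := by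
    intro i
    have : (M *ᵥ d) i = d ⬝ᵥ M i := by
      rw [Matrix.mulVec, dotProduct_comm]
    rw [this]
    exact abs_dotProduct_le_mul_sum (hM i)
  have hn : √(n : ℝ) * √n = n := Real.mul_self_sqrt (Nat.cast_nonneg n)
  calc |c ⬝ᵥ (M *ᵥ d)| ≤ e * (∑ j, |d j|) * ∑ i, |c i| := abs_dotProduct_le_mul_sum h1
    _ ≤ e * (√n * √(d ⬝ᵥ d)) * (√n * √(c ⬝ᵥ c)) := by
        gcongr
        · exact sum_abs_le_sqrt d
        · exact sum_abs_le_sqrt c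
    _ = _ := by linear_combination e * √(c ⬝ᵥ c) * √(d ⬝ᵥ d) * hn

/-- A symmetric positive semidefinite matrix. -/
structure IsCov (K : Matrix (Fin n) (Fin n) ℝ) : Prop where
  symm : ∀ i j, K i j = K j i
  nonneg : ∀ c : Fin n → ℝ, 0 ≤ c ⬝ᵥ (K *ᵥ c)

variable {K L : Matrix (Fin n) (Fin n) ℝ} {σ : ℝ}

/-- The matrix `K + σ² I`. -/
abbrev reg (K : Matrix (Fin n) (Fin n) ℝ) (σ : ℝ) : Matrix (Fin n) (Fin n) ℝ :=
  K + σ ^ 2 • (1 : Matrix (Fin n) (Fin n) ℝ)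

theorem reg_mulVec (K : Matrix (Fin n) (Fin n) ℝ) (σ : ℝ) (c : Fin n → ℝ) :
    reg K σ *ᵥ c = K *ᵥ c + σ ^ 2 • c := by
  rw [reg, Matrix.add_mulVec, Matrix.smul_mulVec, Matrix.one_mulVec]

theorem IsCov.dotProduct_mulVec_comm (hK : IsCov K) (c d : Fin n → ℝ) :
    c ⬝ᵥ (K *ᵥ d) = (K *ᵥ c) ⬝ᵥ d := by
  have : Kᵀ = K := by
    ext i j
    exact hK.symm j i
  rw [Matrix.dotProduct_mulVec, ← Matrix.mulVec_transpose, this]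

theorem IsCov.reg_dotProduct_comm (hK : IsCov K) (c d : Fin n → ℝ) :
    c ⬝ᵥ (reg K σ *ᵥ d) = (reg K σ *ᵥ c) ⬝ᵥ d := by
  rw [reg_mulVec, reg_mulVec, dotProduct_add, add_dotProduct, hK.dotProduct_mulVec_comm,
    dotProduct_smul, smul_dotProduct]

theorem IsCov.le_reg (hK : IsCov K) (c : Fin n → ℝ) :
    σ ^ 2 * (c ⬝ᵥ c) ≤ c ⬝ᵥ (reg K σ *ᵥ c) := by
  rw [reg_mulVec, dotProduct_add, dotProduct_smul, smul_eq_mul]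
  linarith [hK.nonneg c]

theorem IsCov.isUnit_reg (hK : IsCov K) (hσ : 0 < σ) : IsUnit (reg K σ) := by
  rw [← Matrix.mulVec_injective_iff_isUnit]
  intro c d hcd
  have h0 : reg K σ *ᵥ (c - d) = 0 := by
    rw [Matrix.mulVec_sub]
    exact sub_eq_zero.2 hcd
  have h1 := hK.le_reg (σ := σ) (c - d)
  rw [h0, dotProduct_zero] at h1
  have h2 : (c - d) ⬝ᵥ (c - d) = 0 :=
    le_antisymm (by nlinarith [pow_pos hσ 2]) (dotProduct_self_nonneg' _)
  exact sub_eq_zero.1 (dotProduct_self_eq_zero.1 h2)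

theorem IsCov.reg_mulVec_inv (hK : IsCov K) (hσ : 0 < σ) (y : Fin n → ℝ) :
    reg K σ *ᵥ ((reg K σ)⁻¹ *ᵥ y) = y := by
  rw [Matrix.mulVec_mulVec, Matrix.mul_nonsing_inv _
    ((Matrix.isUnit_iff_isUnit_det _).1 (hK.isUnit_reg hσ)), Matrix.one_mulVec]

theorem IsCov.dotProduct_inv_comm (hK : IsCov K) (hσ : 0 < σ) (c y : Fin n → ℝ) :
    c ⬝ᵥ ((reg K σ)⁻¹ *ᵥ y) = ((reg K σ)⁻¹ *ᵥ c) ⬝ᵥ y := by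
  conv_lhs => rw [← hK.reg_mulVec_inv hσ c]
  conv_rhs => rw [← hK.reg_mulVec_inv hσ y]
  exact (hK.reg_dotProduct_comm _ _).symm

/-- K + σ²I dominates σ²I, so its inverse has operator norm at most σ⁻². -/
theorem IsCov.sqrt_inv_le (hK : IsCov K) (hσ : 0 < σ) (y : Fin n → ℝ) :
    √(((reg K σ)⁻¹ *ᵥ y) ⬝ᵥ ((reg K σ)⁻¹ *ᵥ y)) ≤ (σ ^ 2)⁻¹ * √(y ⬝ᵥ y) := by
  set v := (reg K σ)⁻¹ *ᵥ y with hv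
  have h1 := hK.le_reg (σ := σ) v
  rw [hv, hK.reg_mulVec_inv hσ y, ← hv] at h1
  have h2 := (le_abs_self _).trans (abs_dotProduct_le_sqrt v y)
  have h3 := Real.mul_self_sqrt (dotProduct_self_nonneg' v)
  have h4 := Real.sqrt_nonneg (v ⬝ᵥ v)
  have hs : 0 < σ ^ 2 := by positivity
  rw [← div_eq_inv_mul, le_div_iff₀ hs]
  rcases h4.eq_or_lt with h | h
  · rw [← h, zero_mul]
    exact Real.sqrt_nonneg _
  · refine le_of_mul_le_mul_left ?_ h
    nlinarith

variable {k l : Fin n → ℝ} {κ : ℝ}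

/-- The posterior variance, in terms of the prior variance, the prior covariances with the sampled
values, and their covariance matrix. -/
abbrev condVar (K : Matrix (Fin n) (Fin n) ℝ) (σ : ℝ) (k : Fin n → ℝ) (κ : ℝ) : ℝ :=
  κ - k ⬝ᵥ ((reg K σ)⁻¹ *ᵥ k)

/-- For the optimal weights w, the posterior variance is the noiseless prediction error, nonnegative
by `hκ`, plus the noise contribution σ² w·w. -/
theorem IsCov.sq_mul_le_condVar (hK : IsCov K) (hσ : 0 < σ)
    (hκ : ∀ c : Fin n → ℝ, 0 ≤ κ - 2 * (c ⬝ᵥ k) + c ⬝ᵥ (K *ᵥ c)) :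
    σ ^ 2 * (((reg K σ)⁻¹ *ᵥ k) ⬝ᵥ ((reg K σ)⁻¹ *ᵥ k)) ≤ condVar K σ k κ := by
  have h1 := hκ ((reg K σ)⁻¹ *ᵥ k)
  have h2 := congrArg (fun u => ((reg K σ)⁻¹ *ᵥ k) ⬝ᵥ u) (hK.reg_mulVec_inv hσ k)
  simp only [reg_mulVec, dotProduct_add, dotProduct_smul, smul_eq_mul] at h2
  rw [condVar, dotProduct_comm k]
  linarith

theorem IsCov.condVar_nonneg (hK : IsCov K) (hσ : 0 < σ)
    (hκ : ∀ c : Fin n → ℝ, 0 ≤ κ - 2 * (c ⬝ᵥ k) + c ⬝ᵥ (K *ᵥ c)) : 0 ≤ condVar K σ k κ :=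
  (mul_nonneg (sq_nonneg σ) (dotProduct_self_nonneg' _)).trans (hK.sq_mul_le_condVar hσ hκ)

theorem IsCov.dotProduct_inv_nonneg (hK : IsCov K) (hσ : 0 < σ) (k : Fin n → ℝ) :
    0 ≤ k ⬝ᵥ ((reg K σ)⁻¹ *ᵥ k) := by
  have h1 := hK.le_reg (σ := σ) ((reg K σ)⁻¹ *ᵥ k)
  rw [hK.reg_mulVec_inv hσ] at h1
  rw [dotProduct_comm k]
  exact (mul_nonneg (sq_nonneg σ) (dotProduct_self_nonneg' _)).trans h1

theorem IsCov.condVar_le (hK : IsCov K) (hσ : 0 < σ) : condVar K σ k κ ≤ κ :=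
  sub_le_self _ (hK.dotProduct_inv_nonneg hσ k)

/-- Replacing the covariances `L`, `l` by `K`, `k` changes the posterior variance by at most the
excess mean squared error of the weights that are optimal for `K`, `k`. -/
theorem IsCov.condVar_sub_le (hK : IsCov K) (hL : IsCov L) (hσ : 0 < σ) :
    condVar L σ l κ - condVar K σ k κ ≤
      2 * (((reg K σ)⁻¹ *ᵥ k) ⬝ᵥ (k - l)) +
        ((reg K σ)⁻¹ *ᵥ k) ⬝ᵥ ((L - K) *ᵥ ((reg K σ)⁻¹ *ᵥ k)) := by
  set w := (reg K σ)⁻¹ *ᵥ k with hw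
  set u := (reg L σ)⁻¹ *ᵥ l with hu
  -- The weights u minimize the mean squared error for L, l; this form is the excess error of w over
  -- u.
  have h1 : 0 ≤ (w - u) ⬝ᵥ (reg L σ *ᵥ (w - u)) :=
    (mul_nonneg (sq_nonneg σ) (dotProduct_self_nonneg' _)).trans (hL.le_reg _)
  have hLu : reg L σ *ᵥ u = l := hL.reg_mulVec_inv hσ l
  have hKw : reg K σ *ᵥ w = k := hK.reg_mulVec_inv hσ k
  rw [Matrix.mulVec_sub, hLu, sub_dotProduct, dotProduct_sub, dotProduct_sub,
    hL.reg_dotProduct_comm u w, hLu] at h1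
  have h2 : w ⬝ᵥ (reg K σ *ᵥ w) = w ⬝ᵥ k := by rw [hKw]
  rw [reg_mulVec, dotProduct_add] at h1 h2
  rw [condVar, condVar, ← hw, ← hu, dotProduct_sub, Matrix.sub_mulVec, dotProduct_sub,
    dotProduct_comm k w, dotProduct_comm l u]
  rw [dotProduct_comm l w] at h1
  linarith

/-- A resolvent identity, arranged so that the inverse for K acts only on k, giving bounded weights,
and the inverse for L only on the data. -/
theorem IsCov.condMean_sub_eq (hK : IsCov K) (hL : IsCov L) (hσ : 0 < σ) (y : Fin n → ℝ) :
    l ⬝ᵥ ((reg L σ)⁻¹ *ᵥ y) - k ⬝ᵥ ((reg K σ)⁻¹ *ᵥ y) =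
      (l - k) ⬝ᵥ ((reg L σ)⁻¹ *ᵥ y) -
        ((reg K σ)⁻¹ *ᵥ k) ⬝ᵥ ((L - K) *ᵥ ((reg L σ)⁻¹ *ᵥ y)) := by
  set v := (reg L σ)⁻¹ *ᵥ y with hv
  have h1 : reg L σ *ᵥ v = y := hL.reg_mulVec_inv hσ y
  have h2 : k ⬝ᵥ v = ((reg K σ)⁻¹ *ᵥ k) ⬝ᵥ (reg K σ *ᵥ v) := by
    rw [hK.reg_dotProduct_comm, hK.reg_mulVec_inv hσ]
  have h3 : k ⬝ᵥ ((reg K σ)⁻¹ *ᵥ y) = ((reg K σ)⁻¹ *ᵥ k) ⬝ᵥ (reg L σ *ᵥ v) := by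
    rw [hK.dotProduct_inv_comm hσ, h1]
  rw [h3, sub_dotProduct, h2, reg_mulVec, reg_mulVec, Matrix.sub_mulVec]
  simp only [dotProduct_add, dotProduct_sub]
  ring

section Bounds

variable {e : ℝ}

theorem IsCov.sqrt_weights_le (hK : IsCov K) (hσ : 0 < σ) (hk : ∀ i, |k i| ≤ √κ) :
    √(((reg K σ)⁻¹ *ᵥ k) ⬝ᵥ ((reg K σ)⁻¹ *ᵥ k)) ≤ (σ ^ 2)⁻¹ * (√n * √κ) :=
  (hK.sqrt_inv_le hσ k).trans (by
    gcongr
    exact sqrt_dotProduct_le (Real.sqrt_nonneg _) hk)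

/-- The variance reduction is at most σ⁻²|k|², hence at most κ n/σ². When n is small against σ², the
posterior variance stays comparable to the prior one. -/
theorem IsCov.le_condVar (hK : IsCov K) (hσ : 0 < σ) (hκ0 : 0 ≤ κ) (hk : ∀ i, |k i| ≤ √κ) :
    κ * (1 - n / σ ^ 2) ≤ condVar K σ k κ := by
  have h1 := (le_abs_self _).trans (abs_dotProduct_le_sqrt k ((reg K σ)⁻¹ *ᵥ k))
  have h2 := hK.sqrt_weights_le hσ hk
  have h3 := sqrt_dotProduct_le (Real.sqrt_nonneg _) hk
  have h4 : √(k ⬝ᵥ k) * √(((reg K σ)⁻¹ *ᵥ k) ⬝ᵥ ((reg K σ)⁻¹ *ᵥ k)) ≤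
      (√n * √κ) * ((σ ^ 2)⁻¹ * (√n * √κ)) := by gcongr
  have h5 : (√n * √κ) * ((σ ^ 2)⁻¹ * (√n * √κ)) = κ * (n / σ ^ 2) := by
    have e1 := Real.mul_self_sqrt hκ0
    have e2 := Real.mul_self_sqrt (Nat.cast_nonneg (α := ℝ) n)
    calc _ = (√n * √n) * (√κ * √κ) * (σ ^ 2)⁻¹ := by ring
      _ = _ := by rw [e1, e2]; ring
  rw [condVar]
  linarith

/-- The squared norm of the weights is left explicit, because the two regimes of the mismatch bound
insert different estimates for it. -/
theorem IsCov.condVar_sub_le_weights (hK : IsCov K) (hL : IsCov L) (hσ : 0 < σ) (he : 0 ≤ e)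
    (hκ : 0 ≤ κ)
    (hk : ∀ i, |k i| ≤ √κ) (hkl : ∀ i, |k i - l i| ≤ e * √κ) (hKL : ∀ i j, |L i j - K i j| ≤ e) :
    condVar L σ l κ - condVar K σ k κ ≤
      2 * n * e * κ / σ ^ 2 +
        n * e * (((reg K σ)⁻¹ *ᵥ k) ⬝ᵥ ((reg K σ)⁻¹ *ᵥ k)) := by
  have hκ0 : 0 ≤ √κ := Real.sqrt_nonneg κ
  set w := (reg K σ)⁻¹ *ᵥ k with hw
  have h1 : w ⬝ᵥ (k - l) ≤ n * e * κ / σ ^ 2 := by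
    calc w ⬝ᵥ (k - l) ≤ e * √κ * ∑ i, |w i| :=
          (le_abs_self _).trans (abs_dotProduct_le_mul_sum hkl)
      _ ≤ e * √κ * (√n * ((σ ^ 2)⁻¹ * (√n * √κ))) := by
          gcongr
          refine (sum_abs_le_sqrt w).trans ?_
          gcongr
          exact hK.sqrt_weights_le hσ hk
      _ = (√n * √n) * e * (√κ * √κ) / σ ^ 2 := by ring
      _ = n * e * κ / σ ^ 2 := by
          rw [Real.mul_self_sqrt (Nat.cast_nonneg n), Real.mul_self_sqrt hκ]
  have h2 := (le_abs_self _).trans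
    (abs_dotProduct_mulVec_le (M := L - K) he hKL w w)
  rw [Real.mul_self_sqrt (dotProduct_self_nonneg' w)] at h2
  have h3 := hK.condVar_sub_le (k := k) (l := l) (κ := κ) hL hσ
  rw [← hw] at h3
  have h4 : 2 * n * e * κ / σ ^ 2 = 2 * (n * e * κ / σ ^ 2) := by ring
  rw [h4]
  linarith

theorem IsCov.abs_condMean_sub_le (hK : IsCov K) (hL : IsCov L) (hσ : 0 < σ) (he : 0 ≤ e)
    (hκ1 : κ ≤ 1) (hk : ∀ i, |k i| ≤ √κ) (hkl : ∀ i, |k i - l i| ≤ e * √κ)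
    (hKL : ∀ i j, |L i j - K i j| ≤ e) {y : Fin n → ℝ} {Y : ℝ} (hY : 0 ≤ Y) (hy : ∀ i, |y i| ≤ Y) :
    |l ⬝ᵥ ((reg L σ)⁻¹ *ᵥ y) - k ⬝ᵥ ((reg K σ)⁻¹ *ᵥ y)| ≤
      n * e * (σ ^ 2)⁻¹ * (1 + n * (σ ^ 2)⁻¹) * Y := by
  have hκs : √κ ≤ 1 := Real.sqrt_le_one.2 hκ1
  rw [hK.condMean_sub_eq hL hσ]
  set v := (reg L σ)⁻¹ *ᵥ y with hv
  set w := (reg K σ)⁻¹ *ᵥ k with hw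
  have hnn : √(n : ℝ) * √n = n := Real.mul_self_sqrt (Nat.cast_nonneg n)
  have hvn : √(v ⬝ᵥ v) ≤ (σ ^ 2)⁻¹ * (√n * Y) := (hL.sqrt_inv_le hσ y).trans (by
    gcongr
    exact sqrt_dotProduct_le hY hy)
  have hwn : √(w ⬝ᵥ w) ≤ (σ ^ 2)⁻¹ * √n := (hK.sqrt_weights_le hσ hk).trans (by
    gcongr
    exact mul_le_of_le_one_right (Real.sqrt_nonneg _) hκs)
  have h1 : |(l - k) ⬝ᵥ v| ≤ n * e * (σ ^ 2)⁻¹ * Y := by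
    have hlk : ∀ i, |(l - k) i| ≤ e := fun i => by
      rw [Pi.sub_apply, abs_sub_comm]
      exact (hkl i).trans (mul_le_of_le_one_right he hκs)
    rw [dotProduct_comm]
    calc |v ⬝ᵥ (l - k)| ≤ e * ∑ i, |v i| := abs_dotProduct_le_mul_sum hlk
      _ ≤ e * (√n * ((σ ^ 2)⁻¹ * (√n * Y))) := by
          gcongr
          refine (sum_abs_le_sqrt v).trans ?_
          gcongr
      _ = (√n * √n) * e * (σ ^ 2)⁻¹ * Y := by ring
      _ = _ := by rw [hnn]
  have h2 : |w ⬝ᵥ ((L - K) *ᵥ v)| ≤ n * e * (σ ^ 2)⁻¹ * (n * (σ ^ 2)⁻¹) * Y := by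
    calc |w ⬝ᵥ ((L - K) *ᵥ v)| ≤ n * e * (√(w ⬝ᵥ w) * √(v ⬝ᵥ v)) :=
          abs_dotProduct_mulVec_le he hKL w v
      _ ≤ n * e * (((σ ^ 2)⁻¹ * √n) * ((σ ^ 2)⁻¹ * (√n * Y))) := by gcongr
      _ = n * e * (σ ^ 2)⁻¹ * ((√n * √n) * (σ ^ 2)⁻¹) * Y := by ring
      _ = _ := by rw [hnn]
  calc _ ≤ |(l - k) ⬝ᵥ v| + |w ⬝ᵥ ((L - K) *ᵥ v)| := abs_sub _ _
    _ ≤ _ := by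
        refine (add_le_add h1 h2).trans (le_of_eq ?_)
        ring

end Bounds

end LinearAlgebra

/-! ### Jointly measurable versions of rewards and covariances -/

section Version

open Filter Topology

theorem measurable_nonsing_inv {n : ℕ} {A : Type*} [MeasurableSpace A]
    {M : A → Matrix (Fin n) (Fin n) ℝ} (hM : ∀ i j, Measurable fun a => M a i j) (i j : Fin n) :
    Measurable fun a => (M a)⁻¹ i j := by
  have hdet : ∀ {L : A → Matrix (Fin n) (Fin n) ℝ}, (∀ i j, Measurable fun a => L a i j) →
      Measurable fun a => (L a).det := by
    intro L hL
    simp only [Matrix.det_apply']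
    exact Finset.measurable_fun_sum _ fun s _ =>
      (Finset.measurable_fun_prod _ fun i _ => hL _ _).const_mul _
  simp only [Matrix.inv_def, Matrix.smul_apply, Ring.inverse_eq_inv', smul_eq_mul,
    Matrix.adjugate_apply]
  refine (hdet hM).inv.mul (hdet fun i' j' => ?_)
  by_cases h : i' = j
  · subst h
    simp only [Matrix.updateRow_self]
    exact measurable_const
  · simp only [Matrix.updateRow_ne h]
    exact hM _ _

theorem measurable_dotProduct_inv_mulVec {n : ℕ} {A : Type*} [MeasurableSpace A]
    {M : A → Matrix (Fin n) (Fin n) ℝ} {u w : A → Fin n → ℝ}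
    (hM : ∀ i j, Measurable fun a => M a i j) (hu : ∀ i, Measurable fun a => u a i)
    (hw : ∀ i, Measurable fun a => w a i) :
    Measurable fun a => u a ⬝ᵥ ((M a)⁻¹ *ᵥ w a) := by
  simp only [dotProduct, Matrix.mulVec]
  exact Finset.measurable_fun_sum _ fun i _ => (hu i).mul (Finset.measurable_fun_sum _ fun j _ =>
    (measurable_nonsing_inv hM i j).mul (hw j))

theorem measurable_reg_apply {n : ℕ} {A : Type*} [MeasurableSpace A]
    {M : A → Matrix (Fin n) (Fin n) ℝ} (hM : ∀ i j, Measurable fun a => M a i j) (σ : ℝ)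
    (i j : Fin n) : Measurable fun a => reg (M a) σ i j := by
  simp only [reg, Matrix.add_apply]
  exact (hM i j).add_const _

variable {Ω E : Type*} [MeasurableSpace Ω] {μ : Measure Ω} {D : Set E} {k : E → E → ℝ}
  {g : ℕ → Ω → E → ℝ} {ε : ℝ}

theorem measurable_path (h : ∀ s, IsCenteredGP μ D k (g s)) :
    Measurable fun ω s (p : D) => g s ω p :=
  measurable_pi_lambda _ fun s => measurable_pi_lambda _ fun p => (h s).measurable p p.2

/-- The innovations as functions on the canonical path space, extended by `0` outside `D`. -/
def innov (D : Set E) (s : ℕ) (α : ℕ → D → ℝ) (p : E) : ℝ :=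
  open Classical in if h : p ∈ D then α s ⟨p, h⟩ else 0

theorem measurable_innov_reward (D : Set E) (ε : ℝ) (s : ℕ) (p : E) :
    Measurable fun α : ℕ → D → ℝ => reward ε (innov D) s α p := by
  have hi : ∀ s, Measurable fun α : ℕ → D → ℝ => innov D s α p := by
    intro s
    by_cases h : p ∈ D
    · simp only [innov, h, dif_pos]
      fun_prop
    · simp only [innov, h, not_false_eq_true, dif_neg, measurable_const]
  obtain ⟨c, hc⟩ := reward_eq_sum ε (innov D) s
  simp only [hc]
  exact Finset.measurable_fun_sum _ fun j _ => (hi j).const_mul _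

theorem innov_reward_eq {Ω E : Type*} {D : Set E} (ε : ℝ) (g : ℕ → Ω → E → ℝ) (s : ℕ) (ω : Ω) {p : E} (hp : p ∈ D) :
    reward ε (innov D) s (fun s p => g s ω p) p = reward ε g s ω p := by
  induction s with
  | zero => simp [reward, innov, hp]
  | succ s ih => simp [reward, innov, hp, ih]

variable [PseudoMetricSpace E] [MeasurableSpace E] [BorelSpace E] [SecondCountableTopology E]

/-- A jointly measurable version of the reward functions on the canonical path space. -/
def rewardVersion (ε : ℝ) {x₀ : E} (hx₀ : x₀ ∈ D) (s : ℕ) (α : ℕ → D → ℝ) (p : E) : ℝ :=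
  limsup (fun m => reward ε (innov D) s α (SimpleFunc.approxOn id measurable_id D x₀ hx₀ m p)) atTop

theorem measurable_rewardVersion (ε : ℝ) {x₀ : E} (hx₀ : x₀ ∈ D) (s : ℕ) :
    Measurable fun q : (ℕ → D → ℝ) × E => rewardVersion ε hx₀ s q.1 q.2 := by
  refine Measurable.limsup fun m => ?_
  -- The m-th approximation of p takes finitely many values, so joint measurability reduces to
  -- measurability at single points.
  exact SimpleFunc.measurable_bind
    ((SimpleFunc.approxOn id measurable_id D x₀ hx₀ m).comp Prod.snd measurable_snd)
    (fun p q => reward ε (innov D) s q.1 p)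
    fun p => (measurable_innov_reward D ε s p).comp measurable_fst

/-- The approximating points stay in D, so a path continuous on D makes the limsup a genuine limit.
-/
theorem rewardVersion_eq {Ω : Type*} {g : ℕ → Ω → E → ℝ} {x₀ : E} (hx₀ : x₀ ∈ D) {s : ℕ} {ω : Ω}
    (hω : ContinuousOn (reward ε g s ω) D) {p : E} (hp : p ∈ D) :
    rewardVersion ε hx₀ s (fun s p => g s ω p) p = reward ε g s ω p := by
  refine Tendsto.limsup_eq ?_
  have hmem : ∀ m, SimpleFunc.approxOn id measurable_id D x₀ hx₀ m p ∈ D :=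
    fun m => SimpleFunc.approxOn_mem _ _ _ _
  simp only [innov_reward_eq ε g s ω (hmem _)]
  have h1 : Tendsto (fun m => SimpleFunc.approxOn id measurable_id D x₀ hx₀ m p) atTop (𝓝 p) :=
    SimpleFunc.tendsto_approxOn measurable_id hx₀ (subset_closure hp)
  exact (hω p hp).tendsto.comp (tendsto_nhdsWithin_iff.2 ⟨h1, .of_forall hmem⟩)

/-- The covariance kernel of the reward functions in space and time. -/
def timeKer (ρ : ℝ) (k : E → E → ℝ) (p q : ℕ × E) : ℝ := ρ ^ timeDist p.1 q.1 * k p.2 q.2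

/-- A measurable version of the covariance kernel of the reward functions. -/
def covVersion (μ : Measure Ω) (ε : ℝ) {x₀ : E} (hx₀ : x₀ ∈ D) (g : ℕ → Ω → E → ℝ)
    (p q : ℕ × E) : ℝ :=
  ∫ ω, rewardVersion ε hx₀ p.1 (fun s p => g s ω p) p.2 *
    rewardVersion ε hx₀ q.1 (fun s p => g s ω p) q.2 ∂μ

/-- No measurability of k is assumed, yet posterior quantities at data-dependent points must be
measurable. An integral of a jointly measurable integrand depends measurably on its parameters, and
on D it recovers the kernel. -/
theorem measurable_covVersion [IsProbabilityMeasure μ] (h : ∀ s, IsCenteredGP μ D k (g s))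
    {x₀ : E} (hx₀ : x₀ ∈ D) (s t : ℕ) :
    Measurable fun q : E × E => covVersion μ ε hx₀ g (s, q.1) (t, q.2) := by
  refine StronglyMeasurable.measurable ?_
  refine StronglyMeasurable.integral_prod_right (f := fun (q : E × E) ω =>
    rewardVersion ε hx₀ s (fun s p => g s ω p) q.1 *
    rewardVersion ε hx₀ t (fun s p => g s ω p) q.2) (Measurable.stronglyMeasurable ?_)
  have hg := measurable_path h
  have h1 := measurable_rewardVersion ε hx₀ s
  have h2 := measurable_rewardVersion ε hx₀ t
  generalize rewardVersion ε hx₀ s = R at h1 ⊢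
  generalize rewardVersion ε hx₀ t = R' at h2 ⊢
  exact (h1.comp ((hg.comp measurable_snd).prodMk (measurable_fst.comp measurable_fst))).mul
    (h2.comp ((hg.comp measurable_snd).prodMk (measurable_snd.comp measurable_fst)))

theorem covVersion_eq [IsProbabilityMeasure μ] (hε : ε ∈ Set.Icc (0 : ℝ) 1)
    (h : ∀ s, IsCenteredGP μ D k (g s)) (hind : iIndepFun (fun s ω (p : D) => g s ω p) μ)
    (hcont : ∀ s, ∀ᵐ ω ∂μ, ContinuousOn (reward ε g s ω) D) {x₀ : E} (hx₀ : x₀ ∈ D)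
    {p q : ℕ × E} (hp : p.2 ∈ D) (hq : q.2 ∈ D) :
    covVersion μ ε hx₀ g p q = timeKer √(1 - ε) k p q := by
  rw [timeKer, ← cov_reward hε h hind p.1 q.1 hp hq,
    covariance_eq_sub (memLp_reward h hind _ hp) (memLp_reward h hind _ hq),
    integral_reward h p.1 hp, zero_mul, sub_zero, covVersion]
  refine integral_congr_ae ?_
  filter_upwards [hcont p.1, hcont q.1] with ω h1 h2
  rw [rewardVersion_eq hx₀ h1 hp, rewardVersion_eq hx₀ h2 hq, Pi.mul_apply]

theorem measurable_postMean {n : ℕ} {A F : Type*} [MeasurableSpace A] [MeasurableSpace F]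
    {c : F → F → ℝ} {x : A → Fin n → F} {y : A → Fin n → ℝ} {p : A → F} (σ : ℝ)
    (hx : ∀ i j, Measurable fun a => c (x a i) (x a j))
    (hp : ∀ i, Measurable fun a => c (x a i) (p a)) (hy : ∀ i, Measurable fun a => y a i) :
    Measurable fun a => postMean c σ (x a) (y a) (p a) :=
  measurable_dotProduct_inv_mulVec (measurable_reg_apply hx σ) hp hy

theorem measurable_postVar {n : ℕ} {A F : Type*} [MeasurableSpace A] [MeasurableSpace F]
    {c : F → F → ℝ} {x : A → Fin n → F} {p : A → F} (σ : ℝ)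
    (hx : ∀ i j, Measurable fun a => c (x a i) (x a j))
    (hp : ∀ i, Measurable fun a => c (x a i) (p a)) (hpp : Measurable fun a => c (p a) (p a)) :
    Measurable fun a => postVar c σ (x a) (p a) :=
  hpp.sub (measurable_dotProduct_inv_mulVec (measurable_reg_apply hx σ) hp hp)

theorem postMean_congr {n : ℕ} {F : Type*} {c c' : F → F → ℝ} {x : Fin n → F} {p : F} {σ : ℝ}
    (hx : ∀ i j, c (x i) (x j) = c' (x i) (x j)) (hp : ∀ i, c (x i) p = c' (x i) p)
    (y : Fin n → ℝ) : postMean c σ x y p = postMean c' σ x y p := by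
  have h1 : gram c x = gram c' x := by ext i j; exact hx i j
  have h2 : kvec c x p = kvec c' x p := by ext i; exact hp i
  rw [postMean, postMean, h1, h2]

theorem postVar_congr {n : ℕ} {F : Type*} {c c' : F → F → ℝ} {x : Fin n → F} {p : F} {σ : ℝ}
    (hx : ∀ i j, c (x i) (x j) = c' (x i) (x j)) (hp : ∀ i, c (x i) p = c' (x i) p)
    (hpp : c p p = c' p p) : postVar c σ x p = postVar c' σ x p := by
  have h1 : gram c x = gram c' x := by ext i j; exact hx i j
  have h2 : kvec c x p = kvec c' x p := by ext i; exact hp i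
  rw [postVar, postVar, h1, h2, hpp]

end Version

/-! ### Posterior tail bounds for adaptively queried rewards -/

section Tail

open Filter Topology

variable {Ω E : Type*} [MeasurableSpace Ω] {μ : Measure Ω} [IsProbabilityMeasure μ] {D : Set E}
  {k : E → E → ℝ} {g : ℕ → Ω → E → ℝ} {z : ℕ → Ω → ℝ} {ε σ : ℝ} {n : ℕ}

theorem isCov_timeKer (hε : ε ∈ Set.Icc (0 : ℝ) 1) (h : ∀ s, IsCenteredGP μ D k (g s))
    (hind : iIndepFun (fun s ω (p : D) => g s ω p) μ) {τ : Fin n → ℕ × E}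
    (hτ : ∀ i, (τ i).2 ∈ D) : IsCov (gram (timeKer √(1 - ε) k) τ) where
  symm i j := by
    simp only [gram, Matrix.of_apply, timeKer]
    rw [(h 0).symm (hτ i) (hτ j), timeDist, timeDist, add_comm]
  nonneg c := by
    have := sum_cov_nonneg (fun i => memLp_reward (ε := ε) h hind (τ i).1 (hτ i)) c
    simp only [cov_reward hε h hind _ _ (hτ _) (hτ _)] at this
    refine this.trans_eq ?_
    simp only [dotProduct, Matrix.mulVec, gram, Matrix.of_apply, timeKer, Finset.mul_sum]
    refine Finset.sum_congr rfl fun i _ => Finset.sum_congr rfl fun j _ => ?_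
    ring

/-- This is the variance of a prediction error: in the `Option` indexing, `none` carries the target
with coefficient 1 and `some i` the sample with coefficient -c i. -/
theorem timeKer_schur_nonneg (hε : ε ∈ Set.Icc (0 : ℝ) 1) (h : ∀ s, IsCenteredGP μ D k (g s))
    (hind : iIndepFun (fun s ω (p : D) => g s ω p) μ) {τ : Fin n → ℕ × E}
    (hτ : ∀ i, (τ i).2 ∈ D) {q : ℕ × E} (hq : q.2 ∈ D) (c : Fin n → ℝ) :
    0 ≤ timeKer √(1 - ε) k q q - 2 * (c ⬝ᵥ kvec (timeKer √(1 - ε) k) τ q) +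
      c ⬝ᵥ (gram (timeKer √(1 - ε) k) τ *ᵥ c) := by
  let τ' : Option (Fin n) → ℕ × E := fun o => o.elim q τ
  have hτ' : ∀ o, (τ' o).2 ∈ D := by
    rintro (_ | i)
    · exact hq
    · exact hτ i
  have := sum_cov_nonneg (fun o => memLp_reward (ε := ε) h hind (τ' o).1 (hτ' o))
    (fun o : Option (Fin n) => o.elim 1 fun i => - c i)
  simp only [cov_reward hε h hind _ _ (hτ' _) (hτ' _)] at this
  refine this.trans_eq ?_
  have hsymm : ∀ i, k q.2 (τ i).2 = k (τ i).2 q.2 := fun i => (h 0).symm hq (hτ i)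
  have hd : ∀ a b, timeDist a b = timeDist b a := fun a b => by rw [timeDist, timeDist, add_comm]
  simp only [Fintype.sum_option, τ', Option.elim, hsymm, hd q.1]
  simp only [dotProduct, Matrix.mulVec, gram, kvec, Matrix.of_apply, timeKer, Finset.mul_sum,
    Finset.sum_add_distrib, one_mul, mul_one]
  have e1 : ∑ i, -c i * (√(1 - ε) ^ timeDist (τ i).1 q.1 * k (τ i).2 q.2) =
      -∑ i, c i * (√(1 - ε) ^ timeDist (τ i).1 q.1 * k (τ i).2 q.2) := by
    rw [← Finset.sum_neg_distrib]
    exact Finset.sum_congr rfl fun i _ => by ring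
  have e2 : ∑ i, 2 * (c i * (√(1 - ε) ^ timeDist (τ i).1 q.1 * k (τ i).2 q.2)) =
      2 * ∑ i, c i * (√(1 - ε) ^ timeDist (τ i).1 q.1 * k (τ i).2 q.2) := by
    rw [Finset.mul_sum]
  have e3 : ∑ i, ∑ j, -c i * -c j * (√(1 - ε) ^ timeDist (τ i).1 (τ j).1 * k (τ i).2 (τ j).2) =
      ∑ i, ∑ j, c i * (√(1 - ε) ^ timeDist (τ i).1 (τ j).1 * k (τ i).2 (τ j).2 * c j) :=
    Finset.sum_congr rfl fun i _ => Finset.sum_congr rfl fun j _ => by ring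
  rw [e1, e2, e3]
  ring

/-- The weights (K + σ²I)⁻¹ k(q) solve the normal equations of the abstract tail bound and turn its
mean and variance into `postMean` and `postVar`. -/
theorem lintegral_likelihood_tail_le (hε : ε ∈ Set.Icc (0 : ℝ) 1)
    (h : ∀ s, IsCenteredGP μ D k (g s)) (hind : iIndepFun (fun s ω (p : D) => g s ω p) μ)
    (hσ : 0 < σ) {τ : Fin n → ℕ × E} (hτ : ∀ i, (τ i).2 ∈ D) {q : ℕ × E} (hq : q.2 ∈ D)
    (y : Fin n → ℝ) {c b : ℝ} (hc : c ^ 2 = 1) (hb : 0 ≤ b) :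
    ∫⁻ ω, {ω | √b * √(postVar (timeKer √(1 - ε) k) σ τ q) <
        c * (reward ε g q.1 ω q.2 - postMean (timeKer √(1 - ε) k) σ τ y q)}.indicator
        (fun ω => ∏ i, gaussianPDF (reward ε g (τ i).1 ω (τ i).2) (Real.toNNReal (σ ^ 2)) (y i))
        ω ∂μ ≤
      ENNReal.ofReal (Real.exp (-b / 2)) *
        ∫⁻ ω, ∏ i, gaussianPDF (reward ε g (τ i).1 ω (τ i).2) (Real.toNNReal (σ ^ 2)) (y i) ∂μ := by
  have hK := isCov_timeKer hε h hind hτ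
  set κ := timeKer √(1 - ε) k with hκ
  have hv : (Real.toNNReal (σ ^ 2) : ℝ) = σ ^ 2 := Real.coe_toNNReal _ (sq_nonneg σ)
  have hcov : ∀ p r : ℕ × E, p.2 ∈ D → r.2 ∈ D →
      cov[fun ω => reward ε g p.1 ω p.2, fun ω => reward ε g r.1 ω r.2; μ] = κ p r :=
    fun p r hp hr => cov_reward hε h hind p.1 r.1 hp hr
  have hgauss : HasGaussianLaw (fun ω => (reward ε g q.1 ω q.2,
      fun i => reward ε g (τ i).1 ω (τ i).2)) μ := by
    have h1 := ((isGaussianProcess_reward (ε := ε) h hind).comp_right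
      (fun o : Option (Fin n) => o.elim ((q.1, ⟨q.2, hq⟩) : ℕ × D)
        fun i => ((τ i).1, ⟨(τ i).2, hτ i⟩))).hasGaussianLaw Finset.univ
    let L : ({o // o ∈ (Finset.univ : Finset (Option (Fin n)))} → ℝ) →L[ℝ] ℝ × (Fin n → ℝ) :=
      (ContinuousLinearMap.proj ⟨none, Finset.mem_univ _⟩).prod
        (ContinuousLinearMap.pi fun i => ContinuousLinearMap.proj ⟨some i, Finset.mem_univ _⟩)
    exact h1.map_fun L
  set w := (reg (gram κ τ) σ)⁻¹ *ᵥ kvec κ τ q with hwdef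
  have key := lintegral_indicator_likelihood_le (μ := μ) (n := n)
    (U := fun i ω => reward ε g (τ i).1 ω (τ i).2) (V := fun ω => reward ε g q.1 ω q.2)
    hgauss (measurable_reward h _ hq) (fun i => measurable_reward h _ (hτ i))
    (integral_reward h _ hq) (fun i => integral_reward h _ (hτ i))
    (v := Real.toNNReal (σ ^ 2)) (by simpa using hσ.ne') (w := w) (by
      intro i
      simp only [hcov _ _ (hτ _) (hτ _), hcov _ _ (hτ _) hq, hv]
      have := congrFun (hK.reg_mulVec_inv hσ (kvec κ τ q)) i
      rw [← hwdef, reg_mulVec] at this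
      exact this) y hc hb
  have e1 : Var[fun ω => reward ε g q.1 ω q.2; μ] -
      ∑ i, w i * cov[fun ω => reward ε g (τ i).1 ω (τ i).2, fun ω => reward ε g q.1 ω q.2; μ] =
      postVar κ σ τ q := by
    rw [← covariance_self (measurable_reward h _ hq).aemeasurable, hcov q q hq hq]
    simp only [hcov _ _ (hτ _) hq]
    rw [postVar, dotProduct_comm]
    rfl
  have e2 : ∑ i, w i * y i = postMean κ σ τ y q := by
    rw [postMean]
    exact (hK.dotProduct_inv_comm hσ _ _).symm
  rw [e1, e2] at key
  exact key

theorem IsModel.indepFun_path_noise (hm : IsModel μ D k σ g z) (t n : ℕ) :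
    IndepFun (fun ω => ((fun s (p : D) => g s ω p : ℕ → D → ℝ), fun i : Fin n => z (t + i) ω))
      (z (t + n)) μ := by
  classical
  have hz := hm.noise_measurable
  refine indepFun_prodMk_of_prodMk (measurable_path hm.gp)
    (measurable_pi_lambda _ fun i => hz _) (hz _) ?_ ?_
  · exact hm.indep.comp (φ := id)
      (ψ := fun w : ℕ → ℝ => ((fun i : Fin n => w (t + i)), w (t + n))) measurable_id (by fun_prop)
  · have h1 := hm.indep_noise.indepFun_finset (Finset.Ico t (t + n)) {t + n}
      (by simp) hz
    refine h1.comp (γ' := ℝ)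
      (φ := fun w (i : Fin n) => w ⟨t + i, by simp [i.2]⟩)
      (ψ := fun w => w ⟨t + n, by simp⟩)
      (measurable_pi_lambda _ fun i => measurable_pi_apply _) ?_
    exact measurable_pi_apply (⟨t + n, by simp⟩ : ({t + n} : Finset ℕ))

variable [PseudoMetricSpace E] [MeasurableSpace E] [BorelSpace E] [SecondCountableTopology E]

/-- The posterior tail bound for adaptively chosen queries. -/
theorem measure_posterior_tail (hm : IsModel μ D k σ g z) (hε : ε ∈ Set.Icc (0 : ℝ) 1)
    (hσ : 0 < σ) (hD : MeasurableSet D)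
    (hcont : ∀ s, ∀ᵐ ω ∂μ, ContinuousOn (reward ε g s ω) D) {x : ℕ → Ω → E} {y : ℕ → Ω → ℝ}
    (hmem : ∀ s ω, x s ω ∈ D) (hobs : ∀ s ω, y s ω = reward ε g s ω (x s ω) + z s ω) {t : ℕ}
    (hrule : ∀ i < n, ∃ φ : (Fin i → ℝ) → E, Measurable φ ∧
      ∀ ω, x (t + i) ω = φ fun j => y (t + j) ω)
    {π : (Fin n → ℝ) → E} (hπ : Measurable π) (hπD : ∀ y, π y ∈ D) (s : ℕ) {c b : ℝ}
    (hc : c ^ 2 = 1) (hb : 0 ≤ b) :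
    μ {ω | √b * √(postVar (timeKer √(1 - ε) k) σ (fun i : Fin n => (t + i, x (t + i) ω))
          (s, π fun i => y (t + i) ω)) <
        c * (reward ε g s ω (π fun i => y (t + i) ω) -
          postMean (timeKer √(1 - ε) k) σ (fun i : Fin n => (t + i, x (t + i) ω))
            (fun i => y (t + i) ω) (s, π fun i => y (t + i) ω))} ≤
      ENNReal.ofReal (Real.exp (-b / 2)) := by
  classical
  obtain ⟨x₀, hx₀⟩ : D.Nonempty := ⟨π 0, hπD 0⟩
  have hrule' : ∀ i, ∃ φ : (Fin i → ℝ) → E, i < n → Measurable φ ∧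
      ∀ ω, x (t + i) ω = φ fun j => y (t + j) ω := by
    intro i
    by_cases hi : i < n
    · obtain ⟨φ, h⟩ := hrule i hi
      exact ⟨φ, fun _ => h⟩
    · exact ⟨fun _ => x₀, fun h => absurd h hi⟩
  choose φ₀ hφ₀ using hrule'
  -- The given rules are known to land in D only on observations that occur. Other values, and the
  -- indices i ≥ n, are redirected to x₀, so that for every fixed y the query points lie in D.
  let φ : (i : ℕ) → (Fin i → ℝ) → E :=
    fun i y => if i < n ∧ φ₀ i y ∈ D then φ₀ i y else x₀
  have hφ : ∀ i, Measurable (φ i) := by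
    intro i
    by_cases hi : i < n
    · simp only [φ, hi, true_and]
      exact Measurable.ite ((hφ₀ i hi).1 hD) (hφ₀ i hi).1 measurable_const
    · simp only [φ, hi, false_and, if_false]
      exact measurable_const
  have hφD : ∀ i y, φ i y ∈ D := by
    intro i y
    simp only [φ]
    split_ifs with h
    · exact h.2
    · exact hx₀
  have hφeq : ∀ i < n, ∀ ω, φ i (fun j => y (t + j) ω) = x (t + i) ω := by
    intro i hi ω
    have := (hφ₀ i hi).2 ω
    have h1 : φ₀ i (fun j => y (t + j) ω) ∈ D := this ▸ hmem _ _
    simp only [φ, hi, h1, and_self, if_true, this]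
  let a : Ω → ℕ → D → ℝ := fun ω s p => g s ω p
  have ha : Measurable a := measurable_path hm.gp
  let F : ℕ → (ℕ → D → ℝ) → E → ℝ := fun i => rewardVersion ε hx₀ (t + i)
  have hF : ∀ i, Measurable fun p : (ℕ → D → ℝ) × E => F i p.1 p.2 :=
    fun i => measurable_rewardVersion ε hx₀ (t + i)
  have hFs := measurable_rewardVersion ε hx₀ s
  have hae : ∀ᵐ ω ∂μ, ∀ s, ∀ p ∈ D, rewardVersion ε hx₀ s (a ω) p = reward ε g s ω p := by
    filter_upwards [ae_all_iff.2 hcont] with ω hω s p hp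
    exact rewardVersion_eq hx₀ (hω s) hp
  -- Started afresh at time t with the noise from t on, the recursion reproduces the actual
  -- observations, because these queries use only observations since t.
  have hrun : ∀ᵐ ω ∂μ, observe F φ (a ω) n (fun i => z (t + i) ω) =
      fun i : Fin n => y (t + i) ω := by
    filter_upwards [hae] with ω hω
    suffices H : ∀ m ≤ n, observe F φ (a ω) m (fun i => z (t + i) ω) =
        fun i : Fin m => y (t + i) ω from
      H n le_rfl
    intro m
    induction m with
    | zero => exact fun _ => Subsingleton.elim _ _
    | succ m ih =>
      intro hmn
      have ih' := ih (by omega)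
      change Fin.snoc (α := fun _ => ℝ) (observe F φ (a ω) m fun i : Fin m => z (t + i) ω)
        (F m (a ω) (φ m (observe F φ (a ω) m fun i : Fin m => z (t + i) ω)) + z (t + m) ω) = _
      rw [ih', hφeq m (by omega)]
      ext i
      refine Fin.lastCases ?_ (fun i => ?_) i
      · rw [Fin.snoc_last, Fin.val_last, hobs]
        exact congrArg (· + z (t + m) ω) (hω _ _ (hmem _ _))
      · rw [Fin.snoc_castSucc]
        rfl
  let τ : (Fin n → ℝ) → Fin n → ℕ × E := fun y i => (t + i, φ i (initial y i))
  have hτD : ∀ y i, (τ y i).2 ∈ D := fun y i => hφD _ _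
  set κ := timeKer √(1 - ε) k with hκ
  -- κ' only supplies measurability; at points of D it is κ.
  obtain ⟨κ', hκ', hκm⟩ : ∃ κ' : ℕ × E → ℕ × E → ℝ,
      (∀ p q : ℕ × E, p.2 ∈ D → q.2 ∈ D → κ' p q = κ p q) ∧
        ∀ s t, Measurable fun q : E × E => κ' (s, q.1) (t, q.2) :=
    ⟨covVersion μ ε hx₀ g, fun p q hp hq => covVersion_eq hε hm.gp hm.indep_gp hcont hx₀ hp hq,
      fun s t => measurable_covVersion hm.gp hx₀ s t⟩
  have hτm : ∀ i : Fin n, Measurable fun y : Fin n → ℝ => φ i (initial y i) :=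
    fun i => (hφ i).comp (measurable_initial i)
  have hm1 : ∀ i j, Measurable fun y => κ' (τ y i) (τ y j) :=
    fun i j => (hκm (t + i) (t + j)).comp ((hτm i).prodMk (hτm j))
  have hm2 : ∀ i, Measurable fun y => κ' (τ y i) (s, π y) :=
    fun i => (hκm (t + i) s).comp ((hτm i).prodMk hπ)
  have hPV : Measurable fun y => postVar κ' σ (τ y) (s, π y) :=
    measurable_postVar σ hm1 hm2 ((hκm s s).comp (hπ.prodMk hπ))
  have hPM : Measurable fun y => postMean κ' σ (τ y) y (s, π y) :=
    measurable_postMean σ hm1 hm2 (fun i => measurable_pi_apply i)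
  have hPV' : ∀ y, postVar κ' σ (τ y) (s, π y) = postVar κ σ (τ y) (s, π y) := fun y =>
    postVar_congr (fun i j => hκ' _ _ (hτD y i) (hτD y j)) (fun i => hκ' _ _ (hτD y i) (hπD y))
      (hκ' _ _ (hπD y) (hπD y))
  have hPM' : ∀ y, postMean κ' σ (τ y) y (s, π y) = postMean κ σ (τ y) y (s, π y) := fun y =>
    postMean_congr (fun i j => hκ' _ _ (hτD y i) (hτD y j)) (fun i => hκ' _ _ (hτD y i) (hπD y)) y
  let S : Set ((ℕ → D → ℝ) × (Fin n → ℝ)) := {p | √b * √(postVar κ' σ (τ p.2) (s, π p.2)) <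
    c * (rewardVersion ε hx₀ s p.1 (π p.2) - postMean κ' σ (τ p.2) p.2 (s, π p.2))}
  have hS : MeasurableSet S := by
    refine measurableSet_lt ?_ ?_
    · exact ((hPV.comp measurable_snd).sqrt).const_mul _
    · refine Measurable.const_mul (Measurable.sub ?_ (hPM.comp measurable_snd)) c
      generalize rewardVersion ε hx₀ s = R at hFs
      exact hFs.comp (measurable_fst.prodMk (hπ.comp measurable_snd))
  have main := measure_observe_le (μ := μ) hF hφ (v := Real.toNNReal (σ ^ 2)) (by simpa using hσ.ne')
    ha (z := fun i => z (t + i)) (fun i => hm.noise_measurable _) (fun i => hm.noise_law _)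
    (hm.indepFun_path_noise t) n hS (C := ENNReal.ofReal (Real.exp (-b / 2))) (by
      intro y
      have key := lintegral_likelihood_tail_le hε hm.gp hm.indep_gp hσ (hτD y)
        (q := (s, π y)) (hπD y) y hc hb
      rw [← hκ, ← hPV', ← hPM'] at key
      have hlik : ∀ᵐ ω ∂μ, likelihood F φ (Real.toNNReal (σ ^ 2)) n (a ω) y =
          ∏ i, gaussianPDF (reward ε g (τ y i).1 ω (τ y i).2) (Real.toNNReal (σ ^ 2)) (y i) := by
        filter_upwards [hae] with ω hω
        exact Finset.prod_congr rfl fun i _ =>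
          congrArg (fun u => gaussianPDF u _ (y i)) (hω _ _ (hτD y i))
      rw [lintegral_congr_ae hlik]
      refine le_trans (le_of_eq (lintegral_congr_ae ?_)) key
      filter_upwards [hlik, hae] with ω h1 h2
      have h3 : ω ∈ {ω | (a ω, y) ∈ S} ↔ ω ∈ {ω | √b * √(postVar κ' σ (τ y) (s, π y)) <
          c * (reward ε g s ω (π y) - postMean κ' σ (τ y) y (s, π y))} := by
        simp only [S, Set.mem_ofPred_eq, h2 s _ (hπD y)]
      by_cases h4 : ω ∈ {ω | (a ω, y) ∈ S}
      · rw [Set.indicator_of_mem h4, Set.indicator_of_mem (h3.1 h4), h1]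
      · rw [Set.indicator_of_notMem h4, Set.indicator_of_notMem (fun h => h4 (h3.2 h))])
  refine le_trans (measure_mono_ae ?_) main
  filter_upwards [hae, hrun] with ω h1 h2 hω
  have e : (fun i : Fin n => (t + (i : ℕ), x (t + i) ω)) = τ fun i => y (t + i) ω := by
    ext i
    · rfl
    · exact (hφeq i i.2 ω).symm ▸ rfl
  change (a ω, observe F φ (a ω) n fun i => z (t + i) ω) ∈ S
  rw [h2]
  have hω' := hω
  simp only [S, Set.mem_ofPred_eq, h1 s _ (hπD _), hPV', hPM']
  rw [← e]
  exact hω'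

end Tail

/-! ### Scalar inequalities behind ψ, with u = 1/σ -/

section Mismatch

variable {n N e ε u σ L b₀ B : ℝ}

theorem sqrt_two_lt : √2 < 1.4143 := by
  rw [Real.sqrt_lt' (by norm_num)]
  norm_num

theorem mean_coeff_le (hn : 0 ≤ n) (hnN : n + 1 ≤ N) (heN : e ≤ N * ε / 2) (hu : 0 < u)
    (hε : 0 ≤ ε) (hL : 0 ≤ L) (hb : 0 ≤ b₀) :
    n * e * u ^ 2 * (1 + n * u ^ 2) * (b₀ * L) ≤ (u ^ 2 + u ^ 4) * N ^ 3 * ε * b₀ * L / 2 := by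
  have h1 : n * u ^ 2 * (1 + n * u ^ 2) ≤ N ^ 2 * (u ^ 2 + u ^ 4) := by
    have h1 : n ≤ N ^ 2 := by nlinarith
    have h2 : n ^ 2 ≤ N ^ 2 := by nlinarith
    nlinarith [mul_le_mul_of_nonneg_right h1 (by positivity : 0 ≤ u ^ 2),
      mul_le_mul_of_nonneg_right h2 (by positivity : 0 ≤ u ^ 4)]
  have hN : 0 ≤ N := by linarith
  calc _ = e * (n * u ^ 2 * (1 + n * u ^ 2)) * (b₀ * L) := by ring
    _ ≤ (N * ε / 2) * (N ^ 2 * (u ^ 2 + u ^ 4)) * (b₀ * L) := by gcongr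
    _ = _ := by ring

/-- The threshold 0.9 works because √2 (0.9 + 1/2) < 2, where 1/2 comes from u³ ≤ (u² + u⁴)/2. -/
theorem mean_noise_le_of_le (hn : 0 ≤ n) (hnN : n + 1 ≤ N) (heN : e ≤ N * ε / 2)
    (hu : 0 < u) (hε : 0 ≤ ε) (hL : 0 ≤ L) (hcase : n ≤ 0.9 * N ^ 2 * u) :
    n * e * u ^ 2 * (1 + n * u ^ 2) * (u⁻¹ * √2 * L) ≤ (u ^ 2 + u ^ 4) * N ^ 3 * ε * L := by
  have hN : 0 ≤ N := by linarith
  have h1 : n * u ≤ 0.9 * (N ^ 2 * u ^ 2) := by nlinarith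
  have h2 : n ^ 2 * u ^ 3 ≤ N ^ 2 * (u ^ 2 + u ^ 4) / 2 := by
    have h2 : n ^ 2 ≤ N ^ 2 := by nlinarith
    have h3 : u ^ 3 ≤ (u ^ 2 + u ^ 4) / 2 := by nlinarith [mul_nonneg (sq_nonneg u) (sq_nonneg (u - 1))]
    nlinarith [mul_le_mul h2 h3 (by positivity) (by positivity)]
  have h3 : √2 * (n * u + n ^ 2 * u ^ 3) ≤ 2 * (N ^ 2 * (u ^ 2 + u ^ 4)) := by
    have h4 : (0 : ℝ) ≤ N ^ 2 * u ^ 2 := by positivity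
    have h5 : (0 : ℝ) ≤ N ^ 2 * u ^ 4 := by positivity
    calc √2 * (n * u + n ^ 2 * u ^ 3) ≤
          1.4143 * (0.9 * (N ^ 2 * u ^ 2) + N ^ 2 * (u ^ 2 + u ^ 4) / 2) := by
          gcongr
          exact sqrt_two_lt.le
      _ ≤ _ := by linarith
  have h4 : 0 ≤ √2 * (n * u + n ^ 2 * u ^ 3) := by positivity
  calc _ = e * (√2 * (n * u + n ^ 2 * u ^ 3)) * L := by field_simp
    _ ≤ (N * ε / 2) * (2 * (N ^ 2 * (u ^ 2 + u ^ 4))) * L := by gcongr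
    _ = _ := by ring

theorem sqrt_coeff_le_of_le (hnN : n + 1 ≤ N) (heN : e ≤ N * ε / 2)
    (hn : 0 ≤ n) (hε : 0 ≤ ε) :
    B * √(3 * n * e * u ^ 2) ≤ √(B ^ 2 * (3 * u ^ 2 + u ^ 4) * N ^ 3 * ε) / 2 := by
  have hN : 0 ≤ N := by linarith
  rw [le_div_iff₀ (by norm_num)]
  refine Real.le_sqrt_of_sq_le ?_
  by_cases he : 0 ≤ e
  · rw [mul_pow, mul_pow, Real.sq_sqrt (by positivity)]
    have h1 : 12 * (n * e) ≤ 3 * (N ^ 3 * ε) := by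
      have h2 : n * e ≤ n * (N * ε / 2) := by gcongr
      have h3 : 2 * n ≤ N ^ 2 := by nlinarith [sq_nonneg (N - 1)]
      have h4 : (2 * n) * (N * ε) ≤ N ^ 2 * (N * ε) := by gcongr
      nlinarith
    calc B ^ 2 * (3 * n * e * u ^ 2) * 2 ^ 2 = B ^ 2 * u ^ 2 * (12 * (n * e)) := by ring
      _ ≤ B ^ 2 * u ^ 2 * (3 * (N ^ 3 * ε)) := by gcongr
      _ ≤ B ^ 2 * u ^ 2 * (3 * (N ^ 3 * ε)) + B ^ 2 * u ^ 4 * (N ^ 3 * ε) :=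
        le_add_of_nonneg_right (by positivity)
      _ = _ := by ring
  · rw [Real.sqrt_eq_zero_of_nonpos (by
      have : n * e ≤ 0 := mul_nonpos_of_nonneg_of_nonpos hn (not_le.1 he).le
      nlinarith [mul_nonneg (neg_nonneg.2 this) (sq_nonneg u)])]
    simp only [mul_zero, zero_mul, ne_eq, OfNat.ofNat_ne_zero, not_false_eq_true, zero_pow]
    positivity

/-- For small u the part of the error linear in u is not controlled by u² + u⁴. It is kept aside
with the factor B = √β, to be absorbed by the square-root term of ψ. -/
theorem mean_noise_le (hn : 0 ≤ n) (hnN : n + 1 ≤ N) (heN : e ≤ N * ε / 2)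
    (he : 0 ≤ e) (hu : 0 < u) (hε : 0 ≤ ε) {M : ℝ} (hM : 0 ≤ M) (hML : M ≤ √2 * L)
    (hMB : M ≤ B) :
    n * e * u ^ 2 * (1 + n * u ^ 2) * (u⁻¹ * M) ≤
      n * e * u * B + (u ^ 2 + u ^ 4) * N ^ 3 * ε * L := by
  have hN : 0 ≤ N := by linarith
  have h2 : n ^ 2 * u ^ 3 ≤ N ^ 2 * (u ^ 2 + u ^ 4) / 2 := by
    have h2 : n ^ 2 ≤ N ^ 2 := by nlinarith
    have h3 : u ^ 3 ≤ (u ^ 2 + u ^ 4) / 2 := by nlinarith [mul_nonneg (sq_nonneg u) (sq_nonneg (u - 1))]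
    nlinarith [mul_le_mul h2 h3 (by positivity) (by positivity)]
  have h3 : M ≤ 2 * L := by
    have hL : 0 ≤ L := by
      by_contra h
      have := mul_neg_of_pos_of_neg (Real.sqrt_pos.2 (by norm_num : (0 : ℝ) < 2)) (not_le.1 h)
      linarith
    nlinarith [sqrt_two_lt]
  have hL : 0 ≤ L := by linarith
  have e1 : n * e * u ^ 2 * (1 + n * u ^ 2) * (u⁻¹ * M) =
      n * e * u * M + e * (n ^ 2 * u ^ 3) * M := by field_simp
  rw [e1]
  refine add_le_add (by gcongr) ?_
  calc e * (n ^ 2 * u ^ 3) * M ≤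
        (N * ε / 2) * (N ^ 2 * (u ^ 2 + u ^ 4) / 2) * (2 * L) := by gcongr
    _ = (u ^ 2 + u ^ 4) * N ^ 3 * ε * L / 2 := by ring
    _ ≤ _ := by
      have : 0 ≤ (u ^ 2 + u ^ 4) * N ^ 3 * ε * L := by positivity
      linarith

/-- Squaring the case assumption and using 4n ≤ N² gives n u² ≤ 1/3.24, where 3.24 = 4 · 0.9². -/
theorem mul_sq_le_of_lt (hn : 0 ≤ n) (hnN : n + 1 ≤ N) (hu : 0 < u)
    (hcase : 0.9 * N ^ 2 * u < n) : n * u ^ 2 ≤ 0.31 := by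
  have hN : 1 ≤ N := by linarith
  have h1 : 4 * n ≤ N ^ 2 := by nlinarith [sq_nonneg (N - 2)]
  have h2 : n ^ 2 ≤ N ^ 2 := by nlinarith
  have hN4 : 0 < N ^ 4 := by positivity
  have h3 : (0.9 * N ^ 2 * u) ^ 2 ≤ n ^ 2 := pow_le_pow_left₀ (by positivity) hcase.le 2
  have h4 : (4 * n) * n ^ 2 ≤ N ^ 2 * N ^ 2 := mul_le_mul h1 h2 (by positivity) (by positivity)
  have h5 : (n * u ^ 2) * (3.24 * N ^ 4) ≤ 1 * N ^ 4 := by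
    nlinarith [mul_le_mul_of_nonneg_left h3 (by linarith : 0 ≤ 4 * n)]
  have h6 : n * u ^ 2 * 3.24 ≤ 1 := le_of_mul_le_mul_right (by linarith) hN4
  linarith

/-- After squaring, the factor e² is at most Nε/2, since e is bounded both by 1 and by Nε/2. The
constant 1.2247 lies just below √(3/2), so that 2q² ≤ 3N². -/
theorem sqrt_coeff_le_of_lt (hn : 0 ≤ n) (hnN : n + 1 ≤ N) (heN : e ≤ N * ε / 2) (he : 0 ≤ e)
    (he1 : e ≤ 1) (hu : 0 < u)
    (hε : 0 ≤ ε) (hcase : 0.9 * N ^ 2 * u < n) :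
    n * e * u * B + B * (1.4 * (n * e * u ^ 2)) ≤
      √(B ^ 2 * (3 * u ^ 2 + u ^ 4) * N ^ 3 * ε) / 2 := by
  have hN : 1 ≤ N := by linarith
  have hN0 : 0 < N := by linarith
  set q := n * (1 + 1.4 * u) with hq
  have hqN : q ≤ 1.2247 * N := by
    have h1 : 0.9 * (n * u * N) ≤ N - 1 := by
      refine le_of_mul_le_mul_right (a := N) ?_ hN0
      nlinarith [mul_le_mul_of_nonneg_left hcase.le hn]
    refine le_of_mul_le_mul_right (a := N) ?_ hN0
    have h2 : q * N = n * N + 1.4 * (n * u * N) := by rw [hq]; ring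
    rw [h2]
    nlinarith [sq_nonneg (N - 2), mul_le_mul_of_nonneg_right hnN hN0.le]
  have hq0 : 0 ≤ q := by positivity
  have hq2 : 2 * q ^ 2 ≤ 3 * N ^ 2 := by nlinarith [pow_le_pow_left₀ hq0 hqN 2]
  have he2 : e ^ 2 ≤ N * ε / 2 := by nlinarith
  rw [le_div_iff₀ (by norm_num)]
  refine Real.le_sqrt_of_sq_le ?_
  calc ((n * e * u * B + B * (1.4 * (n * e * u ^ 2))) * 2) ^ 2 =
        B ^ 2 * u ^ 2 * (2 * (e ^ 2 * (2 * q ^ 2))) := by rw [hq]; ring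
    _ ≤ B ^ 2 * u ^ 2 * (2 * ((N * ε / 2) * (3 * N ^ 2))) := by gcongr
    _ = B ^ 2 * u ^ 2 * (3 * (N ^ 3 * ε)) := by ring
    _ ≤ B ^ 2 * u ^ 2 * (3 * (N ^ 3 * ε)) + B ^ 2 * u ^ 4 * (N ^ 3 * ε) :=
        le_add_of_nonneg_right (by positivity)
    _ = _ := by ring

theorem sqrt_sub_sqrt_le {a b c : ℝ} (hb : 0 ≤ b) (hc : 0 ≤ c) (hab : a ≤ b + c) :
    √a - √b ≤ √c := by
  rw [sub_le_iff_le_add']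
  refine Real.sqrt_le_iff.2 ⟨by positivity, ?_⟩
  rw [add_sq, Real.sq_sqrt hb, Real.sq_sqrt hc]
  have : 0 ≤ √b * √c := by positivity
  linarith

/-- When b is comparable to κ, the square root is Lipschitz at that scale: 0.83 ≤ √0.69 and 2.31 /
(2 · 0.83) < 1.4. -/
theorem sqrt_sub_sqrt_le_mul {a b κ c : ℝ} (hκ : 0 ≤ κ) (hκ1 : κ ≤ 1) (hc : 0 ≤ c)
    (hb : 0.69 * κ ≤ b) (hab : a ≤ b + κ * (2.31 * c)) : √a - √b ≤ 1.4 * c := by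
  have hs : 0 ≤ √κ := Real.sqrt_nonneg κ
  have hs2 : √κ ^ 2 = κ := Real.sq_sqrt hκ
  have hs1 : √κ ≤ 1 := Real.sqrt_le_one.2 hκ1
  have hb0 : 0 ≤ b := by nlinarith
  have h1 : 0.83 * √κ ≤ √b := by
    refine Real.le_sqrt_of_sq_le ?_
    rw [mul_pow, hs2]
    nlinarith
  rw [sub_le_iff_le_add']
  refine (Real.sqrt_le_sqrt hab).trans (Real.sqrt_le_iff.2 ⟨by positivity, ?_⟩)
  have h2 : 0 ≤ √κ * c := by positivity
  have h3 : κ * c ≤ √κ * c := by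
    refine mul_le_mul_of_nonneg_right ?_ hc
    nlinarith
  have h4 : 0.83 * √κ * c ≤ √b * c := by gcongr
  rw [add_sq, Real.sq_sqrt hb0]
  nlinarith [sq_nonneg c]

end Mismatch

/-! ### True posterior against computed posterior -/

section MismatchMatrix

variable {n : ℕ} {K M : Matrix (Fin n) (Fin n) ℝ} {σ : ℝ} {k l : Fin n → ℝ} {κ : ℝ}

/-- The effect on the posterior of replacing the true covariances `M`, `l` of the samples by the
covariances `K`, `k` of a model without drift. -/
theorem IsCov.posterior_mismatch (hK : IsCov K) (hM : IsCov M) (hσ : 0 < σ) {N : ℕ}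
    (hnN : n + 1 ≤ N) {e ε : ℝ} (he : 0 ≤ e) (he1 : e ≤ 1) (heN : e ≤ N * ε / 2) (hε : 0 ≤ ε)
    (hκ : 0 ≤ κ) (hκ1 : κ ≤ 1)
    (hKκ : ∀ c : Fin n → ℝ, 0 ≤ κ - 2 * (c ⬝ᵥ k) + c ⬝ᵥ (K *ᵥ c))
    (hk : ∀ i, |k i| ≤ √κ) (hkl : ∀ i, |k i - l i| ≤ e * √κ) (hMK : ∀ i j, |M i j - K i j| ≤ e)
    {f z : Fin n → ℝ} {b₀ L Z β b : ℝ} (hb₀ : 0 ≤ b₀) (hL : 0 ≤ L) (hZ : 0 ≤ Z)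
    (hZL : Z ≤ √2 * L) (hZβ : Z ≤ √β) (hβ : 0 ≤ β) (hb : 0 ≤ b) (hbβ : b ≤ √β)
    (hf : ∀ i, |f i| ≤ b₀ * L) (hz : ∀ i, |z i| ≤ σ * Z) :
    |l ⬝ᵥ ((reg M σ)⁻¹ *ᵥ (f + z)) - k ⬝ᵥ ((reg K σ)⁻¹ *ᵥ (f + z))| +
        b * (√(condVar M σ l κ) - √(condVar K σ k κ)) ≤
      (√(β * (3 * (σ ^ 2)⁻¹ + (σ ^ 4)⁻¹) * (N : ℝ) ^ 3 * ε) +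
        ((σ ^ 2)⁻¹ + (σ ^ 4)⁻¹) * (N : ℝ) ^ 3 * ε * (2 + b₀) * L) / 2 := by
  set B := √β with hB
  have hB0 : 0 ≤ B := Real.sqrt_nonneg β
  have hB2 : B ^ 2 = β := Real.sq_sqrt hβ
  set u := σ⁻¹ with hu
  have hu0 : 0 < u := inv_pos.2 hσ
  have hσu : σ = u⁻¹ := (inv_inv σ).symm
  have h2 : (σ ^ 2)⁻¹ = u ^ 2 := by rw [hu, inv_pow]
  have h4 : (σ ^ 4)⁻¹ = u ^ 4 := by rw [hu, inv_pow]
  have hn : (0 : ℝ) ≤ n := Nat.cast_nonneg n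
  have hnN' : (n : ℝ) + 1 ≤ N := by exact_mod_cast hnN
  have hmf := hK.abs_condMean_sub_le hM hσ he hκ1 hk hkl hMK (mul_nonneg hb₀ hL) hf
  have hmz := hK.abs_condMean_sub_le hM hσ he hκ1 hk hkl hMK (mul_nonneg hσ.le hZ) hz
  have hmean : |l ⬝ᵥ ((reg M σ)⁻¹ *ᵥ (f + z)) - k ⬝ᵥ ((reg K σ)⁻¹ *ᵥ (f + z))| ≤
      n * e * (σ ^ 2)⁻¹ * (1 + n * (σ ^ 2)⁻¹) * (b₀ * L) +
        n * e * (σ ^ 2)⁻¹ * (1 + n * (σ ^ 2)⁻¹) * (σ * Z) := by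
    refine le_trans (le_of_eq ?_) ((abs_add_le _ _).trans (add_le_add hmf hmz))
    rw [Matrix.mulVec_add, Matrix.mulVec_add, dotProduct_add, dotProduct_add]
    ring_nf
  have hΔ := hK.condVar_sub_le_weights hM hσ he hκ hk hkl hMK
  set W := ((reg K σ)⁻¹ *ᵥ k) ⬝ᵥ ((reg K σ)⁻¹ *ᵥ k) with hW
  have hfb := mean_coeff_le hn hnN' heN hu0 hε hL hb₀
  rw [h2] at hmean
  rw [h2, h4, ← hB2]
  have hne : 0 ≤ n * e := mul_nonneg hn he
  -- If n ≤ 0.9 N² u, the noise part of the mean error fits in the L-term of ψ, and √a - √b ≤ √(a -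
  -- b) handles the deviations. Otherwise n u² ≤ 0.31, the posterior variance stays near κ, and the
  -- excess deviation is linear in e. The square-root term of ψ then has room for the noise part,
  -- through Z ≤ √β.
  rcases le_or_gt (n : ℝ) (0.9 * (N : ℝ) ^ 2 * u) with hcase | hcase
  · have hWs : W ≤ u ^ 2 * κ := by
      have h := (hK.sq_mul_le_condVar hσ hKκ).trans (hK.condVar_le hσ)
      rw [← h2, inv_mul_eq_div, le_div_iff₀' (by positivity)]
      exact h
    have hv : condVar M σ l κ ≤ condVar K σ k κ + 3 * n * e * u ^ 2 := by
      have h5 : 2 * n * e * κ / σ ^ 2 = 2 * (n * e) * u ^ 2 * κ := by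
        rw [div_eq_mul_inv, h2]; ring
      have h6 : n * e * W ≤ n * e * (u ^ 2 * κ) := by gcongr
      have h7 : (n * e * u ^ 2) * κ ≤ (n * e * u ^ 2) * 1 := by gcongr
      rw [h5] at hΔ
      linarith
    have h5 : b * (√(condVar M σ l κ) - √(condVar K σ k κ)) ≤ B * √(3 * n * e * u ^ 2) :=
      (mul_le_mul_of_nonneg_left (sqrt_sub_sqrt_le (hK.condVar_nonneg hσ hKκ) (by positivity) hv) hb).trans
        (mul_le_mul_of_nonneg_right hbβ (Real.sqrt_nonneg _))
    have h6 := sqrt_coeff_le_of_le (u := u) (B := B) hnN' heN hn hε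
    have h7 := mean_noise_le_of_le hn hnN' heN hu0 hε hL hcase
    have h8 : n * e * u ^ 2 * (1 + n * u ^ 2) * (σ * Z) ≤
        n * e * u ^ 2 * (1 + n * u ^ 2) * (u⁻¹ * √2 * L) := by
      rw [hσu, mul_assoc u⁻¹]
      gcongr
    linarith
  · have hnu := mul_sq_le_of_lt hn hnN' hu0 hcase
    have hκb : 0.69 * κ ≤ condVar K σ k κ := by
      have h := hK.le_condVar hσ hκ hk
      rw [div_eq_mul_inv, h2] at h
      nlinarith
    have hWs : W ≤ u ^ 2 * (0.31 * κ) := by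
      have h := pow_le_pow_left₀ (Real.sqrt_nonneg _) (hK.sqrt_weights_le hσ hk) 2
      rw [Real.sq_sqrt (dotProduct_self_nonneg' _), mul_pow, mul_pow,
        Real.sq_sqrt (Nat.cast_nonneg n), Real.sq_sqrt hκ, h2] at h
      calc W ≤ (u ^ 2) ^ 2 * (n * κ) := h
        _ = u ^ 2 * ((n * u ^ 2) * κ) := by ring
        _ ≤ _ := by gcongr
    have hv : condVar M σ l κ ≤ condVar K σ k κ + κ * (2.31 * (n * e * u ^ 2)) := by
      have h5 : 2 * n * e * κ / σ ^ 2 = 2 * (n * e) * u ^ 2 * κ := by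
        rw [div_eq_mul_inv, h2]; ring
      have h6 : n * e * W ≤ n * e * (u ^ 2 * (0.31 * κ)) := by gcongr
      rw [h5] at hΔ
      linarith
    have h5 : b * (√(condVar M σ l κ) - √(condVar K σ k κ)) ≤ B * (1.4 * (n * e * u ^ 2)) :=
      (mul_le_mul_of_nonneg_left (sqrt_sub_sqrt_le_mul hκ hκ1 (by positivity) hκb hv) hb).trans (mul_le_mul_of_nonneg_right hbβ (by positivity))
    have h6 := sqrt_coeff_le_of_lt (B := B) hn hnN' heN he he1 hu0 hε hcase
    have h7 := mean_noise_le hn hnN' heN he hu0 hε hZ hZL hZβ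
    rw [← hσu] at h7
    linarith

end MismatchMatrix

/-! ### Posterior variances and information gain -/

section InformationGain

variable {E : Type*} {D : Set E} {k : E → E → ℝ} {σ : ℝ}

/-- A kernel is positive semidefinite on `D`. -/
structure IsPosKernel (D : Set E) (k : E → E → ℝ) : Prop where
  isCov : ∀ {n : ℕ} {x : Fin n → E}, (∀ i, x i ∈ D) → IsCov (gram k x)
  schur : ∀ {n : ℕ} {x : Fin n → E} {p : E}, (∀ i, x i ∈ D) → p ∈ D → ∀ c : Fin n → ℝ,
    0 ≤ k p p - 2 * (c ⬝ᵥ kvec k x p) + c ⬝ᵥ (gram k x *ᵥ c)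

theorem IsPosKernel.postVar_nonneg (h : IsPosKernel D k) (hσ : 0 < σ) {n : ℕ} {x : Fin n → E}
    {p : E} (hx : ∀ i, x i ∈ D) (hp : p ∈ D) : 0 ≤ postVar k σ x p :=
  (h.isCov hx).condVar_nonneg hσ (h.schur hx hp)

theorem IsPosKernel.postVar_le (h : IsPosKernel D k) (hσ : 0 < σ) {n : ℕ} {x : Fin n → E}
    {p : E} (hx : ∀ i, x i ∈ D) : postVar k σ x p ≤ k p p :=
  (h.isCov hx).condVar_le hσ

/-- The Schur complement of the old block in the enlarged matrix is σ² plus the posterior variance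
of the new point. -/
theorem IsPosKernel.det_reg_succ (h : IsPosKernel D k) (hσ : 0 < σ) {x : ℕ → E}
    (hx : ∀ i, x i ∈ D) (n : ℕ) :
    (reg (gram k fun i : Fin (n + 1) => x i) σ).det =
      (reg (gram k fun i : Fin n => x i) σ).det *
        (σ ^ 2 + postVar k σ (fun i : Fin n => x i) (x n)) := by
  set A := reg (gram k fun i : Fin n => x i) σ with hA
  have hu : IsUnit A := (h.isCov fun i => hx i).isUnit_reg hσ
  let : Invertible A := hu.invertible
  let v := kvec k (fun i : Fin n => x i) (x n)
  have e1 : (reg (gram k fun i : Fin (n + 1) => x i) σ).submatrix finSumFinEquiv finSumFinEquiv =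
      Matrix.fromBlocks A (Matrix.of fun i _ => v i) (Matrix.of fun _ j => v j)
        (Matrix.of fun _ _ : Fin 1 => k (x n) (x n) + σ ^ 2) := by
    have hsymm : ∀ i : Fin n, k (x n) (x i) = k (x i) (x n) := fun i =>
      (h.isCov (x := fun i : Fin (n + 1) => x i) fun i => hx i).symm (Fin.last n) i.castSucc
    ext i j
    rcases i with i | i <;> rcases j with j | j
    · simp [A, reg, gram, Matrix.one_apply]
    · have : Fin.castAdd 1 i ≠ Fin.natAdd n j := fun e => by
        have := congrArg Fin.val e
        simp at this
        omega
      simp [reg, gram, kvec, v, this]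
    · have : Fin.natAdd n i ≠ Fin.castAdd 1 j := fun e => by
        have := congrArg Fin.val e
        simp at this
        omega
      simp [reg, gram, kvec, v, this, hsymm]
    · have : i = j := Subsingleton.elim _ _
      subst this
      simp [reg, gram]
  rw [← Matrix.det_submatrix_equiv_self finSumFinEquiv, e1, Matrix.det_fromBlocks₁₁,
    Matrix.det_fin_one, Matrix.invOf_eq_nonsing_inv]
  congr 1
  have e2 : ((Matrix.of fun (_ : Fin 1) j => v j) * A⁻¹ * (Matrix.of fun i (_ : Fin 1) => v i)) 0 0 =
      v ⬝ᵥ (A⁻¹ *ᵥ v) := by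
    rw [Matrix.mul_assoc, Matrix.mul_apply]
    rfl
  rw [Matrix.sub_apply, e2, postVar]
  simp only [Matrix.of_apply]
  ring

theorem IsPosKernel.det_eq_prod (h : IsPosKernel D k) (hσ : 0 < σ) {x : ℕ → E}
    (hx : ∀ i, x i ∈ D) (n : ℕ) :
    (1 + (σ ^ 2)⁻¹ • gram k fun i : Fin n => x i).det =
      ∏ i ∈ Finset.range n, (1 + (σ ^ 2)⁻¹ * postVar k σ (fun j : Fin i => x j) (x i)) := by
  have hσ2 : σ ^ 2 ≠ 0 := by positivity
  have e : ∀ m, (1 + (σ ^ 2)⁻¹ • gram k fun i : Fin m => x i) =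
      (σ ^ 2)⁻¹ • reg (gram k fun i : Fin m => x i) σ := by
    intro m
    rw [reg, smul_add, smul_smul, inv_mul_cancel₀ hσ2, one_smul, add_comm]
  induction n with
  | zero => simp
  | succ n ih =>
    rw [Finset.prod_range_succ, ← ih, e, e, Matrix.det_smul, Matrix.det_smul,
      h.det_reg_succ hσ hx, Fintype.card_fin, Fintype.card_fin]
    rw [pow_succ]
    have : (σ ^ 2)⁻¹ * σ ^ 2 = 1 := inv_mul_cancel₀ hσ2
    linear_combination ((σ ^ 2)⁻¹ ^ n * (reg (gram k fun i : Fin n => x i) σ).det) * this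

theorem IsPosKernel.sum_log_eq (h : IsPosKernel D k) (hσ : 0 < σ) {x : ℕ → E}
    (hx : ∀ i, x i ∈ D) (n : ℕ) :
    ∑ i ∈ Finset.range n, Real.log (1 + (σ ^ 2)⁻¹ * postVar k σ (fun j : Fin i => x j) (x i)) =
      2 * infoGain k σ fun i : Fin n => x i := by
  rw [infoGain, h.det_eq_prod hσ hx, Real.log_prod fun i _ => ?_]
  · ring
  · have := h.postVar_nonneg hσ (fun j : Fin i => hx j) (hx i)
    positivity

/-- A real supremum dominates its members only when the set is bounded. Here every factor of the
determinant is at most 1 + σ⁻². -/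
theorem IsPosKernel.bddAbove_infoGain (h : IsPosKernel D k) (hσ : 0 < σ)
    (hk : ∀ p ∈ D, k p p ≤ 1) (hD : D.Nonempty) (n : ℕ) :
    BddAbove (Set.range fun x : Fin n → D => infoGain k σ fun i => (x i : E)) := by
  obtain ⟨x₀, hx₀⟩ := hD
  refine ⟨n * Real.log (1 + (σ ^ 2)⁻¹) / 2, ?_⟩
  rintro _ ⟨x, rfl⟩
  let x' : ℕ → E := fun i => if hi : i < n then x ⟨i, hi⟩ else x₀
  have hx' : ∀ i, x' i ∈ D := by
    intro i
    by_cases hi : i < n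
    · simp only [x', hi, dif_pos, Subtype.coe_prop]
    · simp only [x', hi, dif_neg, not_false_eq_true, hx₀]
  have e : (fun i : Fin n => (x i : E)) = fun i : Fin n => x' i := by
    ext i
    simp [x']
  have h1 := h.sum_log_eq hσ hx' n
  rw [← e] at h1
  have h2 : ∑ i ∈ Finset.range n,
      Real.log (1 + (σ ^ 2)⁻¹ * postVar k σ (fun j : Fin i => x' j) (x' i)) ≤
      ∑ _i ∈ Finset.range n, Real.log (1 + (σ ^ 2)⁻¹) := by
    refine Finset.sum_le_sum fun i _ => ?_
    have h3 := h.postVar_nonneg hσ (fun j : Fin i => hx' j) (hx' i)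
    have h4 := (h.postVar_le hσ (p := x' i) (fun j : Fin i => hx' j)).trans (hk _ (hx' i))
    refine Real.log_le_log (by positivity) ?_
    have : (σ ^ 2)⁻¹ * postVar k σ (fun j : Fin i => x' j) (x' i) ≤ (σ ^ 2)⁻¹ * 1 := by gcongr
    linarith
  rw [Finset.sum_const, Finset.card_range, nsmul_eq_mul] at h2
  change infoGain k σ (fun i : Fin n => (x i : E)) ≤ _
  linarith

theorem IsPosKernel.infoGain_le (h : IsPosKernel D k) (hσ : 0 < σ) (hk : ∀ p ∈ D, k p p ≤ 1)
    {n : ℕ} {x : Fin n → E} (hx : ∀ i, x i ∈ D) (hD : D.Nonempty) :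
    infoGain k σ x ≤ maxInfoGain D k σ n :=
  le_ciSup (h.bddAbove_infoGain hσ hk hD n) fun i => (⟨x i, hx i⟩ : D)

/-- Bernoulli's inequality (1+s)^v ≤ 1 + sv for v in [0,1]; the chord lies below a concave function.
-/
theorem mul_log_le_log {s v : ℝ} (hs : 0 ≤ s) (hv : 0 ≤ v) (hv1 : v ≤ 1) :
    v * Real.log (1 + s) ≤ Real.log (1 + s * v) := by
  rw [← Real.log_rpow (by positivity), mul_comm s v]
  exact Real.log_le_log (Real.rpow_pos_of_pos (by positivity) _)
    (rpow_one_add_le_one_add_mul_self (by linarith) hv hv1)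

/-- The length of the window is part of its type, so the two windows are compared through an F that
accepts every length. -/
theorem sinceReset_add {α : Type*} {F : ∀ {n : ℕ}, (Fin n → α) → ℝ} (v : ℕ → α) {N i : ℕ}
    (hi : i < N) (b : ℕ) :
    F (sinceReset N v (b * N + i)) = F fun j : Fin i => v (b * N + j) := by
  have h1 : (b * N + i) % N = i := by
    rw [mul_comm, Nat.mul_add_mod, Nat.mod_eq_of_lt hi]
  unfold sinceReset
  rw [h1]
  simp

theorem IsPosKernel.sum_postVar_le (h : IsPosKernel D k) (hσ : 0 < σ) (hk : ∀ p ∈ D, k p p ≤ 1)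
    {x : ℕ → E} (hx : ∀ i, x i ∈ D) {N : ℕ} (hN : 1 ≤ N) (T : ℕ) :
    ∑ s ∈ Finset.range T, postVar k σ (sinceReset N x s) (x s) ≤
      2 / Real.log (1 + (σ ^ 2)⁻¹) * ((T : ℝ) / N + 1) * maxInfoGain D k σ N := by
  have hD : D.Nonempty := ⟨x 0, hx 0⟩
  have hl : 0 < Real.log (1 + (σ ^ 2)⁻¹) := Real.log_pos (by
    have : 0 < (σ ^ 2)⁻¹ := by positivity
    linarith)
  set V : ℕ → ℝ := fun s => postVar k σ (sinceReset N x s) (x s) with hV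
  set G : ℕ → ℝ := fun s => Real.log (1 + (σ ^ 2)⁻¹ * V s) with hG
  have hV0 : ∀ s, 0 ≤ V s := fun s => h.postVar_nonneg hσ (fun j => hx _) (hx s)
  have hV1 : ∀ s, V s ≤ 1 := fun s => (h.postVar_le hσ fun j => hx _).trans (hk _ (hx s))
  have hG0 : ∀ s, 0 ≤ G s := fun s => Real.log_nonneg (by
    have := hV0 s
    have : 0 ≤ (σ ^ 2)⁻¹ * V s := by positivity
    linarith)
  have hVG : ∀ s, V s ≤ (Real.log (1 + (σ ^ 2)⁻¹))⁻¹ * G s := by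
    intro s
    rw [← div_eq_inv_mul, le_div_iff₀ hl]
    exact mul_log_le_log (by positivity) (hV0 s) (hV1 s)
  have hγ0 : ∀ b, ∑ i ∈ Finset.range N, G (b * N + i) ≤ 2 * maxInfoGain D k σ N := by
    intro b
    have h1 := h.sum_log_eq hσ (x := fun i => x (b * N + i)) (fun i => hx _) N
    have h2 := h.infoGain_le hσ hk (x := fun i : Fin N => x (b * N + i)) (fun i => hx _) hD
    refine le_trans (le_of_eq (Eq.trans (Finset.sum_congr rfl fun i hi => ?_) h1)) (by linarith)
    simp only [hG, hV]
    congr 3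
    exact sinceReset_add (F := fun w => postVar k σ w (x (b * N + i))) x (Finset.mem_range.1 hi) b
  have hγ : 0 ≤ 2 * maxInfoGain D k σ N :=
    (Finset.sum_nonneg fun i _ => hG0 _).trans (hγ0 0)
  have hblocks : ∀ m : ℕ, ∑ s ∈ Finset.range (m * N), G s ≤ m * (2 * maxInfoGain D k σ N) := by
    intro m
    induction m with
    | zero => simp
    | succ m ih =>
      rw [Nat.succ_mul, Finset.sum_range_add]
      push_cast
      linarith [hγ0 m]
  -- The last, possibly incomplete, block is extended to full length; the added terms are
  -- nonnegative.
  have hTN : T ≤ (T / N + 1) * N := by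
    have h1 := Nat.div_add_mod T N
    have h2 := Nat.mod_lt T hN
    nlinarith
  calc ∑ s ∈ Finset.range T, V s ≤ ∑ s ∈ Finset.range T, (Real.log (1 + (σ ^ 2)⁻¹))⁻¹ * G s :=
        Finset.sum_le_sum fun s _ => hVG s
    _ = (Real.log (1 + (σ ^ 2)⁻¹))⁻¹ * ∑ s ∈ Finset.range T, G s := by rw [Finset.mul_sum]
    _ ≤ (Real.log (1 + (σ ^ 2)⁻¹))⁻¹ * ∑ s ∈ Finset.range ((T / N + 1) * N), G s := by
        gcongr
        exact fun s _ _ => hG0 s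
    _ ≤ (Real.log (1 + (σ ^ 2)⁻¹))⁻¹ * (((T / N + 1 : ℕ) : ℝ) * (2 * maxInfoGain D k σ N)) := by
        gcongr
        exact hblocks _
    _ ≤ (Real.log (1 + (σ ^ 2)⁻¹))⁻¹ * (((T : ℝ) / N + 1) * (2 * maxInfoGain D k σ N)) := by
        gcongr
        push_cast
        gcongr
        exact Nat.cast_div_le
    _ = _ := by rw [div_eq_mul_inv]; ring

end InformationGain

/-! ### Lipschitz bounds and grids inside a convex set -/

section Discretization

variable {d : ℕ} {D : Set (EuclideanSpace ℝ (Fin d))}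

open scoped RealInnerProductSpace

/-- Mean value inequality along the segment, which stays in D. The chain rule holds for whichever
derivative within D `fderivWithin` selects, so D may have empty interior. -/
theorem abs_sub_le_of_partialD_le (hD : Convex ℝ D) {f : EuclideanSpace ℝ (Fin d) → ℝ}
    (hf : ContDiffOn ℝ 1 f D) {L : ℝ} (hL : ∀ j, ∀ p ∈ D, |partialD D j f p| ≤ L)
    {p q : EuclideanSpace ℝ (Fin d)} (hp : p ∈ D) (hq : q ∈ D) :
    |f q - f p| ≤ L * ∑ j, |q j - p j| := by
  have hmem : ∀ t ∈ Set.Icc (0 : ℝ) 1, p + t • (q - p) ∈ D := fun t ht =>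
    hD.add_smul_sub_mem hp hq ht
  have hline : ∀ t : ℝ, HasDerivWithinAt (fun t : ℝ => p + t • (q - p)) (q - p) (Set.Icc 0 1) t := by
    intro t
    have h := (((hasDerivAt_id t).smul_const (q - p)).const_add p).hasDerivWithinAt
      (s := Set.Icc (0 : ℝ) 1)
    simpa using h
  have hder : ∀ t ∈ Set.Icc (0 : ℝ) 1, HasDerivWithinAt (fun t : ℝ => f (p + t • (q - p)))
      (fderivWithin ℝ f D (p + t • (q - p)) (q - p)) (Set.Icc 0 1) t := by
    intro t ht
    have h1 := (hf.differentiableOn (by norm_num) _ (hmem t ht)).hasFDerivWithinAt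
    exact h1.comp_hasDerivWithinAt t (hline t) fun s hs => hmem s hs
  have hdecomp : q - p = ∑ j, (q j - p j) • EuclideanSpace.single j (1 : ℝ) := by
    ext i
    simp [Finset.sum_apply, Pi.single_apply]
  have hbound : ∀ t ∈ Set.Ico (0 : ℝ) 1,
      ‖fderivWithin ℝ f D (p + t • (q - p)) (q - p)‖ ≤ L * ∑ j, |q j - p j| := by
    intro t ht
    have ht' : t ∈ Set.Icc (0 : ℝ) 1 := ⟨ht.1, ht.2.le⟩
    generalize hT : fderivWithin ℝ f D (p + t • (q - p)) = A
    rw [hdecomp, map_sum, Finset.mul_sum]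
    refine (norm_sum_le _ _).trans (Finset.sum_le_sum fun j _ => ?_)
    rw [map_smul, norm_smul, Real.norm_eq_abs, mul_comm]
    refine mul_le_mul_of_nonneg_right ?_ (abs_nonneg _)
    rw [← hT]
    exact hL j _ (hmem t ht')
  have := norm_image_sub_le_of_norm_deriv_le_segment_01' hder hbound
  simpa using this

/-- The projection of u onto D: the angle at v between u and any p in D is obtuse. -/
theorem exists_norm_sub_le (hDc : IsCompact D) (hD : Convex ℝ D) (hne : D.Nonempty)
    (u : EuclideanSpace ℝ (Fin d)) : ∃ v ∈ D, ∀ p ∈ D, ‖p - v‖ ≤ ‖p - u‖ := by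
  obtain ⟨v, hv, hmin⟩ := exists_norm_eq_iInf_of_complete_convex hne hDc.isComplete hD u
  refine ⟨v, hv, fun p hp => ?_⟩
  have h := (norm_eq_iInf_iff_real_inner_le_zero hD hv).1 hmin p hp
  have e : p - u = (p - v) - (u - v) := by abel
  have h2 : ‖p - v‖ ^ 2 ≤ ‖p - u‖ ^ 2 := by
    rw [e, @norm_sub_sq_real _ _ _ (p - v) (u - v), real_inner_comm]
    nlinarith [sq_nonneg ‖u - v‖]
  exact le_of_sq_le_sq h2 (norm_nonneg _)

theorem exists_cell {a : ℝ} {m : ℕ} (hm : 1 ≤ m) (ha0 : 0 ≤ a) (ham : a ≤ m) :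
    ∃ i : Fin m, |a - (i + 1 / 2)| ≤ 1 / 2 := by
  by_cases h : a < m
  · have hi : ⌊a⌋₊ < m := (Nat.floor_lt ha0).2 h
    refine ⟨⟨⌊a⌋₊, hi⟩, abs_le.2 ⟨?_, ?_⟩⟩
    · have := Nat.floor_le ha0
      simp only
      linarith
    · have := Nat.lt_floor_add_one a
      simp only
      linarith
  · have ha : a = m := le_antisymm ham (not_lt.1 h)
    refine ⟨⟨m - 1, by omega⟩, ?_⟩
    simp only [ha, Nat.cast_sub hm, Nat.cast_one]
    rw [show (m : ℝ) - (m - 1 + 1 / 2) = 1 / 2 by ring]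
    norm_num

/-- Cell centres may lie outside D, so they are projected onto it, which brings them no farther from
any point of D in Euclidean norm. Cauchy-Schwarz then returns to the ℓ¹ distance without losing a
constant: √d · √d r/(2m). -/
theorem exists_grid (hDc : IsCompact D) (hD : Convex ℝ D) (hne : D.Nonempty) {r : ℝ} (hr : 0 < r)
    (hcube : ∀ p ∈ D, ∀ j, p j ∈ Set.Icc 0 r) {m : ℕ} (hm : 1 ≤ m) :
    ∃ c : (Fin d → Fin m) → EuclideanSpace ℝ (Fin d), (∀ i, c i ∈ D) ∧
      ∀ p ∈ D, ∃ i, ∑ j, |p j - c i j| ≤ d * (r / (2 * m)) := by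
  have hm0 : (0 : ℝ) < m := by exact_mod_cast hm
  let u : (Fin d → Fin m) → EuclideanSpace ℝ (Fin d) :=
    fun i => WithLp.toLp 2 fun j => ((i j : ℝ) + 1 / 2) * (r / m)
  choose c hcD hc using fun i => exists_norm_sub_le hDc hD hne (u i)
  refine ⟨c, hcD, fun p hp => ?_⟩
  have hcell : ∀ j, ∃ i : Fin m, |p j * (m / r) - (i + 1 / 2)| ≤ 1 / 2 := fun j => by
    obtain ⟨h0, h1⟩ := hcube p hp j
    refine exists_cell hm (by positivity) ?_
    calc p j * (m / r) ≤ r * (m / r) := by gcongr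
      _ = m := by field_simp
  choose i hi using hcell
  refine ⟨i, ?_⟩
  have h1 : ‖p - u i‖ ^ 2 ≤ d * (r / (2 * m)) ^ 2 := by
    rw [EuclideanSpace.norm_sq_eq]
    calc ∑ j, ‖(p - u i) j‖ ^ 2 ≤ ∑ _j : Fin d, (r / (2 * m)) ^ 2 := by
          refine Finset.sum_le_sum fun j _ => pow_le_pow_left₀ (norm_nonneg _) ?_ 2
          have e : (p - u i) j = (p j * (m / r) - (i j + 1 / 2)) * (r / m) := by
            simp only [PiLp.sub_apply, u]
            field_simp
          rw [e, Real.norm_eq_abs, abs_mul, abs_of_pos (by positivity : 0 < r / m)]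
          calc _ ≤ 1 / 2 * (r / m) := by
                gcongr
                exact hi j
            _ = _ := by field_simp
      _ = d * (r / (2 * m)) ^ 2 := by simp
  have h2 : (∑ j, |p j - c i j|) ^ 2 ≤ d * ‖p - c i‖ ^ 2 := by
    rw [EuclideanSpace.norm_sq_eq]
    have := sq_sum_le_card_mul_sum_sq (s := Finset.univ) (f := fun j => |p j - c i j|)
    simpa using this
  have h3 : ‖p - c i‖ ^ 2 ≤ ‖p - u i‖ ^ 2 := pow_le_pow_left₀ (norm_nonneg _) (hc i p hp) 2
  refine le_of_sq_le_sq ?_ (by positivity)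
  calc _ ≤ d * ‖p - c i‖ ^ 2 := h2
    _ ≤ d * (d * (r / (2 * m)) ^ 2) := by gcongr; exact h3.trans h1
    _ = _ := by ring

end Discretization

/-! ### Tail events and the budget of failure probabilities -/

section Tails

open Real in
-- For X < 1 the square root is 0 by convention and the claim is X ≤ 1, so degenerate logarithms in
-- the levels do no harm.
theorem mul_exp_neg_sqrt_log_sq_le {X : ℝ} (hX : 0 ≤ X) : X * exp (-(√(log X)) ^ 2) ≤ 1 := by
  rcases lt_or_ge X 1 with h | h
  · rw [sqrt_eq_zero_of_nonpos (log_nonpos hX h.le)]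
    simpa using h.le
  · have hX0 : 0 < X := by linarith
    rw [sq_sqrt (log_nonneg h), exp_neg, exp_log hX0, mul_inv_cancel₀ hX0.ne']

variable {Ω : Type*} [MeasurableSpace Ω] {μ : Measure Ω}

theorem measureReal_gaussian_tail_le [IsProbabilityMeasure μ] {Z : Ω → ℝ} (hZm : Measurable Z) {σ : ℝ} (hσ : 0 < σ)
    (hZ : μ.map Z = gaussianReal 0 (Real.toNNReal (σ ^ 2))) {a : ℝ} (ha : 0 ≤ a) :
    μ.real {ω | σ * (√2 * a) < |Z ω|} ≤ 2 * Real.exp (-a ^ 2) := by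
  have hv : (Real.toNNReal (σ ^ 2) : ℝ) = σ ^ 2 := Real.coe_toNNReal _ (sq_nonneg σ)
  have h2 : √2 ^ 2 = (2 : ℝ) := Real.sq_sqrt (by norm_num)
  have hint : ∀ t : ℝ, Integrable (fun ω => Real.exp (t * Z ω)) μ := by
    intro t
    have h := integrable_exp_mul_gaussianReal (μ := 0) (v := Real.toNNReal (σ ^ 2)) t
    rw [← hZ] at h
    exact h.comp_measurable hZm
  have hmgf : ∀ t : ℝ, mgf Z μ t = Real.exp (σ ^ 2 * t ^ 2 / 2) := fun t => by
    rw [mgf_gaussianReal hZ, hv]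
    simp
  have h3 : μ.real {ω | σ * (√2 * a) ≤ Z ω} ≤ Real.exp (-a ^ 2) := by
    have h := measure_ge_le_exp_mul_mgf (μ := μ) (X := Z) (σ * (√2 * a)) (t := √2 * a / σ)
      (by positivity) (hint _)
    rw [hmgf, ← Real.exp_add] at h
    refine h.trans (le_of_eq (congrArg Real.exp ?_))
    field_simp
    linear_combination (-a ^ 2) * h2
  have h4 : μ.real {ω | Z ω ≤ -(σ * (√2 * a))} ≤ Real.exp (-a ^ 2) := by
    have h := measure_le_le_exp_mul_mgf (μ := μ) (X := Z) (-(σ * (√2 * a))) (t := -(√2 * a / σ))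
      (by rw [Left.neg_nonpos_iff]; positivity) (hint _)
    rw [hmgf, ← Real.exp_add] at h
    refine h.trans (le_of_eq (congrArg Real.exp ?_))
    field_simp
    linear_combination (-a ^ 2) * h2
  calc _ ≤ μ.real ({ω | σ * (√2 * a) ≤ Z ω} ∪ {ω | Z ω ≤ -(σ * (√2 * a))}) := by
        refine measureReal_mono fun ω hω => ?_
        rcases lt_abs.1 (show σ * (√2 * a) < |Z ω| from hω) with h | h
        · exact Or.inl h.le
        · exact Or.inr (show Z ω ≤ _ by linarith)
    _ ≤ _ := (measureReal_union_le _ _).trans (by linarith)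

variable {d : ℕ} {D : Set (EuclideanSpace ℝ (Fin d))}
  {k : EuclideanSpace ℝ (Fin d) → EuclideanSpace ℝ (Fin d) → ℝ}
  {f : Ω → EuclideanSpace ℝ (Fin d) → ℝ} {a b : ℝ}

theorem SupTail.nonneg (h : SupTail μ D k a b) (hf : IsCenteredGP μ D k f)
    (hf1 : HasC1Paths μ D f) : 0 ≤ a := by
  have := measureReal_nonneg.trans (h f hf hf1 0 le_rfl)
  simpa using this

/-- The failure probability allotted to each event at time `t`. -/
def failProb (δ : ℝ) (t : ℕ) : ℝ := 3 * δ / (2 * Real.pi ^ 2 * (t : ℝ) ^ 2)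

theorem failProb_pos {δ : ℝ} (hδ : 0 < δ) {t : ℕ} (ht : 1 ≤ t) : 0 < failProb δ t := by
  have : (0 : ℝ) < t := by exact_mod_cast ht
  have := Real.pi_pos
  unfold failProb
  positivity

theorem SupTail.measureReal_le (h : SupTail μ D k a b) (hb : 0 < b) (hf : IsCenteredGP μ D k f)
    (hf1 : HasC1Paths μ D f) {δ : ℝ} (hδ : 0 < δ) {T : ℕ} (hT : 1 ≤ T) :
    μ.real {ω | ∃ p ∈ D, b * √(Real.log (2 * (1 + a) * Real.pi ^ 2 * (T : ℝ) ^ 2 / (3 * δ))) <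
      |f ω p|} ≤ failProb δ T := by
  have ha := h.nonneg hf hf1
  have hT0 : (0 : ℝ) < T := by exact_mod_cast hT
  have hp := failProb_pos hδ hT
  set X := 2 * (1 + a) * Real.pi ^ 2 * (T : ℝ) ^ 2 / (3 * δ) with hX
  have hXp : X * failProb δ T = 1 + a := by
    have := Real.pi_pos
    rw [hX, failProb]
    field_simp
  refine (h f hf hf1 _ (by positivity)).trans ?_
  rw [mul_div_cancel_left₀ _ hb.ne']
  have h1 := mul_exp_neg_sqrt_log_sq_le (X := X) (by have := Real.pi_pos; positivity)
  calc a * Real.exp (-√(Real.log X) ^ 2) ≤ (1 + a) * Real.exp (-√(Real.log X) ^ 2) := by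
        gcongr
        linarith
    _ = failProb δ T * (X * Real.exp (-√(Real.log X) ^ 2)) := by rw [← hXp]; ring
    _ ≤ failProb δ T * 1 := by gcongr
    _ = _ := mul_one _

theorem DerivTail.measureReal_le (h : DerivTail μ D k a b) (hb : 0 < b) (hf : IsCenteredGP μ D k f)
    (hf1 : HasC1Paths μ D f) {δ : ℝ} (hδ : 0 < δ) {t : ℕ} (ht : 1 ≤ t) :
    μ.real {ω | ∃ j, ∃ p ∈ D,
      b * √(Real.log (2 * d * a * Real.pi ^ 2 * (t : ℝ) ^ 2 / (3 * δ))) <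
        |partialD D j (f ω) p|} ≤ failProb δ t := by
  have ht0 : (0 : ℝ) < t := by exact_mod_cast ht
  have hp := failProb_pos hδ ht
  set X := 2 * d * a * Real.pi ^ 2 * (t : ℝ) ^ 2 / (3 * δ) with hX
  have hXp : X * failProb δ t = d * a := by
    have := Real.pi_pos
    rw [hX, failProb]
    field_simp
  -- No sign of a is assumed: for d > 0 it follows from the tail bound at L = 0, and for d = 0 the
  -- product vanishes.
  have hda : 0 ≤ d * a := by
    rcases Nat.eq_zero_or_pos d with rfl | hd
    · simp
    · have := measureReal_nonneg.trans (h f hf hf1 ⟨0, hd⟩ 0 le_rfl)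
      simp only [zero_div, ne_eq, OfNat.ofNat_ne_zero, not_false_eq_true, zero_pow, neg_zero,
        Real.exp_zero, mul_one] at this
      positivity
  have hX0 : 0 ≤ X := by
    by_contra hneg
    have := mul_neg_of_neg_of_pos (not_le.1 hneg) hp
    linarith
  have h1 := mul_exp_neg_sqrt_log_sq_le hX0
  calc _ = μ.real (⋃ j : Fin d, {ω | ∃ p ∈ D, b * √(Real.log X) < |partialD D j (f ω) p|}) := by
        congr 1
        ext ω
        simp
    _ ≤ ∑ j : Fin d, μ.real {ω | ∃ p ∈ D, b * √(Real.log X) < |partialD D j (f ω) p|} :=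
        measureReal_iUnion_fintype_le _
    _ ≤ ∑ _j : Fin d, a * Real.exp (-√(Real.log X) ^ 2) := by
        refine Finset.sum_le_sum fun j _ => ?_
        have := h f hf hf1 j (b * √(Real.log X)) (by positivity)
        rwa [mul_div_cancel_left₀ _ hb.ne'] at this
    _ = failProb δ t * (X * Real.exp (-√(Real.log X) ^ 2)) := by
        rw [Finset.sum_const, Finset.card_univ, Fintype.card_fin, nsmul_eq_mul, ← mul_assoc, ← hXp]
        ring
    _ ≤ failProb δ t * 1 := by gcongr
    _ = _ := mul_one _

theorem measureReal_noise_le [IsProbabilityMeasure μ] {Z : Ω → ℝ} (hZm : Measurable Z) {σ : ℝ} (hσ : 0 < σ)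
    (hZ : μ.map Z = gaussianReal 0 (Real.toNNReal (σ ^ 2))) {δ : ℝ} (hδ : 0 < δ) {T : ℕ}
    (hT : 1 ≤ T) :
    μ.real {ω | σ * (√2 * √(Real.log (2 * Real.pi ^ 2 * (T : ℝ) ^ 2 / (3 * δ)))) < |Z ω|} ≤
      2 * failProb δ T := by
  have hT0 : (0 : ℝ) < T := by exact_mod_cast hT
  have hpi := Real.pi_pos
  have hp := failProb_pos hδ hT
  set X := 2 * Real.pi ^ 2 * (T : ℝ) ^ 2 / (3 * δ) with hX
  have hXp : X * failProb δ T = 1 := by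
    rw [hX, failProb]
    field_simp
  have h1 := mul_exp_neg_sqrt_log_sq_le (X := X) (by positivity)
  refine (measureReal_gaussian_tail_le hZm hσ hZ (Real.sqrt_nonneg _)).trans ?_
  calc 2 * Real.exp (-√(Real.log X) ^ 2) =
        2 * (failProb δ T * (X * Real.exp (-√(Real.log X) ^ 2))) := by
        rw [← mul_assoc (failProb δ T), mul_comm (failProb δ T), hXp, one_mul]
    _ ≤ 2 * (failProb δ T * 1) := by gcongr
    _ = _ := by rw [mul_one]

theorem sum_inv_sq_le (T : ℕ) : ∑ s ∈ Finset.range T, 1 / ((s + 1 : ℕ) : ℝ) ^ 2 ≤ Real.pi ^ 2 / 6 := by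
  have h := (hasSum_nat_add_iff' (f := fun n : ℕ => 1 / (n : ℝ) ^ 2) 1).2 hasSum_zeta_two
  simp only [Finset.range_one, Finset.sum_singleton, Nat.cast_zero, ne_eq, OfNat.ofNat_ne_zero,
    not_false_eq_true, zero_pow, div_zero, sub_zero] at h
  exact sum_le_hasSum _ (fun i _ => by positivity) h

theorem sum_failProb_le {δ : ℝ} (hδ : 0 ≤ δ) (T : ℕ) :
    ∑ s ∈ Finset.range T, failProb δ (s + 1) ≤ δ / 4 := by
  have hpi := Real.pi_pos
  have e : ∀ s : ℕ, failProb δ (s + 1) =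
      3 * δ / (2 * Real.pi ^ 2) * (1 / ((s + 1 : ℕ) : ℝ) ^ 2) := fun s => by
    rw [failProb]
    field_simp
  simp only [e]
  rw [← Finset.mul_sum]
  calc _ ≤ 3 * δ / (2 * Real.pi ^ 2) * (Real.pi ^ 2 / 6) := by
        gcongr
        exact sum_inv_sq_le T
    _ = δ / 4 := by field_simp; ring

/-- Rewards and noise are bounded only at the T - 1 times before the last, since the observation at
time T is never used. Then 4(T-1) ≤ T² and π² > 9 suffice. -/
theorem sub_one_mul_failProb_le {δ : ℝ} (hδ : 0 ≤ δ) {T : ℕ} (hT : 1 ≤ T) :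
    ((T - 1 : ℕ) : ℝ) * (3 * failProb δ T) ≤ δ / 4 := by
  have hpi := Real.pi_gt_three
  have hT0 : (0 : ℝ) < T := by exact_mod_cast hT
  have hpi2 : 9 ≤ Real.pi ^ 2 := by nlinarith
  rw [failProb, Nat.cast_sub hT, Nat.cast_one, mul_div_assoc', mul_div_assoc',
    div_le_div_iff₀ (by positivity) (by norm_num)]
  have h1 : 4 * ((T : ℝ) - 1) ≤ (T : ℝ) ^ 2 := by nlinarith [sq_nonneg ((T : ℝ) - 2)]
  have h2 : δ * (4 * ((T : ℝ) - 1)) ≤ δ * (T : ℝ) ^ 2 := by gcongr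
  have h3 : δ * (T : ℝ) ^ 2 * 9 ≤ δ * (T : ℝ) ^ 2 * Real.pi ^ 2 := by gcongr
  nlinarith

end Tails

/-! ### Posterior bounds along a run of the algorithm -/

section Run

variable {Ω E : Type*} [MeasurableSpace Ω] {μ : Measure Ω} [IsProbabilityMeasure μ] {D : Set E}
  {k : E → E → ℝ} {g : ℕ → Ω → E → ℝ} {z : ℕ → Ω → ℝ} {ε σ : ℝ}

theorem timeDist_self (s : ℕ) : timeDist s s = 0 := by simp [timeDist]

/-- Positivity is inherited from the covariances of the innovations: with ε = 0 the space-time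
kernel is k itself. -/
theorem IsModel.isPosKernel (hm : IsModel μ D k σ g z) : IsPosKernel D k where
  isCov {n x} hx := by
    have h := isCov_timeKer (ε := 0) (by simp) hm.gp hm.indep_gp
      (τ := fun i : Fin n => (0, x i)) hx
    have e : gram (timeKer √(1 - 0) k) (fun i : Fin n => (0, x i)) = gram k x := by
      ext i j
      simp [gram, timeKer]
    rwa [e] at h
  schur {n x p} hx hp c := by
    have h := timeKer_schur_nonneg (ε := 0) (by simp) hm.gp hm.indep_gp
      (τ := fun i : Fin n => (0, x i)) hx (q := (0, p)) hp c
    have e : gram (timeKer √(1 - 0) k) (fun i : Fin n => (0, x i)) = gram k x := by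
      ext i j
      simp [gram, timeKer]
    have e2 : kvec (timeKer √(1 - 0) k) (fun i : Fin n => (0, x i)) (0, p) = kvec k x p := by
      ext i
      simp [kvec, timeKer]
    rw [e, e2] at h
    simpa [timeKer] using h

theorem IsPosKernel.diag_nonneg (h : IsPosKernel D k) {p : E} (hp : p ∈ D) : 0 ≤ k p p := by
  have := h.schur (x := fun i : Fin 0 => p) (fun _ => hp) hp 0
  simpa using this

/-- Test positivity with the single weight c = k(q,p) and use k(q,q) ≤ 1. The bound scales with
√k(p,p), as the mismatch estimate requires at points of small variance. -/
theorem IsPosKernel.abs_le_sqrt (h : IsPosKernel D k) (hk : ∀ p ∈ D, k p p ≤ 1) {p q : E}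
    (hp : p ∈ D) (hq : q ∈ D) : |k q p| ≤ √(k p p) := by
  refine Real.abs_le_sqrt ?_
  have h1 := h.schur (x := fun _ : Fin 1 => q) (fun _ => hq) hp fun _ => k q p
  simp only [dotProduct, kvec, gram, Matrix.mulVec, Matrix.of_apply, Finset.univ_unique,
    Finset.sum_singleton] at h1
  nlinarith [mul_le_mul_of_nonneg_left (hk q hq) (sq_nonneg (k q p))]

/-- Rounding the exponent m up to the even number 2⌈m/2⌉ removes the square root, and Bernoulli's
inequality applies. Lags in a block satisfy m + 1 ≤ N, so the rounding costs nothing. -/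
theorem one_sub_sqrt_pow_le (hε : ε ∈ Set.Icc (0 : ℝ) 1) (m : ℕ) :
    1 - √(1 - ε) ^ m ≤ (m + 1) * ε / 2 := by
  have h0 : 0 ≤ 1 - ε := by linarith [hε.2]
  have h1 : √(1 - ε) ≤ 1 := Real.sqrt_le_one.2 (by linarith [hε.1])
  set j := (m + 1) / 2 with hj
  have h2 : √(1 - ε) ^ (2 * j) ≤ √(1 - ε) ^ m :=
    pow_le_pow_of_le_one (Real.sqrt_nonneg _) h1 (by omega)
  rw [pow_mul, Real.sq_sqrt h0] at h2
  have h3 := one_add_mul_le_pow (a := -ε) (by linarith [hε.2]) j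
  rw [← sub_eq_add_neg] at h3
  have h4 : (j : ℝ) ≤ (m + 1) / 2 := by
    have := Nat.cast_div_le (α := ℝ) (m := m + 1) (n := 2)
    push_cast at this
    exact this
  nlinarith [mul_le_mul_of_nonneg_right h4 hε.1]

theorem one_sub_sqrt_pow_nonneg (hε : ε ∈ Set.Icc (0 : ℝ) 1) (m : ℕ) :
    0 ≤ 1 - √(1 - ε) ^ m :=
  sub_nonneg.2 (pow_le_one₀ (Real.sqrt_nonneg _) (Real.sqrt_le_one.2 (by linarith [hε.1])))

/-- The posterior of the drifting reward functions differs little from the posterior that the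
algorithm computes. -/
theorem IsModel.posterior_mismatch (hm : IsModel μ D k σ g z) (hε : ε ∈ Set.Icc (0 : ℝ) 1)
    (hσ : 0 < σ) (hk : ∀ p ∈ D, k p p ≤ 1) {n N : ℕ} (hnN : n + 1 ≤ N) (t : ℕ) {x : Fin n → E}
    (hx : ∀ i, x i ∈ D) {p : E} (hp : p ∈ D) {f ζ : Fin n → ℝ} {b₀ L Z β b : ℝ} (hb₀ : 0 ≤ b₀)
    (hL : 0 ≤ L) (hZ : 0 ≤ Z) (hZL : Z ≤ √2 * L) (hZβ : Z ≤ √β) (hβ : 0 ≤ β) (hb : 0 ≤ b)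
    (hbβ : b ≤ √β) (hf : ∀ i, |f i| ≤ b₀ * L) (hζ : ∀ i, |ζ i| ≤ σ * Z) :
    |postMean (timeKer √(1 - ε) k) σ (fun i : Fin n => (t + (i : ℕ), x i)) (f + ζ) (t + n, p) -
          postMean k σ x (f + ζ) p| +
        b * (√(postVar (timeKer √(1 - ε) k) σ (fun i : Fin n => (t + (i : ℕ), x i)) (t + n, p)) -
          √(postVar k σ x p)) ≤
      (√(β * (3 * (σ ^ 2)⁻¹ + (σ ^ 4)⁻¹) * (N : ℝ) ^ 3 * ε) +
        ((σ ^ 2)⁻¹ + (σ ^ 4)⁻¹) * (N : ℝ) ^ 3 * ε * (2 + b₀) * L) / 2 := by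
  have hpos := hm.isPosKernel
  set τ : Fin n → ℕ × E := fun i => (t + (i : ℕ), x i) with hτ
  -- The cap at 1 provides e² ≤ Nε/2 in the regime of small u.
  set e := min 1 ((N : ℝ) * ε / 2) with he
  have he0 : 0 ≤ e := le_min zero_le_one (by have := hε.1; positivity)
  have hρ : ∀ m : ℕ, m + 1 ≤ N → |1 - √(1 - ε) ^ m| ≤ e := by
    intro m hmN
    rw [abs_of_nonneg (one_sub_sqrt_pow_nonneg hε m)]
    refine le_min ?_ ((one_sub_sqrt_pow_le hε m).trans ?_)
    · have : 0 ≤ √(1 - ε) ^ m := by positivity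
      linarith
    · have : ((m : ℝ) + 1) ≤ N := by exact_mod_cast hmN
      have := hε.1
      gcongr
  have hkvec : ∀ i, |kvec k x p i| ≤ √(k p p) := fun i => hpos.abs_le_sqrt hk hp (hx i)
  have hκ : timeKer √(1 - ε) k (t + n, p) (t + n, p) = k p p := by
    simp [timeKer, timeDist_self]
  have main := (hpos.isCov hx).posterior_mismatch (isCov_timeKer hε hm.gp hm.indep_gp (τ := τ) hx)
    hσ hnN he0 (min_le_left _ _) (min_le_right _ _) hε.1 (hpos.diag_nonneg hp) (hk p hp)
    (hpos.schur hx hp) hkvec (l := kvec (timeKer √(1 - ε) k) τ (t + n, p)) (by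
      intro i
      have e1 : kvec k x p i - kvec (timeKer √(1 - ε) k) τ (t + n, p) i =
          (1 - √(1 - ε) ^ timeDist (t + i) (t + n)) * kvec k x p i := by
        simp only [kvec, timeKer, τ]
        ring
      rw [e1, abs_mul]
      refine mul_le_mul (hρ _ ?_) (hkvec i) (abs_nonneg _) he0
      have := i.2
      simp only [timeDist]
      omega) (by
      intro i j
      have e1 : gram (timeKer √(1 - ε) k) τ i j - gram k x i j =
          -((1 - √(1 - ε) ^ timeDist (t + i) (t + j)) * k (x i) (x j)) := by
        simp only [gram, timeKer, τ, Matrix.of_apply]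
        ring
      rw [e1, abs_neg, abs_mul]
      have h1 : |k (x i) (x j)| ≤ 1 :=
        (hpos.abs_le_sqrt hk (hx j) (hx i)).trans (Real.sqrt_le_one.2 (hk _ (hx j)))
      refine (mul_le_mul (hρ _ ?_) h1 (abs_nonneg _) he0).trans_eq (mul_one e)
      have := i.2
      have := j.2
      simp only [timeDist]
      omega) hb₀ hL hZ hZL hZβ hβ hb hbβ hf hζ
  rw [postVar, hκ]
  exact main

/-- The posterior mean of the reward functions given the samples since the last reset. -/
def trueMean (ε : ℝ) (k : E → E → ℝ) (σ : ℝ) (N : ℕ) (x : ℕ → Ω → E) (y : ℕ → Ω → ℝ) (s : ℕ)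
    (ω : Ω) (p : E) : ℝ :=
  postMean (timeKer √(1 - ε) k) σ
    (fun i : Fin (s % N) => (s - s % N + (i : ℕ), x (s - s % N + i) ω))
    (fun i : Fin (s % N) => y (s - s % N + i) ω) (s, p)

/-- The posterior variance of the reward functions given the samples since the last reset. -/
def trueVar (ε : ℝ) (k : E → E → ℝ) (σ : ℝ) (N : ℕ) (x : ℕ → Ω → E) (s : ℕ) (ω : Ω) (p : E) : ℝ :=
  postVar (timeKer √(1 - ε) k) σ
    (fun i : Fin (s % N) => (s - s % N + (i : ℕ), x (s - s % N + i) ω)) (s, p)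

theorem IsRun.rule_block {Ω E : Type*} [MeasurableSpace E] {D : Set E} {k : E → E → ℝ}
    {z : ℕ → Ω → ℝ} {σ : ℝ} {β : ℕ → ℝ} {N : ℕ} {x : ℕ → Ω → E} {y : ℕ → Ω → ℝ}
    {f : ℕ → Ω → E → ℝ}
    (hrun : IsRun D k σ β N f z x y) (s : ℕ) :
    ∀ i < s % N, ∃ φ : (Fin i → ℝ) → E, Measurable φ ∧
      ∀ ω, x (s - s % N + i) ω = φ fun j => y (s - s % N + j) ω := by
  intro i hi
  obtain ⟨φ, hφ, h⟩ := hrun.rule (s - s % N + i)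
  have hmod : (s - s % N + i) % N = i := by
    have h1 : s - s % N = N * (s / N) := by
      have := Nat.div_add_mod s N
      omega
    rcases Nat.eq_zero_or_pos N with rfl | hN
    · simp at hi ⊢
    · rw [h1, Nat.mul_add_mod, Nat.mod_eq_of_lt (hi.trans (Nat.mod_lt _ hN))]
  unfold sinceReset at h
  revert φ
  rw [hmod]
  intro φ hφ h
  refine ⟨φ, hφ, fun ω => ?_⟩
  simpa using h ω

variable [PseudoMetricSpace E] [MeasurableSpace E] [BorelSpace E] [SecondCountableTopology E]
  {β : ℕ → ℝ} {N : ℕ} {x : ℕ → Ω → E} {y : ℕ → Ω → ℝ}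

theorem IsRun.measureReal_grid_le (hrun : IsRun D k σ β N (reward ε g) z x y)
    (hm : IsModel μ D k σ g z) (hε : ε ∈ Set.Icc (0 : ℝ) 1) (hσ : 0 < σ) (hD : MeasurableSet D)
    (hcont : ∀ s, ∀ᵐ ω ∂μ, ContinuousOn (reward ε g s ω) D) (s : ℕ) {ι : Type*} [Fintype ι]
    {c : ι → E} (hc : ∀ i, c i ∈ D) {b : ℝ} (hb : 0 ≤ b) :
    μ.real {ω | ∃ i, √b * √(trueVar ε k σ N x s ω (c i)) <
      reward ε g s ω (c i) - trueMean ε k σ N x y s ω (c i)} ≤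
      Fintype.card ι * Real.exp (-b / 2) := by
  have h1 : ∀ i, μ.real {ω | √b * √(trueVar ε k σ N x s ω (c i)) <
      reward ε g s ω (c i) - trueMean ε k σ N x y s ω (c i)} ≤ Real.exp (-b / 2) := by
    intro i
    have h := measure_posterior_tail hm hε hσ hD hcont hrun.mem hrun.obs (hrun.rule_block s)
      (π := fun _ => c i) measurable_const (fun _ => hc i) s (c := 1) (by norm_num) hb
    simp only [one_mul] at h
    exact ENNReal.toReal_le_of_le_ofReal (Real.exp_pos _).le h
  calc _ = μ.real (⋃ i, {ω | √b * √(trueVar ε k σ N x s ω (c i)) <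
      reward ε g s ω (c i) - trueMean ε k σ N x y s ω (c i)}) := by
        congr 1
        ext ω
        simp
    _ ≤ ∑ _i : ι, Real.exp (-b / 2) :=
        (measureReal_iUnion_fintype_le _).trans (Finset.sum_le_sum fun i _ => h1 i)
    _ = _ := by rw [Finset.sum_const, Finset.card_univ, nsmul_eq_mul]

/-- The query is a function of the data, so one lower-tail event suffices and no union over D is
taken. -/
theorem IsRun.measureReal_query_le (hrun : IsRun D k σ β N (reward ε g) z x y)
    (hm : IsModel μ D k σ g z) (hε : ε ∈ Set.Icc (0 : ℝ) 1) (hσ : 0 < σ) (hD : MeasurableSet D)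
    (hcont : ∀ s, ∀ᵐ ω ∂μ, ContinuousOn (reward ε g s ω) D) (s : ℕ) {b : ℝ} (hb : 0 ≤ b) :
    μ.real {ω | √b * √(trueVar ε k σ N x s ω (x s ω)) <
      trueMean ε k σ N x y s ω (x s ω) - reward ε g s ω (x s ω)} ≤ Real.exp (-b / 2) := by
  classical
  obtain ⟨ω₀⟩ : Nonempty Ω := μ.nonempty_of_neZero
  obtain ⟨φ, hφ, hx⟩ := hrun.rule s
  let π : (Fin (s % N) → ℝ) → E := fun y => if φ y ∈ D then φ y else x 0 ω₀
  have hπ : Measurable π := Measurable.ite (hφ hD) hφ measurable_const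
  have hπD : ∀ y, π y ∈ D := by
    intro y
    simp only [π]
    split_ifs with h
    · exact h
    · exact hrun.mem _ _
  have hπx : ∀ ω, π (fun i : Fin (s % N) => y (s - s % N + i) ω) = x s ω := by
    intro ω
    have h1 : x s ω = φ fun i : Fin (s % N) => y (s - s % N + i) ω := hx ω
    have h2 : φ (fun i : Fin (s % N) => y (s - s % N + i) ω) ∈ D := h1 ▸ hrun.mem s ω
    simp only [π, h2, if_true, h1]
  have h := measure_posterior_tail hm hε hσ hD hcont hrun.mem hrun.obs (hrun.rule_block s)
    hπ hπD s (c := -1) (by norm_num) hb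
  simp only [hπx, neg_mul, one_mul, neg_sub] at h
  exact ENNReal.toReal_le_of_le_ofReal (Real.exp_pos _).le h

end Run

/-! ### The confidence parameter β and the UCB inequality -/

section Confidence

variable {d : ℕ} {r a b δ : ℝ}

/-- `τ_t = r d b t² √(log (2 d a π² t² / (3 δ)))`, the number of cells per coordinate of the
discretization at time `t`. -/
def cells (d : ℕ) (r a b δ : ℝ) (t : ℕ) : ℝ :=
  r * d * b * (t : ℝ) ^ 2 * √(Real.log (2 * d * a * Real.pi ^ 2 * (t : ℝ) ^ 2 / (3 * δ)))

theorem beta_eq (d : ℕ) (r a b δ : ℝ) (t : ℕ) :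
    beta d r a b δ t = 2 * Real.log (2 * Real.pi ^ 2 * (t : ℝ) ^ 2 / (3 * δ)) +
      2 * d * Real.log (cells d r a b δ t) := rfl

theorem one_le_confidence (hδ : δ ∈ Set.Ioo (0 : ℝ) 1) {t : ℕ} (ht : 1 ≤ t) :
    1 ≤ 2 * Real.pi ^ 2 * (t : ℝ) ^ 2 / (3 * δ) := by
  obtain ⟨h0, h1⟩ := hδ
  have ht' : (1 : ℝ) ≤ t := by exact_mod_cast ht
  have hpi := Real.pi_gt_three
  rw [le_div_iff₀ (by positivity)]
  have h2 : 9 ≤ Real.pi ^ 2 := by nlinarith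
  have h3 : 1 ≤ (t : ℝ) ^ 2 := by nlinarith
  nlinarith [mul_le_mul h2 h3 (by norm_num) (by positivity)]

theorem two_log_le_beta {t : ℕ} (h : 1 ≤ cells d r a b δ t) :
    2 * Real.log (2 * Real.pi ^ 2 * (t : ℝ) ^ 2 / (3 * δ)) ≤ beta d r a b δ t := by
  rw [beta_eq]
  have := Real.log_nonneg h
  have : 0 ≤ 2 * (d : ℝ) * Real.log (cells d r a b δ t) := by positivity
  linarith

theorem beta_nonneg (hδ : δ ∈ Set.Ioo (0 : ℝ) 1) {t : ℕ} (ht : 1 ≤ t)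
    (h : 1 ≤ cells d r a b δ t) : 0 ≤ beta d r a b δ t := by
  have := Real.log_nonneg (one_le_confidence hδ ht)
  linarith [two_log_le_beta h]

theorem cells_mono (hr : 0 ≤ r) (hb : 0 ≤ b) {s t : ℕ} (hs : 1 ≤ s) (hst : s ≤ t) :
    cells d r a b δ s ≤ cells d r a b δ t := by
  have hs' : (0 : ℝ) < s := by exact_mod_cast hs
  have hst' : (s : ℝ) ≤ t := by exact_mod_cast hst
  have hlog : Real.log (2 * d * a * Real.pi ^ 2 * (s : ℝ) ^ 2 / (3 * δ)) ≤
      Real.log (2 * d * a * Real.pi ^ 2 * (t : ℝ) ^ 2 / (3 * δ)) := by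
    have e : ∀ u : ℝ, 2 * d * a * Real.pi ^ 2 * u ^ 2 / (3 * δ) =
        (2 * d * a * Real.pi ^ 2 / (3 * δ)) * u ^ 2 := fun u => by ring
    rw [e, e]
    by_cases hc : 2 * d * a * Real.pi ^ 2 / (3 * δ) = 0
    · simp [hc]
    · have ht' : (0 : ℝ) < t := hs'.trans_le hst'
      rw [Real.log_mul hc (by positivity), Real.log_mul hc (by positivity)]
      have := Real.log_le_log (by positivity) (pow_le_pow_left₀ hs'.le hst' 2)
      linarith
  unfold cells
  gcongr

theorem pos_of_one_le_cells (hb : 0 ≤ b) {t : ℕ} (h : 1 ≤ cells d r a b δ t) : 0 < r := by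
  have h1 : 0 < cells d r a b δ t := by linarith
  have e : cells d r a b δ t = r * (d * b * (t : ℝ) ^ 2 *
      √(Real.log (2 * d * a * Real.pi ^ 2 * (t : ℝ) ^ 2 / (3 * δ)))) := by
    rw [cells]
    ring
  rw [e] at h1
  exact pos_of_mul_pos_left h1 (by positivity)

theorem beta_mono (hδ : 0 < δ) (hr : 0 ≤ r) (hb : 0 ≤ b) {s t : ℕ} (hs : 1 ≤ s) (hst : s ≤ t)
    (h : 1 ≤ cells d r a b δ s) : beta d r a b δ s ≤ beta d r a b δ t := by
  have hs' : (0 : ℝ) < s := by exact_mod_cast hs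
  have hst' : (s : ℝ) ≤ t := by exact_mod_cast hst
  have hpi := Real.pi_pos
  have h1 := cells_mono (d := d) (a := a) (δ := δ) hr hb hs hst
  have h0 : 0 < cells d r a b δ s := by linarith
  have h2 := Real.log_le_log h0 h1
  have h3 : Real.log (2 * Real.pi ^ 2 * (s : ℝ) ^ 2 / (3 * δ)) ≤
      Real.log (2 * Real.pi ^ 2 * (t : ℝ) ^ 2 / (3 * δ)) :=
    Real.log_le_log (by positivity) (by gcongr)
  rw [beta_eq, beta_eq]
  have h4 := mul_le_mul_of_nonneg_left h2 (by positivity : (0 : ℝ) ≤ 2 * d)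
  linarith

/-- The identity behind the choice of β: the number of grid points times the tail at one point is
the allotted failure probability. -/
theorem exp_neg_beta_le (hδ : 0 < δ) {t : ℕ} (ht : 1 ≤ t) (h : 1 ≤ cells d r a b δ t) :
    cells d r a b δ t ^ d * Real.exp (-beta d r a b δ t / 2) = failProb δ t := by
  have ht' : (0 : ℝ) < t := by exact_mod_cast ht
  have hpi := Real.pi_pos
  have h0 : 0 < cells d r a b δ t := by linarith
  have e : -beta d r a b δ t / 2 = -Real.log (2 * Real.pi ^ 2 * (t : ℝ) ^ 2 / (3 * δ)) -
      Real.log (cells d r a b δ t ^ d) := by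
    rw [beta_eq, Real.log_pow]
    ring
  rw [e, Real.exp_sub, Real.exp_neg, Real.exp_log (by positivity), Real.exp_log (by positivity),
    failProb, mul_div_cancel₀ _ (by positivity), inv_div]

/-- Here β stands for √β_t; the letters m, v denote the true posterior mean and deviation, and μ, κ
the computed ones. Half of Ψ pays for passing to the computed upper bound at c, the other half for
returning to the true posterior at x. -/
theorem ucb_step {fc fx mc mx vc vx μc μx κc κx β Ψ : ℝ} (hc : fc - mc ≤ β * vc)
    (hx : mx - fx ≤ β * vx) (hμc : |mc - μc| + β * (vc - κc) ≤ Ψ / 2)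
    (hμx : |mx - μx| + β * (vx - κx) ≤ Ψ / 2) (hmax : μc + β * κc ≤ μx + β * κx) :
    fc - fx ≤ 2 * (β * κx) + Ψ := by
  have h1 := le_abs_self (mc - μc)
  have h2 := neg_abs_le (mx - μx)
  linarith

theorem sum_sqrt_le {T : ℕ} {v : ℕ → ℝ} (hv : ∀ s, 0 ≤ v s) :
    ∑ s ∈ Finset.range T, √(v s) ≤ √(T * ∑ s ∈ Finset.range T, v s) := by
  refine Real.le_sqrt_of_sq_le ?_
  have := sq_sum_le_card_mul_sum_sq (s := Finset.range T) (f := fun s => √(v s))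
  simpa [Real.sq_sqrt (hv _)] using this

end Confidence

/-! ### Regret of a step and its summation -/

section Regret

variable {Ω : Type*} [MeasurableSpace Ω] {μ : Measure Ω} [IsProbabilityMeasure μ] {d : ℕ} {r : ℝ}
  {D : Set (EuclideanSpace ℝ (Fin d))}
  {k : EuclideanSpace ℝ (Fin d) → EuclideanSpace ℝ (Fin d) → ℝ} {σ ε : ℝ}
  {g : ℕ → Ω → EuclideanSpace ℝ (Fin d) → ℝ} {z : ℕ → Ω → ℝ} {a₀ b₀ a₁ b₁ δ : ℝ} {N T : ℕ}
  {x : ℕ → Ω → EuclideanSpace ℝ (Fin d)} {y : ℕ → Ω → ℝ} {β : ℕ → ℝ}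

theorem psi_nonneg (hε : 0 ≤ ε) (hb₀ : 0 ≤ b₀) (βT : ℝ) : 0 ≤ psi σ a₀ b₀ δ βT T N ε := by
  unfold psi
  positivity

theorem noise_level_le (hδ : δ ∈ Set.Ioo (0 : ℝ) 1) (hT : 1 ≤ T) (ha₀ : 0 ≤ a₀) :
    √(Real.log (2 * Real.pi ^ 2 * (T : ℝ) ^ 2 / (3 * δ))) ≤
      √(Real.log (2 * (1 + a₀) * Real.pi ^ 2 * (T : ℝ) ^ 2 / (3 * δ))) := by
  have h1 := one_le_confidence hδ hT
  have hδ0 := hδ.1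
  refine Real.sqrt_le_sqrt (Real.log_le_log (by linarith) ?_)
  gcongr
  have := Real.pi_pos
  nlinarith

theorem IsRun.mismatch (hrun : IsRun D k σ β N (reward ε g) z x y) (hm : IsModel μ D k σ g z)
    (hε : ε ∈ Set.Icc (0 : ℝ) 1) (hσ : 0 < σ) (hk : ∀ p ∈ D, k p p ≤ 1) (hN : 1 ≤ N)
    (hδ : δ ∈ Set.Ioo (0 : ℝ) 1) (hb₀ : 0 ≤ b₀) (ha₀ : 0 ≤ a₀) (hT : 1 ≤ T) {βT b : ℝ}
    (hβ : 2 * Real.log (2 * Real.pi ^ 2 * (T : ℝ) ^ 2 / (3 * δ)) ≤ βT) (hb : b ≤ βT) {ω : Ω}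
    {s : ℕ}
    (hf : ∀ i < s, ∀ p ∈ D, |reward ε g i ω p| ≤
      b₀ * √(Real.log (2 * (1 + a₀) * Real.pi ^ 2 * (T : ℝ) ^ 2 / (3 * δ))))
    (hz : ∀ i < s, |z i ω| ≤
      σ * (√2 * √(Real.log (2 * Real.pi ^ 2 * (T : ℝ) ^ 2 / (3 * δ)))))
    {p : EuclideanSpace ℝ (Fin d)} (hp : p ∈ D) :
    |trueMean ε k σ N x y s ω p -
        postMean k σ (sinceReset N (fun i => x i ω) s) (sinceReset N (fun i => y i ω) s) p| +
      √b * (√(trueVar ε k σ N x s ω p) - √(postVar k σ (sinceReset N (fun i => x i ω) s) p)) ≤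
      psi σ a₀ b₀ δ βT T N ε / 2 := by
  have hmod : s - s % N + s % N = s := Nat.sub_add_cancel (Nat.mod_le s N)
  have hlt : ∀ i : Fin (s % N), s - s % N + i < s := fun i => by
    have := i.2
    omega
  have hl := Real.log_nonneg (one_le_confidence hδ hT)
  have hβ0 : 0 ≤ βT := by linarith
  have h := hm.posterior_mismatch hε hσ hk (n := s % N) (Nat.mod_lt s hN) (s - s % N)
    (x := sinceReset N (fun i => x i ω) s) (fun i => hrun.mem _ ω) hp
    (f := fun i => reward ε g (s - s % N + i) ω (x (s - s % N + i) ω))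
    (ζ := fun i => z (s - s % N + i) ω) hb₀ (Real.sqrt_nonneg _)
    (Z := √2 * √(Real.log (2 * Real.pi ^ 2 * (T : ℝ) ^ 2 / (3 * δ)))) (by positivity)
    (mul_le_mul_of_nonneg_left (noise_level_le hδ hT ha₀) (Real.sqrt_nonneg 2)) (β := βT)
    (by rw [← Real.sqrt_mul (by norm_num)]; exact Real.sqrt_le_sqrt hβ) hβ0
    (Real.sqrt_nonneg b) (Real.sqrt_le_sqrt hb) (fun i => hf _ (hlt i) _ (hrun.mem _ _))
    (fun i => hz _ (hlt i))
  have hy : (fun i : Fin (s % N) => reward ε g (s - s % N + i) ω (x (s - s % N + i) ω)) +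
      (fun i : Fin (s % N) => z (s - s % N + i) ω) = sinceReset N (fun i => y i ω) s := by
    ext i
    exact (hrun.obs _ _).symm
  rw [hy, hmod] at h
  exact h

/-- The regret of a single step, when the confidence bounds hold. -/
theorem IsRun.step_le (hrun : IsRun D k σ (fun s => beta d r a₁ b₁ δ (s + 1)) N (reward ε g) z x y)
    (hm : IsModel μ D k σ g z) (hD : Convex ℝ D)
    (hcube : ∀ p ∈ D, ∀ j, p j ∈ Set.Icc 0 r)
    (hε : ε ∈ Set.Icc (0 : ℝ) 1) (hσ : 0 < σ) (hk : ∀ p ∈ D, k p p ≤ 1) (hN : 1 ≤ N)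
    (hδ : δ ∈ Set.Ioo (0 : ℝ) 1) (hb₀ : 0 ≤ b₀) (ha₀ : 0 ≤ a₀) (hb₁ : 0 ≤ b₁)
    {ω : Ω} {s : ℕ} (hs : s < T)
    (hf : ∀ i < s, ∀ p ∈ D, |reward ε g i ω p| ≤
      b₀ * √(Real.log (2 * (1 + a₀) * Real.pi ^ 2 * (T : ℝ) ^ 2 / (3 * δ))))
    (hz : ∀ i < s, |z i ω| ≤
      σ * (√2 * √(Real.log (2 * Real.pi ^ 2 * (T : ℝ) ^ 2 / (3 * δ)))))
    (hC1 : ContDiffOn ℝ 1 (reward ε g s ω) D)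
    (hder : ∀ j, ∀ p ∈ D, |partialD D j (reward ε g s ω) p| ≤
      b₁ * √(Real.log (2 * d * a₁ * Real.pi ^ 2 * ((s + 1 : ℕ) : ℝ) ^ 2 / (3 * δ))))
    (hgrid : 1 ≤ cells d r a₁ b₁ δ (s + 1) →
      ∀ p ∈ D, ∃ c ∈ D,
        ∑ j, |p j - c j| ≤ d * (r / (2 * ⌊cells d r a₁ b₁ δ (s + 1)⌋₊)) ∧
        reward ε g s ω c - trueMean ε k σ N x y s ω c ≤
          √(beta d r a₁ b₁ δ (s + 1)) * √(trueVar ε k σ N x s ω c))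
    (hquery : 1 ≤ cells d r a₁ b₁ δ (s + 1) →
      trueMean ε k σ N x y s ω (x s ω) - reward ε g s ω (x s ω) ≤
        √(beta d r a₁ b₁ δ (s + 1)) * √(trueVar ε k σ N x s ω (x s ω)))
    {p : EuclideanSpace ℝ (Fin d)} (hp : p ∈ D) :
    reward ε g s ω p - reward ε g s ω (x s ω) ≤ 1 / ((s + 1 : ℕ) : ℝ) ^ 2 +
      2 * (√(beta d r a₁ b₁ δ T) * √(postVar k σ (sinceReset N (fun i => x i ω) s) (x s ω))) +
      psi σ a₀ b₀ δ (beta d r a₁ b₁ δ T) T N ε := by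
  set τ := cells d r a₁ b₁ δ (s + 1) with hτ
  set L := b₁ * √(Real.log (2 * d * a₁ * Real.pi ^ 2 * ((s + 1 : ℕ) : ℝ) ^ 2 / (3 * δ))) with hL
  have hL0 : 0 ≤ L := by positivity
  have hs0 : (0 : ℝ) < ((s + 1 : ℕ) : ℝ) := by positivity
  have hτL : L * (d * r) = τ / ((s + 1 : ℕ) : ℝ) ^ 2 := by
    rw [hτ, hL, cells]
    field_simp
  have hlip : ∀ p ∈ D, ∀ q ∈ D, reward ε g s ω p - reward ε g s ω q ≤ L * ∑ j, |p j - q j| :=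
    fun p hp q hq => (le_abs_self _).trans (abs_sub_le_of_partialD_le hD hC1 hder hq hp)
  have hψ := psi_nonneg (σ := σ) (a₀ := a₀) (δ := δ) (T := T) (N := N) hε.1 hb₀
    (beta d r a₁ b₁ δ T)
  have hx := hrun.mem s ω
  -- If τ < 1 there is no grid and β may be negative, but then the Lipschitz bound across the whole
  -- cube is already at most 1/t².
  rcases lt_or_ge τ 1 with h | h
  · have h1 := hlip p hp _ hx
    have h2 : ∑ j, |p j - x s ω j| ≤ d * r := by
      calc _ ≤ ∑ _j : Fin d, r := Finset.sum_le_sum fun j _ => by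
            obtain ⟨h3, h4⟩ := hcube p hp j
            obtain ⟨h5, h6⟩ := hcube _ hx j
            exact abs_sub_le_iff.2 ⟨by linarith, by linarith⟩
        _ = _ := by simp
    have h3 : τ / ((s + 1 : ℕ) : ℝ) ^ 2 ≤ 1 / ((s + 1 : ℕ) : ℝ) ^ 2 := by gcongr
    have h4 := mul_le_mul_of_nonneg_left h2 hL0
    have h5 : 0 ≤ 2 * (√(beta d r a₁ b₁ δ T) *
      √(postVar k σ (sinceReset N (fun i => x i ω) s) (x s ω))) := by positivity
    linarith
  · have hT : 1 ≤ T := by omega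
    have hr := (pos_of_one_le_cells hb₁ h).le
    have hβ := beta_mono (a := a₁) (d := d) hδ.1 hr hb₁ (Nat.le_add_left 1 s) hs h
    have hτT := h.trans (cells_mono (a := a₁) (δ := δ) (d := d) hr hb₁ (Nat.le_add_left 1 s) hs)
    have hβT := two_log_le_beta hτT
    obtain ⟨c, hc, hpc, hup⟩ := hgrid h p hp
    have hmis : ∀ q ∈ D, _ := fun q hq =>
      hrun.mismatch hm hε hσ hk hN hδ hb₀ ha₀ hT hβT hβ hf hz (p := q) hq
    have hstep := ucb_step hup (hquery h) (hmis c hc) (hmis _ hx) (hrun.argmax s ω c hc)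
    have h1 := hlip p hp c hc
    have h2 : L * ∑ j, |p j - c j| ≤ 1 / ((s + 1 : ℕ) : ℝ) ^ 2 := by
      -- Points lie within half a cell width of a centre in each coordinate, and this factor 2 makes
      -- up for rounding τ down.
      have hfl : τ ≤ 2 * ⌊τ⌋₊ := by
        have h3 := Nat.lt_floor_add_one τ
        have h4 : (1 : ℝ) ≤ ⌊τ⌋₊ := by exact_mod_cast (Nat.one_le_floor_iff τ).2 h
        linarith
      have hτ0 : 0 < τ := by linarith
      calc L * ∑ j, |p j - c j| ≤ L * (d * (r / τ)) := by
            gcongr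
            refine hpc.trans ?_
            gcongr
        _ = L * (d * r) / τ := by ring
        _ = _ := by
          rw [hτL]
          field_simp
    have h3 : √(beta d r a₁ b₁ δ (s + 1)) ≤ √(beta d r a₁ b₁ δ T) := Real.sqrt_le_sqrt hβ
    have h4 := mul_le_mul_of_nonneg_right h3
      (Real.sqrt_nonneg (postVar k σ (sinceReset N (fun i => x i ω) s) (x s ω)))
    linarith

theorem IsRun.regret_le {Ω : Type*} {z : ℕ → Ω → ℝ} {x : ℕ → Ω → EuclideanSpace ℝ (Fin d)}
    {y : ℕ → Ω → ℝ} {f : ℕ → Ω → EuclideanSpace ℝ (Fin d) → ℝ}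
    (hrun : IsRun D k σ β N f z x y) (hpos : IsPosKernel D k) (hσ : 0 < σ)
    (hk : ∀ p ∈ D, k p p ≤ 1) (hN : 1 ≤ N) {ω : Ω} {βT Ψ : ℝ}
    (hstep : ∀ s < T, ∀ p ∈ D, f s ω p - f s ω (x s ω) ≤ 1 / ((s + 1 : ℕ) : ℝ) ^ 2 +
      2 * (√βT * √(postVar k σ (sinceReset N (fun i => x i ω) s) (x s ω))) + Ψ) :
    regret D f x T ω ≤ √(8 / Real.log (1 + (σ ^ 2)⁻¹) * T * βT * ((T : ℝ) / N + 1) *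
      maxInfoGain D k σ N) + 2 + T * Ψ := by
  set v : ℕ → ℝ := fun s => postVar k σ (sinceReset N (fun i => x i ω) s) (x s ω) with hv
  have hv0 : ∀ s, 0 ≤ v s := fun s =>
    hpos.postVar_nonneg hσ (fun i => hrun.mem _ ω) (hrun.mem s ω)
  have h1 : regret D f x T ω ≤
      ∑ s ∈ Finset.range T, (1 / ((s + 1 : ℕ) : ℝ) ^ 2 + 2 * (√βT * √(v s)) + Ψ) := by
    refine Finset.sum_le_sum fun s hs => ?_
    have : sSup (f s ω '' D) ≤ f s ω (x s ω) +
        (1 / ((s + 1 : ℕ) : ℝ) ^ 2 + 2 * (√βT * √(v s)) + Ψ) := by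
      refine csSup_le ⟨_, Set.mem_image_of_mem _ (hrun.mem s ω)⟩ ?_
      rintro _ ⟨p, hp, rfl⟩
      have := hstep s (Finset.mem_range.1 hs) p hp
      linarith
    linarith
  rw [Finset.sum_add_distrib, Finset.sum_add_distrib, Finset.sum_const, Finset.card_range,
    nsmul_eq_mul, ← Finset.mul_sum, ← Finset.mul_sum] at h1
  have h2 : ∑ s ∈ Finset.range T, 1 / ((s + 1 : ℕ) : ℝ) ^ 2 ≤ 2 := by
    refine (sum_inv_sq_le T).trans ?_
    nlinarith [Real.pi_lt_d2, Real.pi_pos]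
  have h3 := hpos.sum_postVar_le hσ hk (x := fun i => x i ω) (fun i => hrun.mem i ω) hN T
  have h4 : 2 * (√βT * ∑ s ∈ Finset.range T, √(v s)) ≤
      √(8 / Real.log (1 + (σ ^ 2)⁻¹) * T * βT * ((T : ℝ) / N + 1) * maxInfoGain D k σ N) := by
    rcases le_or_gt βT 0 with hβ | hβ
    · rw [Real.sqrt_eq_zero_of_nonpos hβ]
      simp
    · refine Real.le_sqrt_of_sq_le ?_
      have h5 := pow_le_pow_left₀ (Finset.sum_nonneg fun s _ => Real.sqrt_nonneg _)
        (sum_sqrt_le (T := T) hv0) 2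
      rw [Real.sq_sqrt (mul_nonneg (Nat.cast_nonneg T) (Finset.sum_nonneg fun s _ => hv0 s))] at h5
      -- The 8 in C₁ is 4, from squaring the confidence width, times the 2 in the sum of variances.
      calc (2 * (√βT * ∑ s ∈ Finset.range T, √(v s))) ^ 2 =
            4 * βT * (∑ s ∈ Finset.range T, √(v s)) ^ 2 := by
            rw [mul_pow, mul_pow, Real.sq_sqrt hβ.le]
            ring
        _ ≤ 4 * βT * (T * (2 / Real.log (1 + (σ ^ 2)⁻¹) * ((T : ℝ) / N + 1) *
              maxInfoGain D k σ N)) := by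
            gcongr
            exact h5.trans (by gcongr)
        _ = _ := by ring
  linarith

end Regret

end RGPUCB

end

/-! ### Assembling the good event -/

theorem theorem2 {Ω : Type*} [MeasurableSpace Ω] (μ : Measure Ω) [IsProbabilityMeasure μ]
    (d : ℕ) (r : ℝ) (D : Set (EuclideanSpace ℝ (Fin d)))
    (hDcompact : IsCompact D) (hDconvex : Convex ℝ D)
    (hDcube : ∀ p ∈ D, ∀ j, p j ∈ Set.Icc 0 r)
    (k : EuclideanSpace ℝ (Fin d) → EuclideanSpace ℝ (Fin d) → ℝ)
    (hk : ∀ p ∈ D, k p p ≤ 1)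
    (σ : ℝ) (hσ : 0 < σ) (ε : ℝ) (hε : ε ∈ Set.Icc (0 : ℝ) 1)
    (g : ℕ → Ω → EuclideanSpace ℝ (Fin d) → ℝ) (z : ℕ → Ω → ℝ)
    (hmodel : RGPUCB.IsModel μ D k σ g z)
    (hsmooth : ∀ s, RGPUCB.HasC1Paths μ D (g s))
    (a₀ b₀ a₁ b₁ : ℝ) (hb₀ : 0 < b₀) (hb₁ : 0 < b₁)
    (htail₀ : RGPUCB.SupTail μ D k a₀ b₀)
    (htail₁ : RGPUCB.DerivTail μ D k a₁ b₁)
    (δ : ℝ) (hδ : δ ∈ Set.Ioo (0 : ℝ) 1)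
    (N : ℕ) (hN : 1 ≤ N)
    (x : ℕ → Ω → EuclideanSpace ℝ (Fin d)) (y : ℕ → Ω → ℝ)
    (hrun : RGPUCB.IsRun D k σ (fun s => RGPUCB.beta d r a₁ b₁ δ (s + 1)) N
      (RGPUCB.reward ε g) z x y)
    (T : ℕ) (hT : 1 ≤ T) :
    1 - δ ≤ μ.real {ω | RGPUCB.regret D (RGPUCB.reward ε g) x T ω ≤
      √(8 / Real.log (1 + (σ ^ 2)⁻¹) * T * RGPUCB.beta d r a₁ b₁ δ T *
          ((T : ℝ) / N + 1) * RGPUCB.maxInfoGain D k σ N) +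
        2 + T * RGPUCB.psi σ a₀ b₀ δ (RGPUCB.beta d r a₁ b₁ δ T) T N ε} := by
  have hD : MeasurableSet D := hDcompact.measurableSet
  obtain ⟨ω₀⟩ : Nonempty Ω := μ.nonempty_of_neZero
  have hne : D.Nonempty := ⟨x 0 ω₀, hrun.mem 0 ω₀⟩
  have hδ0 := hδ.1
  have hf := RGPUCB.isCenteredGP_reward hε hmodel.gp hmodel.indep_gp
  have hf1 := RGPUCB.hasC1Paths_reward (ε := ε) hsmooth
  have hcont : ∀ s, ∀ᵐ ω ∂μ, ContinuousOn (RGPUCB.reward ε g s ω) D := fun s => by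
    filter_upwards [hf1 s] with ω hω using hω.continuousOn
  have ha₀ : 0 ≤ a₀ := htail₀.nonneg (hf 0) (hf1 0)
  choose c hcD hc using fun (s : ℕ) (h : 1 ≤ RGPUCB.cells d r a₁ b₁ δ (s + 1)) =>
    RGPUCB.exists_grid hDcompact hDconvex hne (RGPUCB.pos_of_one_le_cells hb₁.le h) hDcube
      ((Nat.one_le_floor_iff _).2 h)
  let Λ := √(Real.log (2 * (1 + a₀) * Real.pi ^ 2 * (T : ℝ) ^ 2 / (3 * δ)))
  let Z := √(Real.log (2 * Real.pi ^ 2 * (T : ℝ) ^ 2 / (3 * δ)))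
  let L : ℕ → ℝ := fun s =>
    b₁ * √(Real.log (2 * d * a₁ * Real.pi ^ 2 * ((s + 1 : ℕ) : ℝ) ^ 2 / (3 * δ)))
  let B : ℕ → ℝ := fun s => RGPUCB.beta d r a₁ b₁ δ (s + 1)
  let m := RGPUCB.trueMean ε k σ N x y
  let v := RGPUCB.trueVar ε k σ N x
  let f := RGPUCB.reward ε g
  let S₀ : Set Ω := {ω | ¬∀ s, ContDiffOn ℝ 1 (f s ω) D}
  let S₁ : ℕ → Set Ω := fun s => {ω | ∃ j, ∃ p ∈ D, L s < |RGPUCB.partialD D j (f s ω) p|}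
  -- The grid c s h exists only given h : 1 ≤ cells; otherwise this event is empty.
  let S₂ : ℕ → Set Ω := fun s =>
    {ω | ∃ h i, √(B s) * √(v s ω (c s h i)) < f s ω (c s h i) - m s ω (c s h i)}
  let S₃ : ℕ → Set Ω := fun s => {ω | 1 ≤ RGPUCB.cells d r a₁ b₁ δ (s + 1) ∧
    √(B s) * √(v s ω (x s ω)) < m s ω (x s ω) - f s ω (x s ω)}
  let S₄ : ℕ → Set Ω := fun s => {ω | ∃ p ∈ D, b₀ * Λ < |f s ω p|}
  let S₅ : ℕ → Set Ω := fun s => {ω | σ * (√2 * Z) < |z s ω|}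
  have h₀ : μ.real S₀ = 0 := by
    have : μ S₀ = 0 := ae_iff.1 (ae_all_iff.2 hf1)
    simp [Measure.real, this]
  have h₁ : ∀ s, μ.real (S₁ s) ≤ RGPUCB.failProb δ (s + 1) := fun s =>
    htail₁.measureReal_le hb₁ (hf s) (hf1 s) hδ0 (Nat.le_add_left 1 s)
  have h₂ : ∀ s, μ.real (S₂ s) ≤ RGPUCB.failProb δ (s + 1) := by
    intro s
    by_cases h : 1 ≤ RGPUCB.cells d r a₁ b₁ δ (s + 1)
    · have e : S₂ s =
          {ω | ∃ i, √(B s) * √(v s ω (c s h i)) < f s ω (c s h i) - m s ω (c s h i)} := by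
        ext ω
        exact ⟨fun ⟨_, hω⟩ => hω, fun hω => ⟨h, hω⟩⟩
      rw [e, ← RGPUCB.exp_neg_beta_le hδ0 (Nat.le_add_left 1 s) h]
      refine (hrun.measureReal_grid_le hmodel hε hσ hD hcont s (hcD s h)
        (RGPUCB.beta_nonneg hδ (Nat.le_add_left 1 s) h)).trans ?_
      rw [Fintype.card_fun, Fintype.card_fin, Fintype.card_fin, Nat.cast_pow]
      gcongr
      exact Nat.floor_le (by linarith)
    · have e : S₂ s = ∅ := by
        ext ω
        exact ⟨fun ⟨h', _⟩ => h h', fun hω => hω.elim⟩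
      rw [e, measureReal_empty]
      exact (RGPUCB.failProb_pos hδ0 (Nat.le_add_left 1 s)).le
  have h₃ : ∀ s, μ.real (S₃ s) ≤ RGPUCB.failProb δ (s + 1) := by
    intro s
    by_cases h : 1 ≤ RGPUCB.cells d r a₁ b₁ δ (s + 1)
    · have e : S₃ s =
          {ω | √(B s) * √(v s ω (x s ω)) < m s ω (x s ω) - f s ω (x s ω)} := by
        ext ω
        exact ⟨fun hω => hω.2, fun hω => ⟨h, hω⟩⟩
      rw [e, ← RGPUCB.exp_neg_beta_le hδ0 (Nat.le_add_left 1 s) h]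
      refine (hrun.measureReal_query_le hmodel hε hσ hD hcont s
        (RGPUCB.beta_nonneg hδ (Nat.le_add_left 1 s) h)).trans ?_
      exact le_mul_of_one_le_left (Real.exp_pos _).le (one_le_pow₀ h)
    · have e : S₃ s = ∅ := by
        ext ω
        exact ⟨fun hω => h hω.1, fun hω => hω.elim⟩
      rw [e, measureReal_empty]
      exact (RGPUCB.failProb_pos hδ0 (Nat.le_add_left 1 s)).le
  have h₄ : ∀ s, μ.real (S₄ s) ≤ RGPUCB.failProb δ T := fun s =>
    htail₀.measureReal_le hb₀ (hf s) (hf1 s) hδ0 hT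
  have h₅ : ∀ s, μ.real (S₅ s) ≤ 2 * RGPUCB.failProb δ T := fun s =>
    RGPUCB.measureReal_noise_le (hmodel.noise_measurable s) hσ (hmodel.noise_law s) hδ0 hT
  -- Derivative, grid and query events cost δ/4 each over all times; the bounds on past rewards and
  -- noise share the last δ/4.
  let S : Set Ω := S₀ ∪ ((⋃ s ∈ Finset.range T, (S₁ s ∪ S₂ s ∪ S₃ s)) ∪
    ⋃ s ∈ Finset.range (T - 1), (S₄ s ∪ S₅ s))
  have hS : μ.real S ≤ δ := by
    have e1 : μ.real (⋃ s ∈ Finset.range T, (S₁ s ∪ S₂ s ∪ S₃ s)) ≤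
        ∑ s ∈ Finset.range T, 3 * RGPUCB.failProb δ (s + 1) :=
      (measureReal_biUnion_finset_le _ _).trans (Finset.sum_le_sum fun s _ => by
        have u1 := measureReal_union_le (μ := μ) (S₁ s ∪ S₂ s) (S₃ s)
        have u2 := measureReal_union_le (μ := μ) (S₁ s) (S₂ s)
        linarith [h₁ s, h₂ s, h₃ s])
    have e2 : μ.real (⋃ s ∈ Finset.range (T - 1), (S₄ s ∪ S₅ s)) ≤
        ∑ _s ∈ Finset.range (T - 1), 3 * RGPUCB.failProb δ T :=
      (measureReal_biUnion_finset_le _ _).trans (Finset.sum_le_sum fun s _ => by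
        have u1 := measureReal_union_le (μ := μ) (S₄ s) (S₅ s)
        linarith [h₄ s, h₅ s])
    rw [← Finset.mul_sum] at e1
    rw [Finset.sum_const, Finset.card_range, nsmul_eq_mul] at e2
    have u1 := measureReal_union_le (μ := μ) S₀ ((⋃ s ∈ Finset.range T, (S₁ s ∪ S₂ s ∪ S₃ s)) ∪
      ⋃ s ∈ Finset.range (T - 1), (S₄ s ∪ S₅ s))
    have u2 := measureReal_union_le (μ := μ) (⋃ s ∈ Finset.range T, (S₁ s ∪ S₂ s ∪ S₃ s))
      (⋃ s ∈ Finset.range (T - 1), (S₄ s ∪ S₅ s))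
    have u3 := RGPUCB.sum_failProb_le hδ0.le T
    have u4 := RGPUCB.sub_one_mul_failProb_le hδ0.le hT
    change μ.real (S₀ ∪ _) ≤ δ
    linarith
  have hgood : ∀ ω ∉ S, RGPUCB.regret D f x T ω ≤
      √(8 / Real.log (1 + (σ ^ 2)⁻¹) * T * RGPUCB.beta d r a₁ b₁ δ T *
          ((T : ℝ) / N + 1) * RGPUCB.maxInfoGain D k σ N) +
        2 + T * RGPUCB.psi σ a₀ b₀ δ (RGPUCB.beta d r a₁ b₁ δ T) T N ε := by
    intro ω hω
    simp only [S, Set.mem_union, Set.mem_iUnion, not_or, not_exists, Finset.mem_range] at hω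
    obtain ⟨g₀, g₁, g₂⟩ := hω
    have g₀' : ∀ s, ContDiffOn ℝ 1 (f s ω) D := not_not.1 g₀
    refine hrun.regret_le hmodel.isPosKernel hσ hk hN fun s hs p hp => ?_
    obtain ⟨⟨k₁, k₂⟩, k₃⟩ := g₁ s hs
    have k₂' : ¬∃ h i, √(B s) * √(v s ω (c s h i)) < f s ω (c s h i) - m s ω (c s h i) := k₂
    have k₁' : ¬∃ j, ∃ p ∈ D, L s < |RGPUCB.partialD D j (f s ω) p| := k₁
    refine hrun.step_le hmodel hDconvex hDcube hε hσ hk hN hδ hb₀.le ha₀ hb₁.le hs ?_ ?_ (g₀' s)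
      ?_ ?_ ?_ hp
    · intro i hi q hq
      exact not_lt.1 fun h => (g₂ i (by omega)).1 ⟨q, hq, h⟩
    · intro i hi
      exact not_lt.1 fun h => (g₂ i (by omega)).2 h
    · intro j q hq
      exact not_lt.1 fun h => k₁' ⟨j, q, hq, h⟩
    · intro h q hq
      obtain ⟨i, hi⟩ := hc s h q hq
      exact ⟨c s h i, hcD s h i, hi, not_lt.1 fun h' => k₂' ⟨h, i, h'⟩⟩
    · intro h
      exact not_lt.1 fun h' => k₃ ⟨h, h'⟩
  -- Neither S nor the regret event need be known measurable, so subadditivity over a cover replaces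
  -- taking complements.
  have hcover : (1 : ℝ) ≤ μ.real S + μ.real {ω | RGPUCB.regret D f x T ω ≤
      √(8 / Real.log (1 + (σ ^ 2)⁻¹) * T * RGPUCB.beta d r a₁ b₁ δ T *
          ((T : ℝ) / N + 1) * RGPUCB.maxInfoGain D k σ N) +
        2 + T * RGPUCB.psi σ a₀ b₀ δ (RGPUCB.beta d r a₁ b₁ δ T) T N ε} := by
    refine (probReal_univ (μ := μ)).symm.le.trans ?_
    refine (measureReal_mono fun ω _ => ?_).trans (measureReal_union_le _ _)
    by_cases hω : ω ∈ S
    · exact Or.inl hω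
    · exact Or.inr (hgood ω hω)
  linarith
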